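/- Let $M$ be a connected closed oriented surface (of any genus) with the structure of a polyhedron with $n$ faces $f_1,\dots,f_n$: $M$ is obtained from $n$ oriented polygons, each with at least one side, by gluing all their sides in pairs, reversing orientation. Assume that no face is a neighbor of itself and that no two faces share more than one edge. Let $V$ be the set of vertices, choose a point $x_j$ in the interior of each face $f_j$, and put $X=\{x_1,\dots,x_n\}$. Let $M^{[n]}$ be the space of $n$ distinct unordered points of $M$. A loop $\gamma$ in $M^{[n]}$ based at $X$ is written $\gamma=\{\gamma_1,\dots,\gamma_n\}$ with $\gamma_j$ a curve in $M$ and $\gamma_j(0)=x_j$. Let $A:\pi_1(M^{[n]},X)\to H_1(M;\mathbb{Z})$ be the homomorphism that sends $[\gamma]$ to the class of the cycle $\gamma_1+\dots+\gamma_n$, and let $B_n^0=\ker A$. A loop $\gamma$ is called *enumerable* if no $\gamma_j$ meets $V$, if the curves $\gamma_j$ are on edges for only finitely many times $t$, and if, whenever $\gamma_j(t)$ is on an edge, $\gamma_j(t-\varepsilon)$ and $\gamma_j(t+\varepsilon)$ lie in different faces for all small $\varepsilon>0$. Attach to each edge $e$ an orientation of the dual edge, which joins the two faces separated by $e$; a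 crossing of $e$ by some $\gamma_j$ is a crossing of $e^+$ if it goes in the direction of the dual edge, and of $e^-$ otherwise. An enumerable loop $\gamma$ is called *balanced* if, for every edge $e$, the total number of crossings of $e^+$ by $\gamma_1,\dots,\gamma_n$ is equal to the total number of crossings of $e^-$. **Theorem.** For every $b\in B_n^0$ there is a balanced loop $\gamma$ in $M^{[n]}$ based at $X$ with $[\gamma]=b$. -/

import Mathlib

universe u

namespace SurfaceBraid

open CategoryTheory Topology unitInterval

/-- Ordered configurations: `n`-tuples of pairwise distinct points of `M`. -/
def Conf (n : ℕ) (M : Type u) : Type u := {x : Fin n → M // Function.Injective x}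

section Configurations

variable {n : ℕ} {M : Type u}

/-- Permutations act on ordered configurations by relabelling the points. -/
instance : MulAction (Equiv.Perm (Fin n)) (Conf n M) where
  smul g x := ⟨fun i => x.1 (g⁻¹ i), x.2.comp (Equiv.injective _)⟩
  one_smul _ := rfl
  mul_smul _ _ _ := rfl

theorem smul_val (g : Equiv.Perm (Fin n)) (x : Conf n M) (i : Fin n) :
    (g • x).1 i = x.1 (g⁻¹ i) := rfl

variable [TopologicalSpace M]

/-- Ordered configurations carry the subspace topology of the product topology. -/
instance : TopologicalSpace (Conf n M) :=
  inferInstanceAs (TopologicalSpace {x : Fin n → M // Function.Injective x})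

variable (n M) in
/-- The space `M^{[n]}` of `n` distinct, unordered points of `M`, with the quotient topology. -/
abbrev UConf : Type u := MulAction.orbitRel.Quotient (Equiv.Perm (Fin n)) (Conf n M)

/-- The unordered configuration underlying an ordered one. -/
def forget (x : Conf n M) : UConf n M := Quotient.mk (MulAction.orbitRel _ _) x

/-- The `i`-th point of an ordered configuration. -/
def coord (i : Fin n) : C(Conf n M, M) :=
  ⟨fun x => x.1 i, (continuous_apply i).comp continuous_subtype_val⟩

theorem isQuotientCoveringMap_forget [T2Space M] :
    IsQuotientCoveringMap (forget : Conf n M → UConf n M) (Equiv.Perm (Fin n)) where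
  toIsQuotientMap := isQuotientMap_quotient_mk'
  continuous_const_smul g := by
    refine Continuous.subtype_mk (continuous_pi fun i => ?_) _
    exact (coord (g⁻¹ i)).continuous
  apply_eq_iff_mem_orbit := Quotient.eq''
  disjoint x := by
    obtain ⟨U, hU, hdis⟩ := (Set.finite_range x.1).t2_separation
    refine ⟨⋂ i, {y | y.1 i ∈ U (x.1 i)}, ?_, fun g hg => ?_⟩
    · refine (isOpen_iInter_of_finite fun i => ?_).mem_nhds (Set.mem_iInter.2 fun i => (hU _).1)
      exact (hU (x.1 i)).2.preimage (coord i).continuous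
    · obtain ⟨_, ⟨y, hy, rfl⟩, hy'⟩ := hg
      ext1 i
      by_contra hne
      have h1 : y.1 i ∈ U (x.1 i) := Set.mem_iInter.1 hy i
      have h2 : y.1 (g⁻¹ (g i)) ∈ U (x.1 (g i)) := Set.mem_iInter.1 hy' (g i)
      rw [show g⁻¹ (g i) = i from g.symm_apply_apply i] at h2
      have := hdis (Set.mem_range_self i) (Set.mem_range_self (g i))
        (fun h => hne (x.2 h).symm)
      exact Set.disjoint_left.1 this h1 h2

theorem isCoveringMap_forget [T2Space M] : IsCoveringMap (forget : Conf n M → UConf n M) :=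
  isQuotientCoveringMap_forget.isCoveringMap

/-- The lift to ordered configurations, starting at `x`, of a path of unordered configurations. -/
noncomputable def lift [T2Space M] (x : Conf n M) {c : UConf n M} (γ : Path (forget x) c) :
    C(I, Conf n M) :=
  isCoveringMap_forget.liftPath γ x γ.source

/-- The constituent curve `γ_i` of `γ = {γ_1, …, γ_n}`, labelled by `γ_i(0) = x_i`. -/
noncomputable def strand [T2Space M] (x : Conf n M) {c : UConf n M} (γ : Path (forget x) c)
    (i : Fin n) : C(I, M) :=
  (coord i).comp (lift x γ)

theorem strand_zero [T2Space M] (x : Conf n M) {c : UConf n M} (γ : Path (forget x) c)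
    (i : Fin n) : strand x γ i 0 = x.1 i :=
  congrArg (fun y : Conf n M => y.1 i) (isCoveringMap_forget.liftPath_zero ..)

theorem exists_perm [T2Space M] (x : Conf n M) (γ : Path (forget x) (forget x)) :
    ∃ g : Equiv.Perm (Fin n), lift x γ 1 = g • x := by
  have h : forget (lift x γ 1) = forget x :=
    (congrFun ((isCoveringMap_forget (n := n) (M := M)).liftPath_lifts γ x γ.source) 1).trans γ.target
  obtain ⟨g, hg⟩ := isQuotientCoveringMap_forget.apply_eq_iff_mem_orbit.1 h
  exact ⟨g, hg.symm⟩

theorem homotopicRel_strand [T2Space M] (x : Conf n M) {c : UConf n M}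
    {γ δ : Path (forget x) c} (h : γ.Homotopic δ) (i : Fin n) :
    (strand x γ i).HomotopicRel (strand x δ i) {0, 1} :=
  (isCoveringMap_forget.homotopicRel_liftPath h x γ.source δ.source).map
    fun H => H.compContinuousMap (coord i)

theorem lift_trans [T2Space M] (x : Conf n M) (γ δ : Path (forget x) (forget x))
    (g : Equiv.Perm (Fin n)) (hg : lift x γ 1 = g • x) (t : I) :
    lift x (γ.trans δ) t =
      if h : (t : ℝ) ≤ 1 / 2 then
        lift x γ ⟨2 * t, (unitInterval.mul_pos_mem_iff zero_lt_two).2 ⟨t.2.1, h⟩⟩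
      else g • lift x δ ⟨2 * t - 1, unitInterval.two_mul_sub_one_mem_iff.2 ⟨(not_le.1 h).le, t.2.2⟩⟩ := by
  have h := isCoveringMap_forget.liftPath_trans (e := x) rfl γ δ
  have h' := DFunLike.congr_fun h t
  refine h'.trans ?_
  simp only [ContinuousMap.coe_coe, Path.trans_apply]
  split_ifs
  · rfl
  · have key : ((g • lift x δ ·) : I → Conf n M) = isCoveringMap_forget.liftPath δ
        (isCoveringMap_forget.liftPath γ x γ.source 1)
        (by simpa using congr($(isCoveringMap_forget.liftPath_lifts γ x γ.source) 1).symm) := by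
      rw [isCoveringMap_forget.eq_liftPath_iff]
      refine ⟨?_, ?_, ?_⟩
      · exact (isQuotientCoveringMap_forget.continuous_const_smul g).comp (lift x δ).continuous
      · ext s
        refine (isQuotientCoveringMap_forget.map_smul g).trans ?_
        exact congrFun (isCoveringMap_forget.liftPath_lifts δ x δ.source) s
      · have : lift x δ 0 = x := isCoveringMap_forget.liftPath_zero ..
        change g • lift x δ 0 = lift x γ 1
        rw [this, hg]
    exact (congrFun key _).symm

end Configurations
section Homology

variable (M : Type u) [TopologicalSpace M]

/-- The integers, as the coefficient module of singular homology. -/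
abbrev ZZ : ModuleCat.{u} ℤ := ModuleCat.of ℤ (ULift.{u} ℤ)

/-- The singular chain complex of `M` with integer coefficients. -/
noncomputable abbrev chains : ChainComplex (ModuleCat.{u} ℤ) ℕ :=
  (TopCat.toSSet.obj (TopCat.of M)).chainComplex ZZ

/-- The singular homology group `H_1(M; ℤ)`. -/
noncomputable abbrev H1 : ModuleCat.{u} ℤ := (chains M).homology 1

theorem H1_eq_singularHomology : H1 M =
    ((AlgebraicTopology.singularHomologyFunctor (ModuleCat.{u} ℤ) 1).obj ZZ).obj (TopCat.of M) :=
  rfl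

variable {M}

/-- The singular `1`-simplex given by a curve. -/
noncomputable def simplex (p : C(I, M)) : (TopCat.toSSet.obj (TopCat.of M)).obj (.op (.mk 1)) :=
  ((TopCat.of M).toSSetObjEquiv _).symm (p.comp (stdSimplexHomeomorphUnitInterval : C(_, _)))

/-- The singular `1`-chain `1 · p` given by a curve `p`, as a map from the coefficients. -/
noncomputable def chain (p : C(I, M)) : ZZ ⟶ (chains M).X 1 :=
  (TopCat.toSSet.obj (TopCat.of M)).ιChainComplex (simplex p)

noncomputable def pointChain (m : M) : ZZ.{u} ⟶ (chains M).X 0 :=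
  (TopCat.toSSet.obj (TopCat.of M)).ιChainComplex (TopCat.toSSetObj₀Equiv.symm (m : TopCat.of M))

theorem chain_d (p : C(I, M)) :
    chain p ≫ (chains M).d 1 0 = pointChain (p 1) - pointChain (p 0) := by
  have h0 : (TopCat.toSSet.obj (TopCat.of M)).δ 0 (simplex p) =
      TopCat.toSSetObj₀Equiv.symm (p 1 : TopCat.of M) := by
    apply (TopCat.toSSetObjEquiv _ _).injective
    ext z
    obtain rfl := Subsingleton.elim z (stdSimplex.vertex (X := Fin 1) 0)
    change p (stdSimplexHomeomorphUnitInterval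
      (stdSimplex.map (Fin.succAbove 0) (stdSimplex.vertex (X := Fin 1) 0))) = p 1
    rw [stdSimplex.map_vertex]
    rfl
  have h1 : (TopCat.toSSet.obj (TopCat.of M)).δ 1 (simplex p) =
      TopCat.toSSetObj₀Equiv.symm (p 0 : TopCat.of M) := by
    apply (TopCat.toSSetObjEquiv _ _).injective
    ext z
    obtain rfl := Subsingleton.elim z (stdSimplex.vertex (X := Fin 1) 0)
    change p (stdSimplexHomeomorphUnitInterval
      (stdSimplex.map (Fin.succAbove 1) (stdSimplex.vertex (X := Fin 1) 0))) = p 0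
    rw [stdSimplex.map_vertex]
    rfl
  rw [chain, SSet.ιChainComplex_d]
  simp [Fin.sum_univ_succ, h0, h1, pointChain, sub_eq_add_neg]

/-- The class of a singular chain modulo boundaries. -/
noncomputable def cl (p : C(I, M)) : ZZ ⟶ (chains M).opcycles 1 :=
  chain p ≫ (chains M).pOpcycles 1

theorem cl_of_triangle (T : C(stdSimplex ℝ (Fin 3), M)) (p q r : C(I, M))
    (h0 : ∀ z : stdSimplex ℝ (Fin 2), T (stdSimplex.map (Fin.succAbove 0) z) = q (stdSimplexHomeomorphUnitInterval z))
    (h1 : ∀ z : stdSimplex ℝ (Fin 2), T (stdSimplex.map (Fin.succAbove 1) z) = r (stdSimplexHomeomorphUnitInterval z))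
    (h2 : ∀ z : stdSimplex ℝ (Fin 2), T (stdSimplex.map (Fin.succAbove 2) z) = p (stdSimplexHomeomorphUnitInterval z)) :
    cl r = cl p + cl q := by
  let τ : (TopCat.toSSet.obj (TopCat.of M)).obj (.op (.mk 2)) :=
    ((TopCat.of M).toSSetObjEquiv _).symm T
  have e0 : (TopCat.toSSet.obj (TopCat.of M)).δ 0 τ = simplex q := by
    apply (TopCat.toSSetObjEquiv _ _).injective
    ext z
    exact h0 z
  have e1 : (TopCat.toSSet.obj (TopCat.of M)).δ 1 τ = simplex r := by
    apply (TopCat.toSSetObjEquiv _ _).injective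
    ext z
    exact h1 z
  have e2 : (TopCat.toSSet.obj (TopCat.of M)).δ 2 τ = simplex p := by
    apply (TopCat.toSSetObjEquiv _ _).injective
    ext z
    exact h2 z
  have h : ((TopCat.toSSet.obj (TopCat.of M)).ιChainComplex (R := ZZ) τ ≫ (chains M).d 2 1) ≫
      (chains M).pOpcycles 1 = 0 := by
    rw [Category.assoc, HomologicalComplex.d_pOpcycles, Limits.comp_zero]
  rw [SSet.ιChainComplex_d] at h
  simp [Fin.sum_univ_succ, Preadditive.add_comp, Preadditive.neg_comp] at h
  rw [e0, e1, e2] at h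
  change cl q + (-cl r + cl p) = 0 at h
  rw [eq_comm, ← sub_eq_zero, ← h]; abel

theorem face_apply (i : Fin 3) (z : stdSimplex ℝ (Fin 2)) (k : Fin 3) :
    stdSimplex.map (Fin.succAbove i) z k =
      (if Fin.succAbove i 0 = k then z 0 else 0) + (if Fin.succAbove i 1 = k then z 1 else 0) := by
  classical
  rw [stdSimplex.map_coe, FunOnFinite.linearMap_apply_apply, Finset.sum_filter,
    Fin.sum_univ_two]

/-- The affine function `a z₁ + b z₂` on the triangle, truncated to the unit interval. -/
noncomputable def affine (a b : ℝ) : C(stdSimplex ℝ (Fin 3), I) :=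
  ⟨fun z => Set.projIcc 0 1 zero_le_one (a * z.1 1 + b * z.1 2),
    continuous_projIcc.comp
      ((continuous_const.mul ((continuous_apply 1).comp continuous_subtype_val)).add
        (continuous_const.mul ((continuous_apply 2).comp continuous_subtype_val)))⟩

theorem affine_zero (a b : ℝ) (z : stdSimplex ℝ (Fin 2)) :
    affine a b (stdSimplex.map (Fin.succAbove 0) z) =
      Set.projIcc 0 1 zero_le_one (a * z 0 + b * z 1) := by
  have h1 := face_apply 0 z 1
  have h2 := face_apply 0 z 2
  simp at h1 h2
  exact congrArg (Set.projIcc (0 : ℝ) 1 zero_le_one) (congrArg₂ (fun u v => a * u + b * v) h1 h2)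

theorem affine_one (a b : ℝ) (z : stdSimplex ℝ (Fin 2)) :
    affine a b (stdSimplex.map (Fin.succAbove 1) z) =
      Set.projIcc 0 1 zero_le_one (b * z 1) := by
  have h1 := face_apply 1 z 1
  have h2 := face_apply 1 z 2
  have e : (Fin.succAbove (1 : Fin 3) (1 : Fin 2)) = 2 := rfl
  simp [e] at h1 h2
  refine congrArg (Set.projIcc (0 : ℝ) 1 zero_le_one)
    ((congrArg₂ (fun u v => a * u + b * v) h1 h2).trans ?_)
  simp

theorem affine_two (a b : ℝ) (z : stdSimplex ℝ (Fin 2)) :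
    affine a b (stdSimplex.map (Fin.succAbove 2) z) =
      Set.projIcc 0 1 zero_le_one (a * z 1) := by
  have h1 := face_apply 2 z 1
  have h2 := face_apply 2 z 2
  have e : (Fin.succAbove (2 : Fin 3) (1 : Fin 2)) = 1 := rfl
  have e0 : (Fin.succAbove (2 : Fin 3) (0 : Fin 2)) = 0 := rfl
  simp [e, e0] at h1 h2
  refine congrArg (Set.projIcc (0 : ℝ) 1 zero_le_one)
    ((congrArg₂ (fun u v => a * u + b * v) h1 h2).trans ?_)
  simp

theorem homeo_eq (z : stdSimplex ℝ (Fin 2)) :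
    stdSimplexHomeomorphUnitInterval z = Set.projIcc 0 1 zero_le_one (z 1) :=
  (Set.projIcc_val zero_le_one (stdSimplexHomeomorphUnitInterval z)).symm

/-- Modulo boundaries, the chain of a concatenation is the sum of the chains. -/
theorem cl_concat (p q r : C(I, M))
    (hp : ∀ s : ℝ, 0 ≤ s → s ≤ 1 → r (Set.projIcc 0 1 zero_le_one (s / 2)) =
      p (Set.projIcc 0 1 zero_le_one s))
    (hq : ∀ s : ℝ, 0 ≤ s → s ≤ 1 → r (Set.projIcc 0 1 zero_le_one ((1 + s) / 2)) =
      q (Set.projIcc 0 1 zero_le_one s)) :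
    cl r = cl p + cl q := by
  refine cl_of_triangle (r.comp (affine (1 / 2) 1)) p q r (fun z => ?_) (fun z => ?_) fun z => ?_
  · have := stdSimplex.add_eq_one z
    rw [ContinuousMap.comp_apply, affine_zero, homeo_eq, ← hq (z 1) (by simp) (by simp)]
    congr 2
    linarith
  · rw [ContinuousMap.comp_apply, affine_one, homeo_eq, one_mul]
  · rw [ContinuousMap.comp_apply, affine_two, homeo_eq, ← hp (z 1) (by simp) (by simp)]
    congr 2
    ring

theorem cl_const (m : M) : cl (ContinuousMap.const I m) = 0 := by
  have h := cl_concat (.const I m) (.const I m) (.const I m) (fun _ _ _ => rfl) fun _ _ _ => rfl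
  simpa using h

/-- Curves homotopic relative to their endpoints have the same class modulo boundaries. -/
theorem cl_homotopic {p q : C(I, M)} (h : p.HomotopicRel q {0, 1}) : cl p = cl q := by
  obtain ⟨F⟩ := h
  let D : C(I, M) := F.toContinuousMap.comp ((ContinuousMap.id I).prodMk (.id I))
  have hF0 : ∀ s : I, F (s, 0) = p 0 := fun s => F.eq_fst s (by simp)
  have hF1 : ∀ s : I, F (s, 1) = p 1 := fun s => F.eq_fst s (by simp)
  have e0 : Set.projIcc (0 : ℝ) 1 zero_le_one 0 = 0 := Set.projIcc_left _
  have e1 : Set.projIcc (0 : ℝ) 1 zero_le_one 1 = 1 := Set.projIcc_right _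
  have t1 : cl D = cl p + cl (ContinuousMap.const I (p 1)) := by
    refine cl_of_triangle (F.toContinuousMap.comp ((affine 0 1).prodMk (affine 1 1))) _ _ _
      (fun z => ?_) (fun z => ?_) fun z => ?_
    · change F (affine 0 1 _, affine 1 1 _) = _
      have := stdSimplex.add_eq_one z
      rw [affine_zero, affine_zero, one_mul, one_mul, this, e1, hF1]
      rfl
    · change F (affine 0 1 _, affine 1 1 _) = F (_, _)
      rw [affine_one, affine_one, one_mul, homeo_eq]
      rfl
    · change F (affine 0 1 _, affine 1 1 _) = _
      rw [affine_two, affine_two, one_mul, zero_mul, homeo_eq, e0]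
      exact F.apply_zero _
  have t2 : cl D = cl (ContinuousMap.const I (p 0)) + cl q := by
    refine cl_of_triangle (F.toContinuousMap.comp ((affine 1 1).prodMk (affine 0 1))) _ _ _
      (fun z => ?_) (fun z => ?_) fun z => ?_
    · change F (affine 1 1 _, affine 0 1 _) = _
      have := stdSimplex.add_eq_one z
      rw [affine_zero, affine_zero, one_mul, one_mul, this, e1, zero_mul, zero_add, homeo_eq]
      exact F.apply_one _
    · change F (affine 1 1 _, affine 0 1 _) = F (_, _)
      rw [affine_one, affine_one, one_mul, homeo_eq]
      rfl
    · change F (affine 1 1 _, affine 0 1 _) = _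
      rw [affine_two, affine_two, one_mul, zero_mul, e0, hF0]
      rfl
  rw [cl_const] at t1 t2
  rw [← add_zero (cl p), ← t1, t2, zero_add]

/-- The homology class, as a map from the coefficients, of a finite sum of curves which is
a cycle. -/
noncomputable def cycleClass {n : ℕ} (p : Fin n → C(I, M))
    (h : (∑ i, chain (p i)) ≫ (chains M).d 1 0 = 0) : ZZ ⟶ H1 M :=
  (chains M).liftCycles (∑ i, chain (p i)) 0 (by simp) h ≫ (chains M).homologyπ 1

theorem cycleClass_ι {n : ℕ} (p : Fin n → C(I, M))
    (h : (∑ i, chain (p i)) ≫ (chains M).d 1 0 = 0) :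
    cycleClass p h ≫ (chains M).homologyι 1 = ∑ i, cl (p i) := by
  refine (Category.assoc _ _ _).trans ?_
  rw [HomologicalComplex.homology_π_ι, HomologicalComplex.liftCycles_i_assoc,
    Preadditive.sum_comp]
  rfl

theorem isCycle_of_perm {n : ℕ} (p : Fin n → C(I, M)) (g : Equiv.Perm (Fin n))
    (h : ∀ i, p i 1 = p (g i) 0) : (∑ i, chain (p i)) ≫ (chains M).d 1 0 = 0 := by
  simp_rw [Preadditive.sum_comp, chain_d, h, Finset.sum_sub_distrib]
  rw [Equiv.sum_comp g (fun i => pointChain (p i 0)), sub_self]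

end Homology

section MapA

variable {n : ℕ} {M : Type u} [TopologicalSpace M] [T2Space M]

theorem isCycle_strand (x : Conf n M) (γ : Path (forget x) (forget x)) :
    (∑ i, chain (strand x γ i)) ≫ (chains M).d 1 0 = 0 := by
  obtain ⟨g, hg⟩ := exists_perm x γ
  refine isCycle_of_perm _ g⁻¹ fun i => ?_
  rw [strand_zero]
  exact congrArg (fun y : Conf n M => y.1 i) hg

/-- The homology class of the `1`-cycle `γ_1 + ⋯ + γ_n` in `H_1(M)`. -/
noncomputable def loopClass (x : Conf n M) (γ : Path (forget x) (forget x)) : H1 M :=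
  (cycleClass (strand x γ) (isCycle_strand x γ)).hom (ULift.up 1)

theorem loopClass_eq (x : Conf n M) {γ δ : Path (forget x) (forget x)} (h : γ.Homotopic δ) :
    loopClass x γ = loopClass x δ := by
  have : cycleClass (strand x γ) (isCycle_strand x γ) =
      cycleClass (strand x δ) (isCycle_strand x δ) := by
    rw [← cancel_mono ((chains M).homologyι 1), cycleClass_ι, cycleClass_ι]
    exact Finset.sum_congr rfl fun i _ => cl_homotopic (homotopicRel_strand x h i)
  rw [loopClass, loopClass, this]

theorem cl_strand_trans (x : Conf n M) (γ δ : Path (forget x) (forget x))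
    (g : Equiv.Perm (Fin n)) (hg : lift x γ 1 = g • x) (i : Fin n) :
    cl (strand x (γ.trans δ) i) = cl (strand x γ i) + cl (strand x δ (g⁻¹ i)) := by
  have e : ∀ t : I, strand x (γ.trans δ) i t = (lift x (γ.trans δ) t).1 i := fun _ => rfl
  refine cl_concat _ _ _ (fun s h0 h1 => ?_) fun s h0 h1 => ?_
  · have hs : s / 2 ∈ Set.Icc (0 : ℝ) 1 := ⟨by linarith, by linarith⟩
    rw [Set.projIcc_of_mem zero_le_one hs, Set.projIcc_of_mem zero_le_one ⟨h0, h1⟩, e,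
      lift_trans x γ δ g hg, dif_pos (by change s / 2 ≤ 1 / 2; linarith)]
    change (strand x γ i) _ = _
    congr 2
    change 2 * (s / 2) = s
    ring
  · have hs : (1 + s) / 2 ∈ Set.Icc (0 : ℝ) 1 := ⟨by linarith, by linarith⟩
    rw [Set.projIcc_of_mem zero_le_one hs, Set.projIcc_of_mem zero_le_one ⟨h0, h1⟩, e,
      lift_trans x γ δ g hg]
    split_ifs with h
    · have h' : (1 + s) / 2 ≤ 1 / 2 := h
      obtain rfl : s = 0 := by linarith
      have e1 : ∀ t : I, (t : ℝ) = 1 → (lift x γ t).1 i = x.1 (g⁻¹ i) := by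
        intro t ht
        obtain rfl : t = 1 := Subtype.ext ht
        rw [hg]; rfl
      rw [e1 _ (by change 2 * ((1 + 0) / 2 : ℝ) = 1; norm_num)]
      exact (strand_zero x δ _).symm
    · change (strand x δ (g⁻¹ i)) _ = _
      congr 2
      change 2 * ((1 + s) / 2) - 1 = s
      ring

theorem loopClass_trans (x : Conf n M) (γ δ : Path (forget x) (forget x)) :
    loopClass x (γ.trans δ) = loopClass x γ + loopClass x δ := by
  obtain ⟨g, hg⟩ := exists_perm x γ
  have : cycleClass (strand x (γ.trans δ)) (isCycle_strand x _) =
      cycleClass (strand x γ) (isCycle_strand x γ) +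
        cycleClass (strand x δ) (isCycle_strand x δ) := by
    rw [← cancel_mono ((chains M).homologyι 1), Preadditive.add_comp, cycleClass_ι,
      cycleClass_ι, cycleClass_ι, Finset.sum_congr rfl fun i _ => cl_strand_trans x γ δ g hg i,
      Finset.sum_add_distrib, Equiv.sum_comp g⁻¹ fun i => cl (strand x δ i)]
  rw [loopClass, this]
  rfl

/-- The homomorphism `A : π_1(M^{[n]}, X) → H_1(M)` sending the class of a loop
`γ = {γ_1, …, γ_n}` to the class of the `1`-cycle `γ_1 + ⋯ + γ_n`. -/
noncomputable def mapA (x : Conf n M) :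
    FundamentalGroup (UConf n M) (forget x) →* Multiplicative (H1 M) :=
  MonoidHom.mk'
    (fun b => Multiplicative.ofAdd
      (Quotient.lift (loopClass x) (fun _ _ h => loopClass_eq x h) b.toPath))
    (by
      intro a b
      induction a using Path.Homotopic.Quotient.ind with | mk γ => ?_
      induction b using Path.Homotopic.Quotient.ind with | mk δ => ?_
      refine (congrArg Multiplicative.ofAdd (loopClass_trans x δ γ)).trans ?_
      rw [add_comm, ofAdd_add]
      rfl)

theorem mapA_mk (x : Conf n M) (γ : Path (forget x) (forget x)) :
    mapA x (.fromPath (.mk γ)) = Multiplicative.ofAdd (loopClass x γ) := rfl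

/-- The group `B_n^0`, the kernel of `A : π_1(M^{[n]}, X) → H_1(M)`. -/
noncomputable def B0 (x : Conf n M) : Subgroup (FundamentalGroup (UConf n M) (forget x)) :=
  (mapA x).ker

end MapA

section Polyhedra

/-- The closed unit disk, used as a model of a polygon. -/
abbrev Disk : Type := Metric.closedBall (0 : ℂ) 1

/-- The combinatorics of a closed oriented polyhedral surface with `n` faces: face `j` is a
polygon with `sides j ≥ 1` sides, and the sides of all the polygons are matched in pairs. -/
structure GluingPattern (n : ℕ) where
  sides : Fin n → ℕ
  sides_pos : ∀ j, 0 < sides j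
  opp : (Σ j, Fin (sides j)) → Σ j, Fin (sides j)
  opp_opp : ∀ s, opp (opp s) = s
  opp_ne : ∀ s, opp s ≠ s

namespace GluingPattern

variable {n : ℕ} (P : GluingPattern n)

/-- The sides of all the polygons. The side `s` belongs to the face `s.1`; the two sides `s` and
`P.opp s` form one edge of the surface. A side `s` is also an oriented edge of the dual graph:
the one that leads from the face `s.1`, across the edge `{s, P.opp s}`, to the face `(P.opp s).1`.
Whichever orientation is attached to an edge `e`, its two signed versions `e⁺` and `e⁻` are
`s` and `P.opp s` for one of the two sides `s` that form `e`. -/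
abbrev Side : Type := Σ j, Fin (P.sides j)

/-- The unit circle bounding a face with `p` sides is divided into `p` equal arcs, the sides, in
counterclockwise order; this is the point of the side `s` with parameter `t ∈ [0, 1]`. -/
noncomputable def sidePoint (s : P.Side) (t : ℝ) : Disk :=
  ⟨Circle.exp (2 * Real.pi * ((s.2 : ℕ) + t) / P.sides s.1),
    by rw [mem_closedBall_zero_iff, Circle.norm_coe]⟩

/-- Matched sides are glued to each other, reversing their counterclockwise directions, so that
the orientations of the disks agree across the edges. -/
inductive Glue : Fin n × Disk → Fin n × Disk → Prop
  | side (s : P.Side) (t : ℝ) (h0 : 0 ≤ t) (h1 : t ≤ 1) :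
      Glue (s.1, P.sidePoint s t) ((P.opp s).1, P.sidePoint (P.opp s) (1 - t))

end GluingPattern

/-- A structure of a closed oriented polyhedron with `n` faces on the space `M`: polygons, a
matching of their sides, and for each polygon a characteristic map into `M`, such that `M` is
covered by the polygons and points are identified in `M` exactly when the gluing forces this.
If `M` is Hausdorff it is then the quotient space of the disjoint union of the polygons by
the gluing, which is a closed oriented surface. -/
structure Polyhedron (M : Type u) [TopologicalSpace M] (n : ℕ) extends GluingPattern n where
  char : Fin n → C(Disk, M)
  char_surjective : ∀ m, ∃ j z, char j z = m
  char_eq_iff : ∀ j k z w,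
    char j z = char k w ↔ Relation.EqvGen toGluingPattern.Glue (j, z) (k, w)

namespace Polyhedron

variable {M : Type u} [TopologicalSpace M] {n : ℕ} (P : Polyhedron M n)

/-- The (open) face `f_j`. -/
def face (j : Fin n) : Set M := P.char j '' {z | ‖(z : ℂ)‖ < 1}

/-- The (open) edge formed by the sides `s` and `P.opp s`. -/
def edge (s : P.Side) : Set M := (fun t => P.char s.1 (P.sidePoint s t)) '' Set.Ioo 0 1

/-- The set `V` of vertices. -/
def vertices : Set M := Set.range fun s : P.Side => P.char s.1 (P.sidePoint s 0)

/-- The union of the (open) edges. -/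
def edges : Set M := ⋃ s : P.Side, P.edge s

/-- No face is a neighbor of itself. -/
def NoSelfNeighbor : Prop := ∀ s : P.Side, (P.opp s).1 ≠ s.1

/-- No two faces share more than one edge. -/
def AtMostOneSharedEdge : Prop :=
  ∀ s s' : P.Side, s.1 = s'.1 → (P.opp s).1 = (P.opp s').1 → s = s'

/-- At time `t` the curve `c` crosses the oriented dual edge `s`: it is on the edge formed by
`s` and `P.opp s`, it comes from the face of `s` and it goes to the face of `P.opp s`. -/
def Crosses (c : C(I, M)) (t : I) (s : P.Side) : Prop :=
  c t ∈ P.edge s ∧ (∀ᶠ u in 𝓝[<] t, c u ∈ P.face s.1) ∧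
    (∀ᶠ u in 𝓝[>] t, c u ∈ P.face (P.opp s).1)

variable [T2Space M]

/-- Enumerable loops: the curve avoids the vertices, meets the edges at finitely many times only,
and whenever `γ_i(t)` lies on an edge, `γ_i(t - ε)` and `γ_i(t + ε)` lie in different faces
for small `ε`. -/
structure IsEnumerable (x : Conf n M) (γ : Path (forget x) (forget x)) : Prop where
  avoids_vertices : ∀ i t, strand x γ i t ∉ P.vertices
  finite_times : {t | ∃ i, strand x γ i t ∈ P.edges}.Finite
  changes_face : ∀ i t, strand x γ i t ∈ P.edges → ∃ j k, j ≠ k ∧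
    (∀ᶠ u in 𝓝[<] t, strand x γ i u ∈ P.face j) ∧ (∀ᶠ u in 𝓝[>] t, strand x γ i u ∈ P.face k)

/-- The multiplicity of the signed edge `s` in the edge set of `γ`: the number of all the
crossings of `s` by the constituent curves `γ_1, …, γ_n`. -/
noncomputable def multiplicity (x : Conf n M) (γ : Path (forget x) (forget x)) (s : P.Side) : ℕ :=
  ∑ i, {t : I | P.Crosses (strand x γ i) t s}.ncard

/-- Balanced loops: enumerable loops in whose edge set `e⁺` and `e⁻` have the same multiplicity,
for every edge `e`. -/
structure IsBalanced (x : Conf n M) (γ : Path (forget x) (forget x)) : Prop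
    extends P.IsEnumerable x γ where
  balanced : ∀ s : P.Side, P.multiplicity x γ s = P.multiplicity x γ (P.opp s)

end Polyhedron

end Polyhedra

end SurfaceBraid

/-! Crossings are counted in the group `Flux`: integer combinations of sides, modulo `s + opp s` and
modulo the sum of the sides met during one turn around a vertex. These are the 1-chains of the dual
polyhedron modulo boundaries, so the class of the crossings of a curve should depend only on its
singular chain modulo boundaries.

To prove this, one uses local potentials: locally constant functions on the polygons that jump by
`cls s` across `s`. Near a vertex such a function exists precisely because of the vertex relation.
Differences of local potentials are the transition functions of a covering of `M` with discrete
fibre `Flux`. It has sections over maps from simply connected, locally path connected spaces, such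
as intervals and triangles, which gives a potential along every such map (`exists_isPotential`). The
increment of a potential along a curve is its `flux`. On the boundary of a triangle the increments
telescope, so the flux factors through chains modulo boundaries (`flux_triangle`,
`sum_flux_eq_zero`). Hence a loop in the kernel of `A` with tame strands has a crossing vector `N`
in `relations`.

Every class has a tame representative. Each point of `M` has arbitrarily small simply connected
neighbourhoods in which points of faces are joined by tame curves (`exists_isNice`); at a boundary
point of the polygons it is a star, the union of the corners that meet there. Products of disjoint
neighbourhoods of this kind, and a subdivision of the path, make the lifted path of ordered
configurations tame (`exists_confTame_homotopic`).

It remains to change `N` without changing the class. A loop that takes the single point `x_j` inside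
its face to a vertex of that face, once around it and back is null-homotopic in the configuration
space, and its crossing vector is a vertex relation (`exists_vertex_confTame`). Products and
inverses of such loops realize `-N` up to a vector invariant under `opp`
(`exists_nullhomotopic_confTame`). With such a loop in front, the total crossing vector is invariant
under `opp`, which is balance. -/

namespace SurfaceBraid

open CategoryTheory Topology unitInterval

/-! ### Local-to-global homotopies and contractibility of quotients -/

/-- If every point has arbitrarily small neighbourhoods `W ∈ 𝒩` in which paths are determined up
to homotopy by their endpoints and in which points of `S` can be joined by paths satisfying `T`,
then every path between points of `S` is homotopic to one that satisfies `T`. -/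
theorem exists_homotopic_of_nhds_basis {X : Type*} [TopologicalSpace X] (S : Set X)
    (T : ∀ x y : X, Path x y → Prop)
    (hrefl : ∀ x ∈ S, T x x (Path.refl x))
    (htrans : ∀ x y z (p : Path x y) (q : Path y z), T x y p → T y z q → T x z (p.trans q))
    (𝒩 : Set (Set X))
    (hbasis : ∀ z, ∀ O ∈ 𝓝 z, ∃ W ∈ 𝒩, W ∈ 𝓝 z ∧ W ⊆ O)
    (hpath : ∀ W ∈ 𝒩, ∀ a ∈ W, ∃ y ∈ S ∩ W, ∃ η : Path a y, ∀ t, η t ∈ W)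
    (hsimple : ∀ W ∈ 𝒩, ∀ a b (p q : Path a b), (∀ t, p t ∈ W) → (∀ t, q t ∈ W) → p.Homotopic q)
    (htame : ∀ W ∈ 𝒩, ∀ a ∈ S ∩ W, ∀ b ∈ S ∩ W, ∃ p : Path a b, T a b p ∧ ∀ t, p t ∈ W)
    {x y : X} (hx : x ∈ S) (hy : y ∈ S) (p : Path x y) :
    ∃ p' : Path x y, T x y p' ∧ p'.Homotopic p := by
  choose W hW𝒩 hWp _ using fun t : I => hbasis (p t) Set.univ Filter.univ_mem
  obtain ⟨t, t0, tmono, ⟨K, hK⟩, ht⟩ := exists_monotone_Icc_subset_open_cover_unitInterval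
    (c := fun s : I => p ⁻¹' interior (W s)) (fun s => isOpen_interior.preimage p.continuous)
    (fun s _ => Set.mem_iUnion.2 ⟨s, mem_interior_iff_mem_nhds.2 (hWp s)⟩)
  -- Induction along the subdivision. Since `p (t k)` need not lie in `S`, a short tail `η` ends the
  -- path in `S`; quantifying over `V` lets the next step prescribe where this tail stays.
  have key : ∀ k, ∀ V ∈ 𝒩, V ∈ 𝓝 (p (t k)) → ∃ y ∈ S ∩ V, ∃ η : Path (p (t k)) y,
      (∀ s, η s ∈ V) ∧ ∃ τ : Path (p (t 0)) y, T _ _ τ ∧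
        ((p.subpath (t 0) (t k)).trans η).Homotopic τ := by
    intro k
    induction k with
    | zero =>
      intro V hV hVp
      have hp0 : p (t 0) = x := by rw [t0]; simp
      have hS : p (t 0) ∈ S := by rw [hp0]; exact hx
      refine ⟨p (t 0), ⟨hS, mem_of_mem_nhds hVp⟩, Path.refl _,
        fun s => mem_of_mem_nhds hVp, Path.refl _, hrefl _ hS, ?_⟩
      rw [Path.subpath_self]
      exact ⟨Path.Homotopy.transRefl _⟩
    | succ k ih =>
      intro V hV hVp
      obtain ⟨s, hs⟩ := ht k
      have hsub : ∀ u, t k ≤ u → u ≤ t (k + 1) → W s ∈ 𝓝 (p u) := fun u h1 h2 =>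
        mem_interior_iff_mem_nhds.1 (hs ⟨h1, h2⟩)
      obtain ⟨a, ha, η, hη, τ, hτ, hh⟩ := ih (W s) (hW𝒩 s) (hsub _ le_rfl (tmono k.le_succ))
      -- The new tail `θ` must stay both in the prescribed `V` and in `W s`, where it is compared
      -- with the old tail.
      obtain ⟨V', hV'𝒩, hV'p, hV'⟩ := hbasis _ _
        (Filter.inter_mem hVp (hsub _ (tmono k.le_succ) le_rfl))
      obtain ⟨b, hb, θ, hθ⟩ := hpath V' hV'𝒩 _ (mem_of_mem_nhds hV'p)
      obtain ⟨ζ, hζ, hζW⟩ := htame (W s) (hW𝒩 s) a ha b ⟨hb.1, (hV' hb.2).2⟩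
      refine ⟨b, ⟨hb.1, (hV' hb.2).1⟩, θ, fun u => (hV' (hθ u)).1, τ.trans ζ,
        htrans _ _ _ _ _ hτ hζ, ?_⟩
      -- Back along the old tail, along `p`, out along the new tail: all of it in `W s`, hence
      -- homotopic to the tame `ζ`.
      have h1 : (η.symm.trans ((p.subpath (t k) (t (k + 1))).trans θ)).Homotopic ζ := by
        refine hsimple _ (hW𝒩 s) _ _ _ _ (fun u => ?_) hζW
        have hr : ∀ c ∈ Set.range (η.symm.trans ((p.subpath (t k) (t (k + 1))).trans θ)),
            c ∈ W s := by
          rw [Path.trans_range, Path.trans_range, Path.symm_range,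
            Path.range_subpath_of_le _ _ _ (tmono k.le_succ)]
          rintro c (⟨v, rfl⟩ | ⟨v, hv, rfl⟩ | ⟨v, rfl⟩)
          · exact hη v
          · exact mem_of_mem_nhds (hsub v hv.1 hv.2)
          · exact (hV' (hθ v)).2
        exact hr _ ⟨u, rfl⟩
      have h2 : ((p.subpath (t 0) (t k)).trans (p.subpath (t k) (t (k + 1)))).Homotopic
          (p.subpath (t 0) (t (k + 1))) := ⟨Path.Homotopy.subpathTransSubpath p _ _ _⟩
      rw [← Path.Homotopic.Quotient.eq] at hh h1 h2 ⊢
      simp only [Path.Homotopic.Quotient.mk_trans, Path.Homotopic.Quotient.mk_symm] at *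
      rw [← h2, ← h1, ← hh]
      simp [← Path.Homotopic.Quotient.trans_assoc]
      simp [Path.Homotopic.Quotient.trans_assoc]
  have hpK : p (t K) = y := by rw [hK K le_rfl]; simp
  have hp0 : p (t 0) = x := by rw [t0]; simp
  have hKS : p (t K) ∈ S := by rw [hpK]; exact hy
  obtain ⟨b, hb, η, hη, τ, hτ, hh⟩ := key K (W (t K)) (hW𝒩 _) (hWp _)
  obtain ⟨ζ, hζ, hζW⟩ := htame _ (hW𝒩 _) b hb (p (t K)) ⟨hKS, mem_of_mem_nhds (hWp _)⟩
  have h1 : (η.symm).Homotopic ζ := hsimple _ (hW𝒩 (t K)) _ _ _ _ (fun u => hη _) hζW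
  have h3 : (p.subpath (t 0) (t K)).Homotopic (τ.trans ζ) := by
    rw [← Path.Homotopic.Quotient.eq] at hh h1 ⊢
    simp only [Path.Homotopic.Quotient.mk_trans, Path.Homotopic.Quotient.mk_symm] at *
    rw [← h1, ← hh]
    simp [Path.Homotopic.Quotient.trans_assoc]
  have h4 : p.subpath (t 0) (t K) = p.cast hp0 hpK := by
    have := hK K le_rfl
    ext s
    simp [Path.subpath, t0, this]
  have cast_lemma : ∀ (x' y' : X) (hx' : x' = x) (hy' : y' = y) (q : Path x' y'), T x' y' q →
      q.Homotopic (p.cast hx' hy') → ∃ p' : Path x y, T x y p' ∧ p'.Homotopic p := by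
    rintro x' y' rfl rfl q hq hq'
    exact ⟨q, hq, hq'⟩
  exact cast_lemma _ _ hp0 hpK _ (htrans _ _ _ _ _ hτ hζ) (h4 ▸ h3.symm)

/-- A continuous surjection from a compact space to a Hausdorff space is closed, hence a quotient
map, and this also applies to its product with `I`. So a contraction of `K` that respects the fibres
of `Q` descends. -/
theorem contractibleSpace_range {K M : Type*} [TopologicalSpace K] [CompactSpace K]
    [TopologicalSpace M] [T2Space M] (Q : K → M) (hQ : Continuous Q) (H : K × I → K)
    (hH : Continuous H) (h0 : ∀ a, H (a, 0) = a)
    (hcomp : ∀ a b s, Q a = Q b → Q (H (a, s)) = Q (H (b, s)))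
    (k : K) (h1 : ∀ a, Q (H (a, 1)) = Q k) : ContractibleSpace (Set.range Q) := by
  let Q' : K → Set.range Q := Set.rangeFactorization Q
  have hQ' : Continuous Q' := hQ.subtype_mk _
  have hq : IsQuotientMap (Prod.map Q' (id : I → I)) := by
    have hc : Continuous (Prod.map Q' (id : I → I)) := hQ'.prodMap continuous_id
    exact hc.isClosedMap.isQuotientMap hc
      (Set.rangeFactorization_surjective.prodMap Function.surjective_id)
  let L : C(K × I, Set.range Q) := ⟨fun a => Q' (H a), hQ'.comp hH⟩
  have hL : ∀ a b, Prod.map Q' (id : I → I) a = Prod.map Q' (id : I → I) b → L a = L b := by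
    rintro ⟨a, s⟩ ⟨b, s'⟩ h
    obtain ⟨h1, h2⟩ := Prod.mk.inj h
    obtain rfl : s = s' := h2
    exact Subtype.ext (hcomp a b s (congrArg Subtype.val h1))
  let F : C(Set.range Q × I, Set.range Q) := hq.lift (f := ⟨_, hq.continuous⟩) L hL
  have hF : ∀ a s, F (Q' a, s) = Q' (H (a, s)) := fun a s =>
    DFunLike.congr_fun (hq.lift_comp (f := ⟨_, hq.continuous⟩) L hL) (a, s)
  rw [contractible_iff_id_nullhomotopic]
  refine ⟨Q' k, ⟨⟨F.comp ContinuousMap.prodSwap, ?_, ?_⟩⟩⟩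
  · rintro ⟨_, a, rfl⟩
    exact (hF a 0).trans (congrArg Q' (h0 a))
  · rintro ⟨_, a, rfl⟩
    exact (hF a 1).trans (Subtype.ext (h1 a))

section Conf

variable {n : ℕ} {M : Type*} [TopologicalSpace M]

/-- The set of configurations whose `i`-th point lies in `N i`. -/
def confBox (N : Fin n → Set M) : Set (Conf n M) := {x | ∀ i, x.1 i ∈ N i}

/-- Homotopies are chosen in each `N i` separately; disjointness of the `N i` keeps the points
distinct throughout, so they combine to a homotopy of configurations. -/
theorem confBox_homotopic {N : Fin n → Set M} (hN : Pairwise (Function.onFun Disjoint N))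
    (hc : ∀ i, SimplyConnectedSpace (N i)) {a b : Conf n M} (p q : Path a b)
    (hp : ∀ t, p t ∈ confBox N) (hq : ∀ t, q t ∈ confBox N) : p.Homotopic q := by
  have ha : ∀ i, a.1 i ∈ N i := by simpa [confBox] using hp 0
  have hb : ∀ i, b.1 i ∈ N i := by simpa [confBox] using hp 1
  let c : ∀ r : Path a b, (∀ t, r t ∈ confBox N) → ∀ i,
      Path (⟨a.1 i, ha i⟩ : N i) ⟨b.1 i, hb i⟩ := fun r hr i =>
    { toFun := fun t => ⟨(r t).1 i, hr t i⟩
      continuous_toFun := ((coord i).continuous.comp r.continuous).subtype_mk _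
      source' := by simp
      target' := by simp }
  have h : ∀ i, Nonempty ((c p hp i).Homotopy (c q hq i)) := fun i =>
    SimplyConnectedSpace.paths_homotopic _ _
  let F := fun i => (h i).some
  refine ⟨⟨⟨⟨fun z => ⟨fun i => (F i z).1, fun i j hij => ?_⟩, ?_⟩, ?_, ?_⟩, ?_⟩⟩
  · by_contra hne
    have hij' : ((F i z : N i) : M) = F j z := hij
    exact Set.disjoint_left.1 (hN hne) (F i z).2 (hij' ▸ (F j z).2)
  · exact Continuous.subtype_mk
      (continuous_pi fun i => continuous_subtype_val.comp (F i).continuous) _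
  · intro s
    refine Subtype.ext (funext fun i => ?_)
    exact congrArg Subtype.val ((F i).apply_zero s)
  · intro s
    refine Subtype.ext (funext fun i => ?_)
    exact congrArg Subtype.val ((F i).apply_one s)
  · intro s u hu
    refine Subtype.ext (funext fun i => ?_)
    exact congrArg Subtype.val ((F i).prop s u hu)

end Conf

/-! ### Polar coordinates on the polygons; stars at vertices and on edges -/

namespace GluingPattern

variable {n : ℕ} (P : GluingPattern n)

/-- The point with polar coordinates `(u, r)` of the polygon `j`; the angle is measured in units
of sides and the radius is truncated to `[0, 1]`. -/
noncomputable def polar (j : Fin n) (u r : ℝ) : Disk :=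
  ⟨(Set.projIcc 0 1 zero_le_one r : I) * Circle.exp (2 * Real.pi * u / P.sides j), by
    rw [mem_closedBall_zero_iff, norm_mul, Circle.norm_coe, mul_one, Complex.norm_real,
      Real.norm_of_nonneg (Set.projIcc 0 1 zero_le_one r).2.1]
    exact (Set.projIcc 0 1 zero_le_one r).2.2⟩

theorem sides_pos' (j : Fin n) : (0 : ℝ) < P.sides j := Nat.cast_pos.2 (P.sides_pos j)

theorem sidePoint_eq_polar (s : P.Side) (t : ℝ) :
    P.sidePoint s t = P.polar s.1 ((s.2 : ℕ) + t) 1 := by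
  ext1
  simp [sidePoint, polar]

theorem norm_polar (j : Fin n) (u : ℝ) {r : ℝ} (h0 : 0 ≤ r) (h1 : r ≤ 1) :
    ‖(P.polar j u r : ℂ)‖ = r := by
  rw [polar, norm_mul, Circle.norm_coe, mul_one, Complex.norm_real,
    Set.projIcc_of_mem zero_le_one ⟨h0, h1⟩, Real.norm_of_nonneg h0]

theorem continuous_polar (j : Fin n) : Continuous fun z : ℝ × ℝ => P.polar j z.1 z.2 := by
  refine Continuous.subtype_mk (Continuous.mul ?_ ?_) _
  · exact Complex.continuous_ofReal.comp
      (continuous_subtype_val.comp (continuous_projIcc.comp continuous_snd))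
  · exact continuous_subtype_val.comp (Circle.exp.continuous.comp (by fun_prop))

theorem polar_eq_iff (j : Fin n) {u r u' r' : ℝ} (h0 : 0 < r) (h1 : r ≤ 1) (h0' : 0 < r')
    (h1' : r' ≤ 1) :
    P.polar j u r = P.polar j u' r' ↔ r = r' ∧ ∃ m : ℤ, u = u' + m * P.sides j := by
  have hp := P.sides_pos' j
  have hpi := Real.pi_pos
  have hexp : Circle.exp (2 * Real.pi * u / P.sides j) =
      Circle.exp (2 * Real.pi * u' / P.sides j) ↔ ∃ m : ℤ, u = u' + m * P.sides j := by
    rw [Circle.exp_eq_exp]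
    refine exists_congr fun m => ?_
    rw [div_eq_iff hp.ne', add_mul, div_mul_cancel₀ _ hp.ne']
    constructor
    · intro h
      have : 2 * Real.pi * (u - (u' + m * P.sides j)) = 0 := by linear_combination h
      have := (mul_eq_zero.1 this).resolve_left (by positivity)
      linarith
    · rintro rfl
      ring
  constructor
  · intro h
    have hr : r = r' := by
      rw [← P.norm_polar j u h0.le h1, h, P.norm_polar j u' h0'.le h1']
    subst hr
    refine ⟨rfl, hexp.1 (Circle.ext ?_)⟩
    have h' := congrArg Subtype.val h
    simp only [polar, Set.projIcc_of_mem zero_le_one ⟨h0.le, h1⟩] at h'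
    exact mul_left_cancel₀ (Complex.ofReal_ne_zero.2 h0.ne') h'
  · rintro ⟨rfl, h⟩
    ext1
    simp only [polar, hexp.2 h]

theorem polar_add_mul (j : Fin n) (u r : ℝ) (m : ℤ) :
    P.polar j (u + m * P.sides j) r = P.polar j u r := by
  have hp := P.sides_pos' j
  have h : Circle.exp (2 * Real.pi * (u + m * P.sides j) / P.sides j) =
      Circle.exp (2 * Real.pi * u / P.sides j) := Circle.exp_eq_exp.2 ⟨m, by field_simp⟩
  ext1
  simp only [polar, h]

/-- Points close to the boundary point with angle `u` have polar coordinates close to `(u, 1)`. -/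
theorem eventually_polar (j : Fin n) (u : ℝ) {δ : ℝ} (hδ : 0 < δ) :
    ∀ᶠ z in 𝓝 (P.polar j u 1), ∃ v r, |v| ≤ δ ∧ 1 - δ ≤ r ∧ r ≤ 1 ∧ 0 ≤ r ∧
      P.polar j (u + v) r = z := by
  have hp := P.sides_pos' j
  have hpi := Real.pi_pos
  set κ : ℝ := 2 * Real.pi / P.sides j with hκ
  have hκ0 : 0 < κ := by positivity
  set e : Circle := Circle.exp (2 * Real.pi * u / P.sides j) with he
  have hz0 : (P.polar j u 1 : ℂ) = e := by simp [polar, he]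
  -- Division by `e` rotates the boundary point to `1`, where `arg` is continuous.
  have hw : Continuous fun z : Disk => (z : ℂ) / e :=
    continuous_subtype_val.div_const _
  have hw0 : (P.polar j u 1 : ℂ) / e = 1 := by
    rw [hz0, div_self (Circle.coe_ne_zero e)]
  have h1 : ∀ᶠ z : Disk in 𝓝 (P.polar j u 1), |Complex.arg ((z : ℂ) / e)| < κ * δ := by
    have hc : ContinuousAt (fun z : Disk => |Complex.arg ((z : ℂ) / e)|) (P.polar j u 1) := by
      refine ContinuousAt.abs (ContinuousAt.comp (g := Complex.arg) ?_ hw.continuousAt)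
      rw [hw0]
      exact Complex.continuousAt_arg Complex.one_mem_slitPlane
    refine hc.eventually (gt_mem_nhds ?_)
    simp only [hw0]
    simp
    positivity
  have h2 : ∀ᶠ z : Disk in 𝓝 (P.polar j u 1), 1 - δ < ‖(z : ℂ)‖ := by
    have hc : Continuous fun z : Disk => ‖(z : ℂ)‖ := continuous_subtype_val.norm
    refine hc.continuousAt.eventually (lt_mem_nhds ?_)
    simp only [hz0, Circle.norm_coe]
    linarith
  filter_upwards [h1, h2] with z hz1 hz2
  have hzn : ‖(z : ℂ)‖ ≤ 1 := mem_closedBall_zero_iff.1 z.2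
  refine ⟨Complex.arg ((z : ℂ) / e) / κ, ‖(z : ℂ)‖, ?_, hz2.le, hzn, norm_nonneg _, ?_⟩
  · rw [abs_div, abs_of_pos hκ0, div_le_iff₀ hκ0]
    linarith
  · ext1
    have hang : 2 * Real.pi * (u + Complex.arg ((z : ℂ) / e) / κ) / P.sides j =
        2 * Real.pi * u / P.sides j + Complex.arg ((z : ℂ) / e) := by
      rw [hκ]
      field_simp
    have hnorm : ‖(z : ℂ) / e‖ = ‖(z : ℂ)‖ := by rw [norm_div, Circle.norm_coe, div_one]
    have hpol := Complex.norm_mul_exp_arg_mul_I ((z : ℂ) / e)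
    rw [hnorm] at hpol
    simp only [polar]
    rw [hang, Circle.exp_add, Set.projIcc_of_mem zero_le_one ⟨norm_nonneg _, hzn⟩, Circle.coe_mul,
      ← he, mul_left_comm]
    rw [← Circle.coe_exp] at hpol
    exact (congrArg ((e : ℂ) * ·) hpol).trans (mul_div_cancel₀ _ (Circle.coe_ne_zero e))

/-- The next side, in counterclockwise order, of the same polygon. -/
def next : Equiv.Perm P.Side := Equiv.sigmaCongrRight fun j => finRotate (P.sides j)

/-- The step from the last side to the first costs a multiple of the number of sides, which `polar`
does not see. -/
theorem next_val (s : P.Side) :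
    ∃ m : ℤ, (((P.next s).2 : ℕ) : ℤ) = (s.2 : ℕ) + 1 + m * P.sides s.1 := by
  obtain ⟨j, k⟩ := s
  change ∃ m : ℤ, (((finRotate (P.sides j) k : Fin _) : ℕ) : ℤ) = (k : ℕ) + 1 + m * P.sides j
  have := P.sides_pos j
  generalize P.sides j = p at *
  obtain ⟨p, rfl⟩ : ∃ q, p = q + 1 := ⟨p - 1, by omega⟩
  rw [coe_finRotate]
  split_ifs with h
  · exact ⟨-1, by subst h; simp⟩
  · exact ⟨0, by simp⟩

/-- The involution exchanging the two sides of each edge. -/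
def oppPerm : Equiv.Perm P.Side := Function.Involutive.toPerm P.opp P.opp_opp

/-- The permutation of the sides whose cycles are the vertices: the side following `P.opp s` in its
polygon starts at the same vertex as `s`. -/
def rot : Equiv.Perm P.Side := P.oppPerm.trans P.next

theorem glue_symm {p p' : Fin n × Disk} (h : P.Glue p p') : P.Glue p' p := by
  obtain ⟨s, t, h0, h1⟩ := h
  have := Glue.side (P := P) (P.opp s) (1 - t) (by linarith) (by linarith)
  rwa [P.opp_opp, sub_sub_cancel] at this

/-- A boundary point of the polygons which lies in the polygon of the side `c`. -/
noncomputable def cornerPoint (shift : P.Side → ℝ) (c : P.Side) (v r : ℝ) : Fin n × Disk :=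
  (c.1, P.polar c.1 ((c.2 : ℕ) + shift c + v) r)

/-- The combinatorics of the gluing around a boundary point of the polygons. The corners at that
point are labelled by the sides in one cycle of `rot`; inside the polygon `c.1` the corner `c` is
the box of points with polar coordinates `(c.2 + shift c + v, r)`, `|v| ≤ rad`, `1 - rad ≤ r ≤ 1`.
The half `0 ≤ v` of its boundary belongs to the side `c` and is glued to
the half `v ≤ 0` of the boundary of the corner `rot c`. -/
structure Star where
  rot : Equiv.Perm P.Side
  base : P.Side
  shift : P.Side → ℝ
  rad : ℝ
  rad_pos : 0 < rad
  rad_lt : rad < 1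
  inj : ∀ c c', rot.SameCycle base c → rot.SameCycle base c' → ∀ v v' r r', |v| ≤ rad →
    |v'| ≤ rad → 1 - rad ≤ r → r ≤ 1 → 1 - rad ≤ r' → r' ≤ 1 →
    P.cornerPoint shift c v r = P.cornerPoint shift c' v' r' → c = c' ∧ v = v' ∧ r = r'
  side : ∀ c, rot.SameCycle base c → ∀ v, 0 ≤ v → v ≤ rad → ∃ t, 0 ≤ t ∧ t ≤ 1 ∧
    (0 < v → 0 < t ∧ t < 1) ∧ (c.1, P.sidePoint c t) = P.cornerPoint shift c v 1 ∧
    ((P.opp c).1, P.sidePoint (P.opp c) (1 - t)) = P.cornerPoint shift (rot c) (-v) 1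
  glue : ∀ c, rot.SameCycle base c → ∀ v, |v| ≤ rad → ∀ s t, 0 ≤ t → t ≤ 1 →
    (s.1, P.sidePoint s t) = P.cornerPoint shift c v 1 →
    (0 ≤ v ∧ s = c ∧
      ((P.opp s).1, P.sidePoint (P.opp s) (1 - t)) = P.cornerPoint shift (rot c) (-v) 1) ∨
    (v ≤ 0 ∧ s = P.opp (rot.symm c) ∧
      ((P.opp s).1, P.sidePoint (P.opp s) (1 - t)) = P.cornerPoint shift (rot.symm c) (-v) 1)

/-- The same star with smaller corners. -/
def Star.shrink {P : GluingPattern n} (T : P.Star) (δ : ℝ) (h0 : 0 < δ) (h1 : δ ≤ T.rad) :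
    P.Star where
  rot := T.rot
  base := T.base
  shift := T.shift
  rad := δ
  rad_pos := h0
  rad_lt := h1.trans_lt T.rad_lt
  inj c c' hc hc' v v' r r' hv hv' hr hr1 hr' hr1' h :=
    T.inj c c' hc hc' v v' r r' (hv.trans h1) (hv'.trans h1) (by linarith) hr1 (by linarith) hr1' h
  side c hc v h hv := T.side c hc v h (hv.trans h1)
  glue c hc v hv := T.glue c hc v (hv.trans h1)

theorem cornerPoint_congr (shift : P.Side → ℝ) {c : P.Side} {s : P.Side} {u v : ℝ} (h : s.1 = c.1)
    {m : ℤ} (hm : u = (c.2 : ℕ) + shift c + v + m * P.sides c.1) :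
    (s.1, P.polar s.1 u 1) = P.cornerPoint shift c v 1 := by
  obtain ⟨j, k⟩ := s
  obtain ⟨j', k'⟩ := c
  obtain rfl : j = j' := h
  rw [cornerPoint, hm, polar_add_mul]

theorem int_eq_of_mul_lt {p k l : ℕ} (hk : k < p) (hl : l < p) {m : ℤ}
    (h : (k : ℤ) = l + m * p) : k = l := by
  have hm : m = 0 := by
    by_contra hm
    rcases lt_or_gt_of_ne hm with hm | hm
    · nlinarith
    · nlinarith
  subst hm
  simpa using h

/-- The star of the vertex at which the side `s` starts. -/
noncomputable def vertexStar (s : P.Side) : P.Star where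
  rot := P.rot
  base := s
  shift := 0
  -- With angles measured in sides, a coincidence of two corner points makes `v' - v` an integer of
  -- absolute value at most `1 / 2`, hence zero. In `glue` the integer `t - v` lies strictly between
  -- `-1` and `2`.
  rad := 1 / 4
  rad_pos := by norm_num
  rad_lt := by norm_num
  inj := by
    rintro ⟨j, k⟩ ⟨j', k'⟩ - - v v' r r' hv hv' hr hr1 hr' hr1' h
    obtain ⟨h1, h2⟩ := Prod.mk.inj h
    obtain rfl : j = j' := h1
    obtain ⟨rfl, m, hm⟩ := (P.polar_eq_iff j (by linarith) hr1 (by linarith) hr1').1 h2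
    simp only [Pi.zero_apply, add_zero] at hm
    rw [abs_le] at hv hv'
    have hd : ((k : ℕ) : ℤ) = (k' : ℕ) + m * P.sides j := by
      have h3 : (((k : ℕ) - ((k' : ℕ) + m * P.sides j) : ℤ) : ℝ) = v' - v := by
        push_cast; linarith
      have h4 : (((k : ℕ) - ((k' : ℕ) + m * P.sides j) : ℤ) : ℝ) < (1 : ℤ) := by
        rw [h3]; push_cast; linarith
      have h5 : ((-1 : ℤ) : ℝ) < (((k : ℕ) - ((k' : ℕ) + m * P.sides j) : ℤ) : ℝ) := by
        rw [h3]; push_cast; linarith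
      have h4' := Int.cast_lt.1 h4
      have h5' := Int.cast_lt.1 h5
      omega
    have hk := int_eq_of_mul_lt k.2 k'.2 hd
    have hd' : ((k : ℕ) : ℝ) = (k' : ℕ) + m * P.sides j := by exact_mod_cast hd
    obtain rfl : k = k' := Fin.ext hk
    exact ⟨rfl, by linarith, rfl⟩
  side := by
    intro c _ v h0 h1
    refine ⟨v, h0, by linarith, fun h => ⟨h, by linarith⟩, ?_, ?_⟩
    · rw [sidePoint_eq_polar]
      exact P.cornerPoint_congr 0 rfl (m := 0) (by simp)
    · rw [sidePoint_eq_polar]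
      obtain ⟨m, hm⟩ := P.next_val (P.opp c)
      refine P.cornerPoint_congr 0 (c := P.next (P.opp c)) rfl (m := -m) ?_
      have hm' : (((P.next (P.opp c)).2 : ℕ) : ℝ) =
        ((P.opp c).2 : ℕ) + 1 + m * P.sides (P.opp c).1 := by exact_mod_cast hm
      rw [hm']
      change _ = _ + _ + _ + _ * (P.sides (P.opp c).1 : ℝ)
      simp
      ring
  glue := by
    rintro c - v hv s t h0 h1 h
    rw [sidePoint_eq_polar] at h
    obtain ⟨hsc, h2⟩ := Prod.mk.inj h
    rw [abs_le] at hv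
    obtain ⟨j, k⟩ := s
    obtain ⟨j', l⟩ := c
    obtain rfl : j = j' := hsc
    obtain ⟨-, m, hm⟩ := (P.polar_eq_iff j (by norm_num) le_rfl (by norm_num) le_rfl).1 h2
    simp only [Pi.zero_apply, add_zero] at hm
    have h3 : (((l : ℕ) + m * P.sides j - (k : ℕ) : ℤ) : ℝ) = t - v := by
      push_cast; linarith
    have h4 : (((l : ℕ) + m * P.sides j - (k : ℕ) : ℤ) : ℝ) < (2 : ℤ) := by
      rw [h3]; push_cast; linarith
    have h5 : ((-1 : ℤ) : ℝ) < (((l : ℕ) + m * P.sides j - (k : ℕ) : ℤ) : ℝ) := by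
      rw [h3]; push_cast; linarith
    have h4' := Int.cast_lt.1 h4
    have h5' := Int.cast_lt.1 h5
    -- Difference `0`: the point is near the start of the side `c` itself. Difference `1`: it is
    -- near the end of the side preceding `c`, which is `P.opp (P.rot.symm c)`.
    rcases (by omega : (l : ℕ) + m * P.sides j - (k : ℕ) = 0 ∨ (l : ℕ) + m * P.sides j - (k : ℕ) = 1)
      with hd | hd
    · left
      rw [hd] at h3
      obtain rfl : k = l := Fin.ext (int_eq_of_mul_lt k.2 l.2 (m := m) (by linarith))
      obtain rfl : t = v := by push_cast at h3; linarith
      refine ⟨h0, rfl, ?_⟩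
      rw [sidePoint_eq_polar]
      obtain ⟨m', hm'⟩ := P.next_val (P.opp ⟨j, k⟩)
      refine P.cornerPoint_congr 0 (c := P.next (P.opp ⟨j, k⟩)) rfl (m := -m') ?_
      have hm'' : (((P.next (P.opp ⟨j, k⟩)).2 : ℕ) : ℝ) =
        ((P.opp ⟨j, k⟩).2 : ℕ) + 1 + m' * P.sides (P.opp ⟨j, k⟩).1 := by exact_mod_cast hm'
      rw [hm'']
      change _ = _ + _ + _ + _ * (P.sides (P.opp ⟨j, k⟩).1 : ℝ)
      simp
      ring
    · right
      rw [hd] at h3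
      push_cast at h3
      have hnext : P.next ⟨j, k⟩ = ⟨j, l⟩ := by
        obtain ⟨m', hm'⟩ := P.next_val ⟨j, k⟩
        refine Sigma.ext rfl (heq_of_eq (Fin.ext ?_))
        refine int_eq_of_mul_lt (p := P.sides j) (m := m' + m) (P.next ⟨j, k⟩).2.2 l.2 ?_
        rw [hm', add_mul]
        change ((k : ℕ) : ℤ) + 1 + m' * P.sides j = _
        linarith
      have hrot : P.rot.symm ⟨j, l⟩ = P.opp ⟨j, k⟩ := by
        rw [Equiv.symm_apply_eq, ← hnext]
        change _ = P.next (P.opp (P.opp ⟨j, k⟩))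
        rw [P.opp_opp]
      refine ⟨by linarith, ?_, ?_⟩
      · rw [hrot, P.opp_opp]
      · rw [hrot, sidePoint_eq_polar]
        refine P.cornerPoint_congr 0 rfl (m := 0) ?_
        simp
        linarith

/-- Angles agree modulo the number of sides, and `t' - t` lies strictly between `-1` and `1`, even
if `t'` is an endpoint; so the indices of the sides agree. -/
theorem sidePoint_inj {s s' : P.Side} {t t' : ℝ} (h0 : 0 < t) (h1 : t < 1) (h0' : 0 ≤ t')
    (h1' : t' ≤ 1) (h : (s'.1, P.sidePoint s' t') = (s.1, P.sidePoint s t)) : s' = s ∧ t' = t := by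
  rw [sidePoint_eq_polar, sidePoint_eq_polar] at h
  obtain ⟨hs, h2⟩ := Prod.mk.inj h
  obtain ⟨j, k⟩ := s'
  obtain ⟨j', l⟩ := s
  obtain rfl : j = j' := hs
  obtain ⟨-, m, hm⟩ := (P.polar_eq_iff j (by norm_num) le_rfl (by norm_num) le_rfl).1 h2
  simp only at hm
  have h3 : (((l : ℕ) + m * P.sides j - (k : ℕ) : ℤ) : ℝ) = t' - t := by
    push_cast; linarith
  have h4 : (((l : ℕ) + m * P.sides j - (k : ℕ) : ℤ) : ℝ) < (1 : ℤ) := by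
    rw [h3]; push_cast; linarith
  have h5 : ((-1 : ℤ) : ℝ) < (((l : ℕ) + m * P.sides j - (k : ℕ) : ℤ) : ℝ) := by
    rw [h3]; push_cast; linarith
  have h4' := Int.cast_lt.1 h4
  have h5' := Int.cast_lt.1 h5
  have hd : (l : ℕ) + m * P.sides j - (k : ℕ) = 0 := by omega
  rw [hd] at h3
  obtain rfl : k = l := Fin.ext (int_eq_of_mul_lt k.2 l.2 (m := m) (by linarith))
  exact ⟨rfl, by push_cast at h3; linarith⟩

theorem sameCycle_opp {s c : P.Side} (h : P.oppPerm.SameCycle s c) : c = s ∨ c = P.opp s := by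
  obtain ⟨i, rfl⟩ := h
  have hsq : P.oppPerm * P.oppPerm = 1 := Equiv.ext fun s => P.opp_opp s
  rcases Int.even_or_odd' i with ⟨k, rfl | rfl⟩
  · left
    rw [zpow_mul, zpow_two, hsq, one_zpow]; rfl
  · right
    rw [zpow_add, zpow_mul, zpow_two, hsq, one_zpow, one_mul, zpow_one]; rfl

open Classical in
/-- The star of the point with parameter `t` of the side `s`. -/
noncomputable def edgeStar (hself : ∀ s : P.Side, (P.opp s).1 ≠ s.1) (s : P.Side) (t : ℝ)
    (h0 : 0 < t) (h1 : t < 1) : P.Star :=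
  have hs : P.opp s ≠ s := P.opp_ne s
  -- The same point of the edge has parameter `t` on `s` and `1 - t` on `P.opp s`.
  let a : P.Side → ℝ := fun c => if c = s then t else 1 - t
  have ha0 : ∀ c, min t (1 - t) ≤ a c := fun c => by
    simp only [a]; split_ifs; exacts [min_le_left _ _, min_le_right _ _]
  have ha1 : ∀ c, a c ≤ 1 - min t (1 - t) := fun c => by
    simp only [a]; split_ifs
    · have := min_le_right t (1 - t); linarith
    · have := min_le_left t (1 - t); linarith
  have hopp : ∀ c, P.oppPerm.SameCycle s c → a (P.opp c) = 1 - a c := fun c hc => by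
    rcases P.sameCycle_opp hc with rfl | rfl
    · simp [a, hs]
    · simp [a, hs, P.opp_opp]
  have hmin : 0 < min t (1 - t) := lt_min h0 (by linarith)
  have hminlt : min t (1 - t) < 1 := (min_le_left _ _).trans_lt h1
  { rot := P.oppPerm
    base := s
    shift := a
    -- Half the distance to the nearer end of the side, so that the corners contain no vertex.
    rad := min t (1 - t) / 2
    rad_pos := by positivity
    rad_lt := by linarith
    inj := by
      rintro c c' hc hc' v v' r r' hv hv' hr hr1 hr' hr1' h
      obtain ⟨hcc, h2⟩ := Prod.mk.inj h
      -- The only corners are `s` and `P.opp s`; as no face is its own neighbor, they lie in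
      -- different polygons.
      have hcc' : c = c' := by
        rcases P.sameCycle_opp hc with rfl | rfl <;> rcases P.sameCycle_opp hc' with rfl | rfl
        · rfl
        · exact absurd hcc.symm (hself _)
        · exact absurd hcc (hself _)
        · rfl
      subst hcc'
      obtain ⟨rfl, m, hm⟩ := (P.polar_eq_iff _ (by linarith) hr1 (by linarith) hr1').1 h2
      rw [abs_le] at hv hv'
      have hp : (1 : ℝ) ≤ P.sides c.1 := by exact_mod_cast P.sides_pos c.1
      have hm0 : m = 0 := by
        by_contra hm0
        rcases lt_or_gt_of_ne hm0 with hm0 | hm0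
        · have : (m : ℝ) ≤ -1 := by exact_mod_cast Int.le_sub_one_of_lt hm0
          nlinarith
        · have : (1 : ℝ) ≤ m := by exact_mod_cast hm0
          nlinarith
      subst hm0
      simp only [Int.cast_zero, zero_mul, add_zero] at hm
      exact ⟨rfl, by linarith, rfl⟩
    side := by
      intro c hc v hv0 hv1
      have := ha0 c
      have := ha1 c
      refine ⟨a c + v, by linarith, by linarith, fun h => ⟨by linarith, by linarith⟩, ?_, ?_⟩
      · rw [sidePoint_eq_polar]
        exact P.cornerPoint_congr a rfl (m := 0) (by simp; ring)
      · rw [sidePoint_eq_polar]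
        refine P.cornerPoint_congr a (c := P.opp c) rfl (m := 0) ?_
        rw [hopp c hc]
        simp
        ring
    glue := by
      rintro c hc v hv c' t' h0' h1' h
      have hac0 := ha0 c
      have hac1 := ha1 c
      have hoppc := hopp c hc
      rw [abs_le] at hv
      have key : c' = c ∧ t' = a c + v := by
        refine P.sidePoint_inj (by linarith) (by linarith) h0' h1' (h.trans ?_)
        rw [sidePoint_eq_polar, cornerPoint, add_assoc]
      obtain ⟨rfl, rfl⟩ := key
      have hg : ((P.opp c').1, P.sidePoint (P.opp c') (1 - (a c' + v))) =
          P.cornerPoint a (P.opp c') (-v) 1 := by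
        rw [sidePoint_eq_polar]
        refine P.cornerPoint_congr a (c := P.opp c') rfl (m := 0) ?_
        rw [hoppc]
        simp
        ring
      rcases le_total 0 v with hv0 | hv0
      · exact .inl ⟨hv0, rfl, hg⟩
      · exact .inr ⟨hv0, (P.opp_opp c').symm, hg⟩ }

theorem exists_polar_eq (j : Fin n) (z : Disk) (hz : ‖(z : ℂ)‖ = 1) :
    ∃ (k : Fin (P.sides j)) (t : ℝ), 0 ≤ t ∧ t < 1 ∧ P.polar j ((k : ℕ) + t) 1 = z := by
  have hp := P.sides_pos' j
  have hp' : (0 : ℤ) < P.sides j := by exact_mod_cast P.sides_pos j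
  have hpi := Real.pi_pos
  -- The angle measured in sides; its integer part modulo the number of sides is the side, its
  -- fractional part the parameter.
  set u : ℝ := P.sides j * Complex.arg z / (2 * Real.pi) with hu
  have hk0 := Int.emod_nonneg ⌊u⌋ hp'.ne'
  have hk1 := Int.emod_lt_of_pos ⌊u⌋ hp'
  refine ⟨⟨(⌊u⌋ % P.sides j).toNat, by omega⟩, Int.fract u, Int.fract_nonneg u,
    Int.fract_lt_one u, ?_⟩
  have hc : (((⌊u⌋ % P.sides j).toNat : ℕ) : ℝ) = ((⌊u⌋ % P.sides j : ℤ) : ℝ) := by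
    exact_mod_cast Int.toNat_of_nonneg hk0
  have hd := Int.emod_add_mul_ediv ⌊u⌋ (P.sides j)
  have hd' : ((⌊u⌋ % P.sides j : ℤ) : ℝ) + P.sides j * (⌊u⌋ / P.sides j : ℤ) = ⌊u⌋ := by
    exact_mod_cast hd
  have := Int.floor_add_fract u
  rw [show ((((⟨(⌊u⌋ % P.sides j).toNat, by omega⟩ : Fin (P.sides j)) : ℕ) : ℝ) + Int.fract u) =
    u + (-(⌊u⌋ / P.sides j) : ℤ) * P.sides j by
      simp only [hc]; push_cast; linarith, polar_add_mul]
  ext1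
  have hang : 2 * Real.pi * u / P.sides j = Complex.arg z := by rw [hu]; field_simp
  have := Complex.norm_mul_exp_arg_mul_I (z : ℂ)
  rw [hz] at this
  simp only [polar, hang, Circle.coe_exp]
  simpa using this

/-- Every boundary point of a polygon is the centre of a star. -/
theorem exists_star (hself : ∀ s : P.Side, (P.opp s).1 ≠ s.1) (j : Fin n) (z : Disk)
    (hz : ‖(z : ℂ)‖ = 1) : ∃ T : P.Star, P.cornerPoint T.shift T.base 0 1 = (j, z) ∧
      ((T.rot = P.rot ∧ T.shift = 0) ∨ T.rot = P.oppPerm) := by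
  obtain ⟨k, t, h0, h1, rfl⟩ := P.exists_polar_eq j z hz
  rcases h0.eq_or_lt with rfl | h0
  · exact ⟨P.vertexStar ⟨j, k⟩, by simp [cornerPoint, vertexStar], .inl ⟨rfl, rfl⟩⟩
  · exact ⟨P.edgeStar hself ⟨j, k⟩ t h0 h1, by simp [cornerPoint, edgeStar], .inr rfl⟩

end GluingPattern

/-! ### The quotient map from the polygons to the surface -/

namespace Polyhedron

variable {M : Type u} [TopologicalSpace M] {n : ℕ} (P : Polyhedron M n)

/-- The map from the disjoint union of the polygons onto the surface. -/
noncomputable def quot (p : Fin n × Disk) : M := P.char p.1 p.2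

theorem continuous_quot : Continuous P.quot :=
  continuous_prod_of_discrete_left.2 fun j => (P.char j).continuous

theorem quot_eq_iff (p p' : Fin n × Disk) : P.quot p = P.quot p' ↔ Relation.EqvGen P.Glue p p' :=
  P.char_eq_iff _ _ _ _

theorem quot_eq_of_glue {p p' : Fin n × Disk} (h : P.Glue p p') : P.quot p = P.quot p' :=
  (P.quot_eq_iff p p').2 (.rel _ _ h)

theorem quot_surjective : Function.Surjective P.quot := fun m =>
  let ⟨j, z, h⟩ := P.char_surjective m
  ⟨(j, z), h⟩

theorem isClosedMap_quot [T2Space M] : IsClosedMap P.quot := P.continuous_quot.isClosedMap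

/-- A property that holds near all preimages of `x` holds at all preimages of points near `x`. -/
theorem eventually_quot [T2Space M] {x : M} {Q : Fin n × Disk → Prop}
    (h : ∀ p, P.quot p = x → ∀ᶠ p' in 𝓝 p, Q p') : ∀ᶠ x' in 𝓝 x, ∀ p, P.quot p = x' → Q p := by
  have h1 := P.isClosedMap_quot.comap_nhds_le (y := x)
  have h2 : {p | Q p} ∈ Filter.comap P.quot (𝓝 x) :=
    h1 (mem_nhdsSet_iff_forall.2 fun p hp => h p hp)
  obtain ⟨V, hV, hVQ⟩ := h2
  filter_upwards [hV] with x' hx' p hp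
  exact hVQ (by rw [Set.mem_preimage, hp]; exact hx')

theorem norm_le (z : Disk) : ‖(z : ℂ)‖ ≤ 1 := mem_closedBall_zero_iff.1 z.2

theorem norm_sidePoint (s : P.Side) (t : ℝ) : ‖(P.sidePoint s t : ℂ)‖ = 1 := by
  rw [GluingPattern.sidePoint_eq_polar, GluingPattern.norm_polar _ _ _ zero_le_one le_rfl]

theorem norm_of_glue {p p' : Fin n × Disk} (h : P.Glue p p') :
    ‖(p.2 : ℂ)‖ = 1 ∧ ‖(p'.2 : ℂ)‖ = 1 := by
  obtain ⟨s, t, -, -⟩ := h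
  exact ⟨P.norm_sidePoint _ _, P.norm_sidePoint _ _⟩

/-- The gluing involves only points of norm one, so an interior point is alone in its class. The
induction carries both directions to cover the symmetric case. -/
theorem eq_of_quot_eq {p p' : Fin n × Disk} (h : P.quot p = P.quot p') (hp : ‖(p.2 : ℂ)‖ < 1) :
    p' = p := by
  have h' := (P.quot_eq_iff p p').1 h
  have key : (‖(p.2 : ℂ)‖ < 1 → p' = p) ∧ (‖(p'.2 : ℂ)‖ < 1 → p' = p) := by
    clear h hp
    induction h' with
    | rel p p' h =>
      have := P.norm_of_glue h
      exact ⟨fun h => by linarith, fun h => by linarith⟩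
    | refl p => simp
    | symm p p' _ ih => exact ⟨fun h => (ih.2 h).symm, fun h => (ih.1 h).symm⟩
    | trans p p' p'' _ _ ih1 ih2 =>
      refine ⟨fun h => ?_, fun h => ?_⟩
      · have h1 := ih1.1 h
        subst h1
        exact ih2.1 h
      · have h1 := ih2.2 h
        subst h1
        exact ih1.2 h
  exact key.1 hp

theorem quot_mem_face {p : Fin n × Disk} {j : Fin n} :
    P.quot p ∈ P.face j ↔ p.1 = j ∧ ‖(p.2 : ℂ)‖ < 1 := by
  constructor
  · rintro ⟨z, hz, h⟩
    have := P.eq_of_quot_eq (p := (j, z)) (p' := p) h hz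
    subst this
    exact ⟨rfl, hz⟩
  · rintro ⟨rfl, h⟩
    exact ⟨p.2, h, rfl⟩

theorem exists_face_or (x : M) : (∃ j, x ∈ P.face j) ∨
    ∃ j, ∃ z : Disk, ‖(z : ℂ)‖ = 1 ∧ P.quot (j, z) = x := by
  obtain ⟨⟨j, z⟩, rfl⟩ := P.quot_surjective x
  rcases (norm_le z).lt_or_eq with h | h
  · exact .inl ⟨j, P.quot_mem_face.2 ⟨rfl, h⟩⟩
  · exact .inr ⟨j, z, h, rfl⟩

theorem face_unique {x : M} {j k : Fin n} (hj : x ∈ P.face j) (hk : x ∈ P.face k) : j = k := by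
  obtain ⟨p, rfl⟩ := P.quot_surjective x
  rw [← (P.quot_mem_face.1 hj).1, (P.quot_mem_face.1 hk).1]

theorem notMem_edge_of_mem_face {x : M} {j : Fin n} (hj : x ∈ P.face j) (s : P.Side) :
    x ∉ P.edge s := by
  rintro ⟨t, -, rfl⟩
  have := (P.quot_mem_face (p := (s.1, P.sidePoint s t)).1 hj).2
  rw [P.norm_sidePoint] at this
  exact lt_irrefl _ this

theorem notMem_edges_of_mem_face {x : M} {j : Fin n} (hj : x ∈ P.face j) : x ∉ P.edges := by
  intro h
  obtain ⟨s, hs⟩ := Set.mem_iUnion.1 h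
  exact P.notMem_edge_of_mem_face hj s hs

theorem notMem_vertices_of_mem_face {x : M} {j : Fin n} (hj : x ∈ P.face j) : x ∉ P.vertices := by
  rintro ⟨s, rfl⟩
  have := (P.quot_mem_face (p := (s.1, P.sidePoint s 0)).1 hj).2
  rw [P.norm_sidePoint] at this
  exact lt_irrefl _ this

end Polyhedron

/-! ### Star neighbourhoods and their contraction -/

namespace GluingPattern.Star

variable {n : ℕ} {P₀ : GluingPattern n} (T : P₀.Star)

/-- The labels of the corners of a star. -/
abbrev Corner : Type := {c : P₀.Side // T.rot.SameCycle T.base c}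

/-- The parameters of the points of the corners of a star. -/
abbrev Box : Type := T.Corner × Set.Icc (-T.rad) T.rad × Set.Icc (1 - T.rad) 1

/-- The point of the polygons with given parameters. -/
noncomputable def pt (a : T.Box) : Fin n × Disk := P₀.cornerPoint T.shift a.1.1 a.2.1 a.2.2

theorem pt_injective : Function.Injective T.pt := by
  rintro ⟨⟨c, hc⟩, ⟨v, hv⟩, r, hr⟩ ⟨⟨c', hc'⟩, ⟨v', hv'⟩, r', hr'⟩ h
  obtain ⟨rfl, rfl, rfl⟩ := T.inj c c' hc hc' v v' r r' (abs_le.2 hv) (abs_le.2 hv') hr.1 hr.2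
    hr'.1 hr'.2 h
  rfl

theorem continuous_pt : Continuous T.pt := by
  refine continuous_prod_of_discrete_left.2 fun c => ?_
  change Continuous fun b : Set.Icc (-T.rad) T.rad × Set.Icc (1 - T.rad) 1 =>
    (c.1.1, P₀.polar c.1.1 ((c.1.2 : ℕ) + T.shift c.1 + (b.1 : ℝ)) (b.2 : ℝ))
  have h : Continuous fun b : Set.Icc (-T.rad) T.rad × Set.Icc (1 - T.rad) 1 =>
      (((c.1.2 : ℕ) + T.shift c.1 + (b.1 : ℝ), (b.2 : ℝ)) : ℝ × ℝ) :=
    (continuous_const.add (continuous_subtype_val.comp continuous_fst)).prodMk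
      (continuous_subtype_val.comp continuous_snd)
  exact continuous_const.prodMk ((P₀.continuous_polar c.1.1).comp h)

theorem norm_pt (a : T.Box) : ‖((T.pt a).2 : ℂ)‖ = a.2.2 := by
  have := a.2.2.2.1
  have := T.rad_lt
  exact P₀.norm_polar _ _ (by linarith) a.2.2.2.2

def zero : Set.Icc (-T.rad) T.rad := ⟨0, by have := T.rad_pos; constructor <;> linarith⟩

def neg (v : Set.Icc (-T.rad) T.rad) : Set.Icc (-T.rad) T.rad :=
  ⟨-v, by have := v.2.1; have := v.2.2; constructor <;> linarith⟩

def one : Set.Icc (1 - T.rad) 1 := ⟨1, by have := T.rad_pos; constructor <;> linarith⟩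

def baseCorner : T.Corner := ⟨T.base, .refl _ _⟩

def rotCorner (c : T.Corner) : T.Corner := ⟨T.rot c, Equiv.Perm.sameCycle_apply_right.2 c.2⟩

def rotSymmCorner (c : T.Corner) : T.Corner :=
  ⟨T.rot.symm c, Equiv.Perm.sameCycle_symm_apply_right.2 c.2⟩

/-- There are finitely many sides, so nonnegative powers of `rot` already reach the whole cycle. -/
theorem corner_induction {Q : T.Corner → Prop} (h0 : Q T.baseCorner)
    (h1 : ∀ c, Q c → Q (T.rotCorner c)) (c : T.Corner) : Q c := by
  obtain ⟨c, hc⟩ := c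
  obtain ⟨i, -, rfl⟩ := hc.exists_pow_eq'
  induction i with
  | zero => exact h0
  | succ i ih =>
    have hi : T.rot.SameCycle T.base ((T.rot ^ i) T.base) := ⟨i, by simp⟩
    have := h1 _ (ih hi)
    refine (congrArg Q (Subtype.ext ?_)).mp this
    change T.rot ((T.rot ^ i) T.base) = (T.rot ^ (i + 1)) T.base
    rw [pow_succ', Equiv.Perm.mul_apply]

/-- The radial contraction of the corners. -/
noncomputable def contract (z : T.Box × I) : T.Box :=
  (z.1.1, Set.Icc.convexComb z.1.2.1 T.zero z.2, Set.Icc.convexComb z.1.2.2 T.one z.2)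

theorem continuous_contract : Continuous T.contract := by
  have h := @Set.Icc.continuous_convexComb_prod
  refine (continuous_fst.comp continuous_fst).prodMk (Continuous.prodMk ?_ ?_)
  · exact (h (a := -T.rad) (b := T.rad)).comp ((continuous_fst.comp (continuous_snd.comp
      continuous_fst)).prodMk (continuous_const.prodMk continuous_snd))
  · exact (h (a := 1 - T.rad) (b := 1)).comp ((continuous_snd.comp (continuous_snd.comp
      continuous_fst)).prodMk (continuous_const.prodMk continuous_snd))

/-- If a point of a corner is glued to another point, along the side `s`, then the latter lies
in an adjacent corner. -/
theorem exists_of_side (s : P₀.Side) (t : ℝ) (h0 : 0 ≤ t) (h1 : t ≤ 1) (a : T.Box)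
    (ha : (s.1, P₀.sidePoint s t) = T.pt a) : ∃ c' : T.Corner,
      T.pt (c', T.neg a.2.1, a.2.2) = ((P₀.opp s).1, P₀.sidePoint (P₀.opp s) (1 - t)) ∧
      a.2.2 = T.one ∧ (((0 : ℝ) ≤ a.2.1 ∧ s = a.1 ∧ c' = T.rotCorner a.1) ∨
        ((a.2.1 : ℝ) ≤ 0 ∧ s = P₀.opp (T.rotSymmCorner a.1) ∧ c' = T.rotSymmCorner a.1)) := by
  obtain ⟨c, v, r⟩ := a
  have hr : r = T.one := by
    have := T.norm_pt (c, v, r)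
    rw [← ha] at this
    refine Subtype.ext (this.symm.trans ?_)
    change ‖(P₀.sidePoint s t : ℂ)‖ = 1
    rw [sidePoint_eq_polar, norm_polar _ _ _ zero_le_one le_rfl]
  subst hr
  rcases T.glue c.1 c.2 v (abs_le.2 v.2) s t h0 h1 ha with ⟨hv, hs, h⟩ | ⟨hv, hs, h⟩
  · exact ⟨T.rotCorner c, h.symm, rfl, .inl ⟨hv, hs, rfl⟩⟩
  · exact ⟨T.rotSymmCorner c, h.symm, rfl, .inr ⟨hv, hs, rfl⟩⟩

variable {M : Type u} [TopologicalSpace M] (P : Polyhedron M n) (T : P.Star)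

theorem quot_rotCorner (c : T.Corner) (v : Set.Icc (-T.rad) T.rad) (hv : (0 : ℝ) ≤ v) :
    P.quot (T.pt (c, v, T.one)) = P.quot (T.pt (T.rotCorner c, T.neg v, T.one)) := by
  obtain ⟨t, h0, h1, -, h2, h3⟩ := T.side c.1 c.2 v hv v.2.2
  refine P.quot_eq_of_glue ?_
  have := Glue.side (P := P.toGluingPattern) c.1 t h0 h1
  rw [h2, h3] at this
  exact this

/-- The point of the surface in the middle of a star. -/
noncomputable def center : M := P.quot (T.pt (T.baseCorner, T.zero, T.one))

/-- The closed neighbourhood of the centre covered by the corners of a star. -/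
noncomputable def nbhd : Set M := Set.range (P.quot ∘ T.pt)

theorem neg_zero' : T.neg T.zero = T.zero := Subtype.ext (by simp [neg, zero])

theorem quot_pt_zero (c : T.Corner) : P.quot (T.pt (c, T.zero, T.one)) = T.center P := by
  induction c using T.corner_induction with
  | h0 => rfl
  | h1 c ih => rw [← ih, quot_rotCorner P T c T.zero le_rfl, neg_zero']

/-- Adjacent corners are glued along `r = 1` by `v ↦ -v`. The contraction is linear towards `v = 0`,
`r = 1`: it is odd in `v`, keeps the sign of `v` and fixes `r = 1`, so it commutes with this gluing.
-/
theorem quot_contract_of_side (s : P.Side) (t : ℝ) (h0 : 0 ≤ t) (h1 : t ≤ 1) (a : T.Box)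
    (ha : (s.1, P.sidePoint s t) = T.pt a) :
    ∃ a' : T.Box, T.pt a' = ((P.opp s).1, P.sidePoint (P.opp s) (1 - t)) ∧
      a'.2.1 = T.neg a.2.1 ∧ a'.2.2 = a.2.2 ∧
      ∀ u, P.quot (T.pt (T.contract (a, u))) = P.quot (T.pt (T.contract (a', u))) := by
  obtain ⟨c', hc', hr, h⟩ := T.exists_of_side s t h0 h1 a ha
  refine ⟨_, hc', rfl, rfl, fun u => ?_⟩
  obtain ⟨c, v, r⟩ := a
  obtain rfl : r = T.one := hr
  have e1 : Set.Icc.convexComb T.one T.one u = T.one := Set.Icc.convexComb_eq _ _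
  have e2 : ∀ v, Set.Icc.convexComb (T.neg v) T.zero u = T.neg (Set.Icc.convexComb v T.zero u) :=
    fun v => Subtype.ext (by simp [neg, zero])
  have e3 : ((Set.Icc.convexComb v T.zero u : Set.Icc (-T.rad) T.rad) : ℝ) = (1 - u) * v := by
    simp [zero]
  have hu : (0 : ℝ) ≤ 1 - u := sub_nonneg.2 u.2.2
  simp only [contract, e1, e2]
  rcases h with ⟨hv, -, rfl⟩ | ⟨hv, -, rfl⟩
  · exact quot_rotCorner P T c _ (by rw [e3]; exact mul_nonneg hu hv)
  -- For `v ≤ 0` the gluing is read from the preceding corner, at `-v ≥ 0`.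
  · have := quot_rotCorner P T (T.rotSymmCorner c) (T.neg (Set.Icc.convexComb v T.zero u))
      (by simp only [neg, e3]; linarith [mul_nonneg hu (neg_nonneg.2 hv)])
    rw [this]
    congr 2
    refine Prod.ext (Subtype.ext ?_) (Prod.ext (Subtype.ext ?_) rfl)
    · exact (Equiv.apply_symm_apply _ _).symm
    · simp [neg]

/-- The corners of a star are saturated, and their contraction respects the gluing. -/
theorem quot_contract_of_eqvGen {p p' : Fin n × Disk} (h : Relation.EqvGen P.Glue p p') :
    (∀ a : T.Box, p = T.pt a → ∃ a' : T.Box, T.pt a' = p' ∧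
      (a'.2.1 = a.2.1 ∨ a'.2.1 = T.neg a.2.1) ∧ a'.2.2 = a.2.2 ∧
      ∀ u, P.quot (T.pt (T.contract (a, u))) = P.quot (T.pt (T.contract (a', u)))) ∧
    (∀ a : T.Box, p' = T.pt a → ∃ a' : T.Box, T.pt a' = p ∧
      (a'.2.1 = a.2.1 ∨ a'.2.1 = T.neg a.2.1) ∧ a'.2.2 = a.2.2 ∧
      ∀ u, P.quot (T.pt (T.contract (a, u))) = P.quot (T.pt (T.contract (a', u)))) := by
  have hneg : ∀ v, T.neg (T.neg v) = v := fun v => Subtype.ext (by simp [neg])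
  have one_dir : ∀ {p p'}, P.Glue p p' → ∀ a : T.Box, p = T.pt a → ∃ a' : T.Box, T.pt a' = p' ∧
      (a'.2.1 = a.2.1 ∨ a'.2.1 = T.neg a.2.1) ∧ a'.2.2 = a.2.2 ∧
      ∀ u, P.quot (T.pt (T.contract (a, u))) = P.quot (T.pt (T.contract (a', u))) := by
    rintro _ _ ⟨s, t, h0, h1⟩ a ha
    obtain ⟨a', h2, h3, h4, h5⟩ := quot_contract_of_side P T s t h0 h1 a ha
    exact ⟨a', h2, .inr h3, h4, h5⟩
  have tr : ∀ {p p' p'' : Fin n × Disk}, (∀ a : T.Box, p = T.pt a → ∃ a' : T.Box, T.pt a' = p' ∧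
      (a'.2.1 = a.2.1 ∨ a'.2.1 = T.neg a.2.1) ∧ a'.2.2 = a.2.2 ∧
      ∀ u, P.quot (T.pt (T.contract (a, u))) = P.quot (T.pt (T.contract (a', u)))) →
      (∀ a : T.Box, p' = T.pt a → ∃ a' : T.Box, T.pt a' = p'' ∧
      (a'.2.1 = a.2.1 ∨ a'.2.1 = T.neg a.2.1) ∧ a'.2.2 = a.2.2 ∧
      ∀ u, P.quot (T.pt (T.contract (a, u))) = P.quot (T.pt (T.contract (a', u)))) →
      (∀ a : T.Box, p = T.pt a → ∃ a' : T.Box, T.pt a' = p'' ∧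
      (a'.2.1 = a.2.1 ∨ a'.2.1 = T.neg a.2.1) ∧ a'.2.2 = a.2.2 ∧
      ∀ u, P.quot (T.pt (T.contract (a, u))) = P.quot (T.pt (T.contract (a', u)))) := by
    intro p p' p'' h1 h2 a ha
    obtain ⟨b, hb, hb1, hb2, hb3⟩ := h1 a ha
    obtain ⟨c, hc, hc1, hc2, hc3⟩ := h2 b hb.symm
    refine ⟨c, hc, ?_, hc2.trans hb2, fun u => (hb3 u).trans (hc3 u)⟩
    rcases hb1 with hb1 | hb1 <;> rcases hc1 with hc1 | hc1 <;> rw [hc1, hb1] <;> simp [hneg]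
  induction h with
  | rel p p' h => exact ⟨one_dir h, one_dir (P.glue_symm h)⟩
  | refl p => exact ⟨fun a h => ⟨a, h.symm, .inl rfl, rfl, fun _ => rfl⟩,
      fun a h => ⟨a, h.symm, .inl rfl, rfl, fun _ => rfl⟩⟩
  | symm p p' _ ih => exact ⟨ih.2, ih.1⟩
  | trans p p' p'' _ _ ih1 ih2 => exact ⟨tr ih1.1 ih2.1, tr ih2.2 ih1.2⟩

theorem exists_of_quot_eq {p : Fin n × Disk} {a : T.Box} (h : P.quot (T.pt a) = P.quot p) :
    ∃ a' : T.Box, T.pt a' = p ∧ (a'.2.1 = a.2.1 ∨ a'.2.1 = T.neg a.2.1) ∧ a'.2.2 = a.2.2 ∧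
      ∀ u, P.quot (T.pt (T.contract (a, u))) = P.quot (T.pt (T.contract (a', u))) :=
  (quot_contract_of_eqvGen P T ((P.quot_eq_iff _ _).1 h)).1 a rfl

theorem exists_pt_of_mem_nbhd {p : Fin n × Disk} (h : P.quot p ∈ T.nbhd P) : ∃ a, T.pt a = p := by
  obtain ⟨a, ha⟩ := h
  obtain ⟨a', h', -⟩ := exists_of_quot_eq P T ha
  exact ⟨a', h'⟩

theorem contractibleSpace_nbhd [T2Space M] : ContractibleSpace (T.nbhd P) := by
  refine contractibleSpace_range (P.quot ∘ T.pt) (P.continuous_quot.comp T.continuous_pt)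
    T.contract T.continuous_contract (fun a => ?_) (fun a b u h => ?_)
    (T.baseCorner, T.zero, T.one) fun a => ?_
  · simp [contract]
  · obtain ⟨b', hb', -, -, h'⟩ := exists_of_quot_eq P T h
    obtain rfl := T.pt_injective hb'
    exact h' u
  · simp only [contract, Set.Icc.convexComb_one]
    exact quot_pt_zero P T a.1

/-- Being glued preserves `r` and preserves `v` up to sign, so the preimages of the centre are
exactly the corner points with `v = 0`, `r = 1`. Near each of them the box contains all points of
the polygon, and `eventually_quot` carries this down to `M`. -/
theorem nbhd_mem_nhds [T2Space M] : T.nbhd P ∈ 𝓝 (T.center P) := by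
  have key : ∀ᶠ x in 𝓝 (T.center P), ∀ p, P.quot p = x → p ∈ Set.range T.pt := by
    refine P.eventually_quot fun p hp => ?_
    obtain ⟨⟨c, v, r⟩, rfl, hv, hr, -⟩ := exists_of_quot_eq P T hp.symm
    have hv' : v = T.zero := by
      rcases hv with hv | hv
      · exact hv
      · exact hv.trans T.neg_zero'
    obtain rfl : r = T.one := hr
    subst hv'
    have h := P.eventually_polar c.1.1 ((c.1.2 : ℕ) + T.shift c.1) T.rad_pos
    have e : T.pt (c, T.zero, T.one) = (c.1.1, P.polar c.1.1 ((c.1.2 : ℕ) + T.shift c.1) 1) := by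
      simp [pt, cornerPoint, zero, one]
    rw [e, nhds_prod_eq, nhds_discrete, Filter.pure_prod, Filter.eventually_map]
    filter_upwards [h] with z hz
    obtain ⟨v, r, h1, h2, h3, h4, rfl⟩ := hz
    exact ⟨(c, ⟨v, abs_le.1 h1⟩, ⟨r, h2, h3⟩), rfl⟩
  filter_upwards [key] with x hx
  obtain ⟨p, rfl⟩ := P.quot_surjective x
  obtain ⟨a, rfl⟩ := hx p rfl
  exact ⟨a, rfl⟩

/-- Continuity at `(0, 1)` gives a radius for each corner; as there are finitely many corners, one
radius serves all. -/
theorem exists_shrink {O : Set M} (hO : O ∈ 𝓝 (T.center P)) :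
    ∃ (δ : ℝ) (h0 : 0 < δ) (h1 : δ ≤ T.rad), (T.shrink δ h0 h1).nbhd P ⊆ O := by
  have h : ∀ c : T.Corner, ∀ᶠ δ in 𝓝[>] (0 : ℝ), ∀ v r : ℝ, |v| ≤ δ → 1 - δ ≤ r → r ≤ 1 →
      P.quot (P.cornerPoint T.shift c v r) ∈ O := by
    intro c
    have hc : Continuous fun z : ℝ × ℝ => P.quot (P.cornerPoint T.shift c z.1 z.2) :=
      P.continuous_quot.comp (continuous_const.prodMk ((P.continuous_polar c.1.1).comp
        ((continuous_const.add continuous_fst).prodMk continuous_snd)))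
    have hO' : O ∈ 𝓝 (P.quot (P.cornerPoint T.shift c 0 1)) := by
      rw [← quot_pt_zero P T c] at hO
      exact hO
    have := hc.continuousAt.preimage_mem_nhds (x := (0, 1)) hO'
    obtain ⟨ε, hε, hball⟩ := Metric.mem_nhds_iff.1 this
    filter_upwards [Ioo_mem_nhdsGT hε] with δ hδ v r hv hr hr1
    refine hball (?_ : (v, r) ∈ _)
    rw [Metric.mem_ball, Prod.dist_eq, max_lt_iff, Real.dist_eq, Real.dist_eq]
    constructor
    · simpa using hv.trans_lt hδ.2
    · rw [abs_lt]
      constructor <;> linarith [hδ.1, hδ.2]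
  have h2 : ∀ᶠ δ in 𝓝[>] (0 : ℝ), 0 < δ ∧ δ ≤ T.rad := by
    filter_upwards [Ioo_mem_nhdsGT T.rad_pos] with δ hδ
    exact ⟨hδ.1, hδ.2.le⟩
  obtain ⟨δ, hδ, h0, h1⟩ := ((Filter.eventually_all.2 h).and h2).exists
  refine ⟨δ, h0, h1, ?_⟩
  rintro _ ⟨⟨c, v, r⟩, rfl⟩
  exact hδ c v r (abs_le.2 v.2) r.2.1 r.2.2

end GluingPattern.Star

/-! ### The group of fluxes -/

namespace GluingPattern

variable {n : ℕ} (P : GluingPattern n)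

/-- The relations between signed edges: the two sides of an edge are opposite to each other, and
the edges around a vertex add up to zero. -/
def relations : AddSubgroup (P.Side → ℤ) := AddSubgroup.closure
  (Set.range (fun s => Pi.single s 1 + Pi.single (P.opp s) 1) ∪
    Set.range fun s => ∑ i ∈ Finset.range (Function.minimalPeriod P.rot s),
      Pi.single (P.rot^[i] s) 1)

/-- The cellular `1`-chains of the dual polyhedron modulo boundaries. -/
def Flux : Type := (P.Side → ℤ) ⧸ P.relations

noncomputable instance : AddCommGroup P.Flux :=
  inferInstanceAs (AddCommGroup ((P.Side → ℤ) ⧸ P.relations))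

instance : TopologicalSpace P.Flux := ⊥

instance : DiscreteTopology P.Flux := ⟨rfl⟩

/-- The class of a chain. -/
noncomputable def fluxMk : (P.Side → ℤ) →+ P.Flux := QuotientAddGroup.mk' P.relations

theorem fluxMk_eq_zero {μ : P.Side → ℤ} : P.fluxMk μ = 0 ↔ μ ∈ P.relations :=
  QuotientAddGroup.eq_zero_iff μ

/-- The class of a signed edge. -/
noncomputable def cls (s : P.Side) : P.Flux := P.fluxMk (Pi.single s 1)

theorem cls_opp (s : P.Side) : P.cls (P.opp s) = -P.cls s := by
  rw [eq_neg_iff_add_eq_zero, add_comm, cls, cls, ← map_add, fluxMk_eq_zero]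
  exact AddSubgroup.subset_closure (.inl ⟨s, rfl⟩)

/-- The condition for a potential around a vertex to be single-valued: the jumps of one full turn
cancel. -/
theorem sum_cls_rot (s : P.Side) :
    ∑ i ∈ Finset.range (Function.minimalPeriod P.rot s), P.cls (P.rot^[i] s) = 0 := by
  simp_rw [cls]
  rw [← map_sum, fluxMk_eq_zero]
  exact AddSubgroup.subset_closure (.inr ⟨s, rfl⟩)

theorem sum_cls_oppPerm (s : P.Side) :
    ∑ i ∈ Finset.range (Function.minimalPeriod P.oppPerm s), P.cls (P.oppPerm^[i] s) = 0 := by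
  have h : Function.minimalPeriod P.oppPerm s = 2 := by
    refine Function.minimalPeriod_eq_prime_iff.2 ⟨?_, P.opp_ne s⟩
    exact P.opp_opp s
  rw [h, Finset.sum_range_succ, Finset.sum_range_one]
  change P.cls s + P.cls (P.opp s) = 0
  rw [cls_opp, add_neg_cancel]

end GluingPattern

/-- A function on a cycle of a permutation with prescribed increments exists when the increments
add up to zero. -/
theorem exists_of_sum_cycle_eq_zero {α A : Type*} [Finite α] [AddCommGroup A] (f : Equiv.Perm α)
    (x : α) (a : α → A)
    (h : ∑ i ∈ Finset.range (Function.minimalPeriod f x), a (f^[i] x) = 0) :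
    ∃ τ : α → A, ∀ c, f.SameCycle x c → τ (f c) = τ c + a c := by
  set m := Function.minimalPeriod f x
  have hm : 0 < m := Function.minimalPeriod_pos_of_mem_periodicPts (f.injective.mem_periodicPts x)
  have hex : ∀ c, ∃ k, f.SameCycle x c → k < m ∧ f^[k] x = c := by
    intro c
    by_cases hc : f.SameCycle x c
    · obtain ⟨i, -, hi⟩ := hc.exists_pow_eq'
      refine ⟨i % m, fun _ => ⟨Nat.mod_lt _ hm, ?_⟩⟩
      rw [Function.iterate_mod_minimalPeriod_eq, Equiv.Perm.iterate_eq_pow, hi]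
    · exact ⟨0, fun h => absurd h hc⟩
  choose k hk using hex
  refine ⟨fun c => ∑ i ∈ Finset.range (k c), a (f^[i] x), fun c hc => ?_⟩
  obtain ⟨h1, h2⟩ := hk c hc
  obtain ⟨h3, h4⟩ := hk (f c) (Equiv.Perm.sameCycle_apply_right.2 hc)
  have h5 : f^[k c + 1] x = f c := by rw [Function.iterate_succ_apply', h2]
  have h6 : ∑ i ∈ Finset.range (k c), a (f^[i] x) + a c =
      ∑ i ∈ Finset.range (k c + 1), a (f^[i] x) := by rw [Finset.sum_range_succ, h2]
  simp only [h6]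
  -- Either `f c` is the next point in the enumeration of the cycle, or the enumeration returns to
  -- `x`, and then the vanishing of the total sum is needed.
  rcases (Nat.succ_le_of_lt h1).lt_or_eq with h7 | h7
  · have : k (f c) = k c + 1 :=
      Function.iterate_injOn_Iio_minimalPeriod (f := f) (x := x) h3 h7 (h4.trans h5.symm)
    rw [this]
  · have h7' : k c + 1 = m := h7
    have : k (f c) = 0 := by
      refine Function.iterate_injOn_Iio_minimalPeriod (f := f) (x := x) h3 hm ?_
      change f^[k (f c)] x = x
      rw [h4, ← h5, h7']
      exact Function.iterate_minimalPeriod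
    rw [this, h7', h, Finset.sum_range_zero]

/-! ### Local potentials, and potentials along maps into the surface -/

namespace Polyhedron

variable {M : Type u} [TopologicalSpace M] {n : ℕ} (P : Polyhedron M n)

/-- A locally constant function on the part of the polygons over an open set `U`, whose increment
across each side is the class of that side. -/
structure IsLocalPotential (U : Set M) (D : Fin n × Disk → P.Flux) : Prop where
  isOpen : IsOpen U
  eventually_eq : ∀ p, P.quot p ∈ U → ∀ᶠ p' in 𝓝 p, D p' = D p
  side : ∀ s t, 0 ≤ t → t ≤ 1 → P.quot (s.1, P.sidePoint s t) ∈ U →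
    D ((P.opp s).1, P.sidePoint (P.opp s) (1 - t)) = D (s.1, P.sidePoint s t) + P.cls s

theorem isOpen_face [T2Space M] (j : Fin n) : IsOpen (P.face j) := by
  rw [isOpen_iff_mem_nhds]
  intro x hx
  obtain ⟨p, rfl⟩ := P.quot_surjective x
  have h := P.eventually_quot (x := P.quot p) (Q := fun p' => p'.1 = j ∧ ‖(p'.2 : ℂ)‖ < 1) ?_
  · filter_upwards [h] with x hx
    obtain ⟨p, rfl⟩ := P.quot_surjective x
    exact P.quot_mem_face.2 (hx p rfl)
  · intro p' hp'
    rw [← hp', quot_mem_face] at hx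
    obtain ⟨rfl, h2⟩ := hx
    have c1 : Continuous fun q : Fin n × Disk => q.1 := continuous_fst
    have c2 : Continuous fun q : Fin n × Disk => ‖(q.2 : ℂ)‖ :=
      (continuous_subtype_val.comp continuous_snd).norm
    exact (c1.continuousAt.eventually_mem ((isOpen_discrete {p'.1}).mem_nhds rfl)).and
      (c2.continuousAt.eventually (gt_mem_nhds h2))

theorem isLocalPotential_face [T2Space M] (j : Fin n) : P.IsLocalPotential (P.face j) 0 where
  isOpen := P.isOpen_face j
  eventually_eq _ _ := .of_forall fun _ => rfl
  side s t _ _ h := by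
    have := (P.quot_mem_face.1 h).2
    rw [P.norm_sidePoint] at this
    exact absurd this (lt_irrefl _)

open Classical in
-- The potential is a constant `τ c` on each corner. Passing from `c` to `rot c` must add `cls c`,
-- and `hT` makes this consistent around the cycle.
theorem exists_isLocalPotential_star [T2Space M] (T : P.Star)
    (hT : ∑ i ∈ Finset.range (Function.minimalPeriod T.rot T.base), P.cls (T.rot^[i] T.base) = 0) :
    ∃ D, P.IsLocalPotential (interior (T.nbhd P)) D := by
  obtain ⟨τ, hτ⟩ := exists_of_sum_cycle_eq_zero T.rot T.base P.cls hT
  let D : Fin n × Disk → P.Flux := fun p => if h : ∃ a, T.pt a = p then τ h.choose.1 else 0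
  have hD : ∀ a, D (T.pt a) = τ a.1 := by
    intro a
    have h : ∃ b, T.pt b = T.pt a := ⟨a, rfl⟩
    simp only [D, dif_pos h]
    rw [T.pt_injective h.choose_spec]
  refine ⟨D, isOpen_interior, fun p hp => ?_, fun s t h0 h1 h => ?_⟩
  · obtain ⟨a, rfl⟩ := T.exists_pt_of_mem_nbhd P (interior_subset hp)
    -- The other corners form a closed set that misses `T.pt a`, so nearby points over the star lie
    -- in the same corner.
    have hc : IsClosed (T.pt '' {b | b.1 ≠ a.1}) := by
      refine T.continuous_pt.isClosedMap _ ?_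
      exact (isClosed_discrete {c | c ≠ a.1}).preimage continuous_fst
    have hn : T.pt a ∉ T.pt '' {b | b.1 ≠ a.1} := by
      rintro ⟨b, hb, hba⟩
      exact hb (congrArg Prod.fst (T.pt_injective hba))
    filter_upwards [hc.isOpen_compl.mem_nhds hn,
      (isOpen_interior.preimage P.continuous_quot).mem_nhds hp] with p' h1 h2
    obtain ⟨b, rfl⟩ := T.exists_pt_of_mem_nbhd P (interior_subset h2)
    rw [hD, hD]
    by_contra hne
    exact h1 ⟨b, fun h => hne (by rw [h]), rfl⟩
  · obtain ⟨a, ha⟩ := T.exists_pt_of_mem_nbhd P (interior_subset h)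
    obtain ⟨c', hc', -, h'⟩ := T.exists_of_side s t h0 h1 a ha.symm
    rw [← hc', ← ha, hD, hD]
    rcases h' with ⟨-, rfl, rfl⟩ | ⟨-, rfl, rfl⟩
    · exact hτ _ a.1.2
    · have := hτ _ (T.rotSymmCorner a.1).2
      have e : T.rot (T.rotSymmCorner a.1) = a.1 := T.rot.apply_symm_apply _
      rw [e] at this
      rw [this, P.cls_opp, add_neg_cancel_right]

section

variable {P}

/-- Both potentials jump by the same class across every side, so the jumps cancel in the difference,
which therefore descends to the surface. -/
theorem IsLocalPotential.sub_eq_sub {U U' : Set M} {D D' : Fin n × Disk → P.Flux}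
    (h : P.IsLocalPotential U D) (h' : P.IsLocalPotential U' D') {p p' : Fin n × Disk}
    (hp : P.quot p ∈ U) (hp' : P.quot p ∈ U') (hpp : P.quot p = P.quot p') :
    D' p - D p = D' p' - D p' := by
  have he := (P.quot_eq_iff p p').1 hpp
  clear hpp
  induction he with
  | rel p p' hg =>
    obtain ⟨s, t, h0, h1⟩ := hg
    rw [h.side s t h0 h1 hp, h'.side s t h0 h1 hp', add_sub_add_right_eq_sub]
  | refl p => rfl
  | symm p p' hg ih =>
    have := (P.quot_eq_iff p p').2 hg
    rw [ih (by rwa [this]) (by rwa [this])]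
  | trans p p' p'' hg _ ih1 ih2 =>
    have := (P.quot_eq_iff p p').2 hg
    rw [ih1 hp hp', ih2 (by rwa [← this]) (by rwa [← this])]

variable (P) in
/-- A choice of a point of the polygons over each point of the surface. -/
noncomputable def rep : M → Fin n × Disk := Function.surjInv P.quot_surjective

variable (P) in
theorem quot_rep (x : M) : P.quot (P.rep x) = x := Function.surjInv_eq P.quot_surjective x

/-- A potential of a map `f` into the surface: a function which differs from the pullback of each
local potential by a locally constant function. -/
def IsPotential {X : Type*} [TopologicalSpace X] (f : X → M) (y : X → P.Flux) : Prop :=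
  ∀ x, ∃ U D, f x ∈ U ∧ P.IsLocalPotential U D ∧
    ∀ᶠ x' in 𝓝 x, D (P.rep (f x')) - y x' = D (P.rep (f x)) - y x

theorem IsPotential.comp {X Y : Type*} [TopologicalSpace X] [TopologicalSpace Y] {f : X → M}
    {y : X → P.Flux} (h : IsPotential f y) {g : Y → X} (hg : Continuous g) :
    IsPotential (f ∘ g) (y ∘ g) := fun x =>
  let ⟨U, D, hx, hD, he⟩ := h (g x)
  ⟨U, D, hx, hD, hg.continuousAt.eventually he⟩

end

variable [T2Space M]

theorem exists_isLocalPotential (hself : P.NoSelfNeighbor) (x : M) :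
    ∃ U D, x ∈ U ∧ P.IsLocalPotential U D := by
  rcases P.exists_face_or x with ⟨j, hj⟩ | ⟨j, z, hz, rfl⟩
  · exact ⟨_, _, hj, P.isLocalPotential_face j⟩
  · obtain ⟨T, hT, h⟩ := P.exists_star hself j z hz
    have hc : P.quot (j, z) = T.center P := by rw [← hT]; rfl
    obtain ⟨D, hD⟩ := P.exists_isLocalPotential_star T (by
      rcases h with ⟨h, -⟩ | h
      · rw [h]; exact P.sum_cls_rot _
      · rw [h]; exact P.sum_cls_oppPerm _)
    exact ⟨_, D, by rw [hc, mem_interior_iff_mem_nhds]; exact T.nbhd_mem_nhds P, hD⟩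

variable {P}

/-- The difference does not depend on the chosen point of the polygons, so the discontinuity of
`rep` is harmless. -/
theorem IsLocalPotential.eventually_sub {U U' : Set M} {D D' : Fin n × Disk → P.Flux}
    (h : P.IsLocalPotential U D) (h' : P.IsLocalPotential U' D') {x : M} (hx : x ∈ U)
    (hx' : x ∈ U') : ∀ᶠ y in 𝓝 x,
      D' (P.rep y) - D (P.rep y) = D' (P.rep x) - D (P.rep x) := by
  have h1 : ∀ᶠ y in 𝓝 x, ∀ p, P.quot p = y → D' p - D p = D' (P.rep x) - D (P.rep x) := by
    refine P.eventually_quot fun p hp => ?_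
    filter_upwards [h.eventually_eq p (by rwa [hp]), h'.eventually_eq p (by rwa [hp])] with q h2 h3
    rw [h2, h3]
    exact h.sub_eq_sub h' (by rwa [hp]) (by rwa [hp]) (by rw [quot_rep, hp])
  filter_upwards [h1] with y hy
  exact hy _ (P.quot_rep y)

section Potential

variable {X : Type*} [TopologicalSpace X] {f : X → M} {y y' : X → P.Flux}

theorem IsPotential.eventually (h : IsPotential f y) (hf : Continuous f) {x : X} {U : Set M}
    {D : Fin n × Disk → P.Flux} (hD : P.IsLocalPotential U D) (hx : f x ∈ U) :
    ∀ᶠ x' in 𝓝 x, D (P.rep (f x')) - y x' = D (P.rep (f x)) - y x := by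
  obtain ⟨U', D', hx', hD', he⟩ := h x
  filter_upwards [he, hf.continuousAt.eventually (hD'.eventually_sub hD hx' hx)] with z h1 h2
  rw [← sub_add_sub_cancel _ (D' (P.rep (f z))), h1, h2, sub_add_sub_cancel]

/-- Two potentials of the same map differ by a locally constant function, so increments are well
defined; this is what makes `flux` independent of choices. -/
theorem IsPotential.sub_eq_sub [PreconnectedSpace X] (h : IsPotential f y) (h' : IsPotential f y')
    (hf : Continuous f) (a b : X) : y b - y a = y' b - y' a := by
  have hl : IsLocallyConstant fun x => y' x - y x := by
    rw [IsLocallyConstant.iff_eventually_eq]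
    intro x
    obtain ⟨U, D, hx, hD, he⟩ := h x
    filter_upwards [he, h'.eventually hf hD hx] with z h1 h2
    have := congrArg₂ (· - ·) h1 h2
    simpa only [sub_sub_sub_cancel_left] using this
  have := hl.apply_eq_of_preconnectedSpace b a
  rw [sub_eq_sub_iff_sub_eq_sub]
  rw [← neg_sub, this, neg_sub]

end Potential

section Bundle

variable (hself : P.NoSelfNeighbor)

/-- The principal bundle of the local potentials. -/
noncomputable def bundleCore : FiberBundleCore M M P.Flux :=
  let U := fun x => (P.exists_isLocalPotential hself x).choose
  let D := fun x => (P.exists_isLocalPotential hself x).choose_spec.choose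
  have hx : ∀ x, x ∈ U x := fun x =>
    (P.exists_isLocalPotential hself x).choose_spec.choose_spec.1
  have hD : ∀ x, P.IsLocalPotential (U x) (D x) := fun x =>
    (P.exists_isLocalPotential hself x).choose_spec.choose_spec.2
  { baseSet := U
    isOpen_baseSet := fun x => (hD x).isOpen
    indexAt := id
    mem_baseSet_at := hx
    -- Translation by the difference of two local potentials; these differences are locally constant
    -- and telescope, which is the cocycle condition.
    coordChange := fun i j x v => v + (D j (P.rep x) - D i (P.rep x))
    coordChange_self := fun i x _ v => by simp
    continuousOn_coordChange := fun i j => by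
      rintro ⟨x, v⟩ ⟨⟨h1, h2⟩, -⟩
      refine ContinuousAt.continuousWithinAt ?_
      have h3 : ∀ᶠ z : M × P.Flux in 𝓝 (x, v), z.2 + (D j (P.rep z.1) - D i (P.rep z.1)) =
          v + (D j (P.rep x) - D i (P.rep x)) := by
        rw [nhds_prod_eq, nhds_discrete P.Flux, Filter.prod_pure, Filter.eventually_map]
        filter_upwards [(hD i).eventually_sub (hD j) h1 h2] with z hz
        rw [hz]
      exact continuousAt_const.congr (h3.mono fun z hz => hz.symm)
    coordChange_comp := fun i j k x _ v => by abel }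

/-- The fibre is discrete, so the total space is a covering of `M` and `f` lifts to it. In a fixed
chart the coordinate of the lift is locally constant; for the `y` chosen here, that coordinate is
the local potential minus `y`. -/
theorem exists_isPotential (hself : P.NoSelfNeighbor) {X : Type*} [TopologicalSpace X]
    [SimplyConnectedSpace X] [LocallyPathConnectedSpace X] (f : C(X, M)) :
    ∃ y : X → P.Flux, IsPotential f y := by
  obtain ⟨x₀⟩ : Nonempty X := inferInstance
  let Z := bundleCore hself
  obtain ⟨F, ⟨-, hF⟩, -⟩ :=
    (FiberBundle.isCoveringMap (F := P.Flux) (E := Z.Fiber)).existsUnique_continuousMap_lifts f x₀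
      (⟨f x₀, (0 : P.Flux)⟩ : Bundle.TotalSpace P.Flux Z.Fiber) rfl
  have hF' : ∀ x, (F x).proj = f x := fun x => congrFun hF x
  let D := fun x => (P.exists_isLocalPotential hself x).choose_spec.choose
  let s : X → P.Flux := fun x => (F x).snd
  refine ⟨fun x => D (f x) (P.rep (f x)) - s x, fun x => ⟨Z.baseSet (f x), D (f x),
    (P.exists_isLocalPotential hself _).choose_spec.choose_spec.1,
    (P.exists_isLocalPotential hself _).choose_spec.choose_spec.2, ?_⟩⟩
  have hc : ContinuousAt (fun x' => (Z.localTriv (f x) (F x')).2) x := by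
    refine continuous_snd.continuousAt.comp
      (ContinuousAt.comp (((Z.localTriv (f x)).continuousOn).continuousAt ?_) F.continuous.continuousAt)
    refine (Z.localTriv (f x)).open_source.mem_nhds ?_
    rw [Bundle.Trivialization.mem_source]
    change (F x).proj ∈ Z.baseSet (f x)
    rw [hF']
    exact Z.mem_baseSet_at (f x)
  have hloc : ∀ᶠ x' in 𝓝 x, (Z.localTriv (f x) (F x')).2 = (Z.localTriv (f x) (F x)).2 :=
    hc.eventually_mem ((isOpen_discrete {(Z.localTriv (f x) (F x)).2}).mem_nhds rfl)
  have hval : ∀ x', (Z.localTriv (f x) (F x')).2 =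
      s x' + (D (f x) (P.rep (f x')) - D (f x') (P.rep (f x'))) := by
    intro x'
    change s x' + (D (f x) (P.rep (F x').proj) - D ((F x').proj) (P.rep (F x').proj)) = _
    rw [hF']
  filter_upwards [hloc] with x' hx'
  rw [hval, hval] at hx'
  rw [sub_sub_eq_add_sub, add_comm, add_sub_assoc, hx']
  abel

end Bundle

end Polyhedron

/-! ### Concatenation and the two halves of the interval -/

/-- The parametrization of the first half of the unit interval. -/
noncomputable def firstHalf : C(I, I) :=
  ⟨fun t => ⟨t / 2, by linarith [t.2.1], by linarith [t.2.2]⟩, by fun_prop⟩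

/-- The parametrization of the second half of the unit interval. -/
noncomputable def secondHalf : C(I, I) :=
  ⟨fun t => ⟨(1 + t) / 2, by linarith [t.2.1], by linarith [t.2.2]⟩, by fun_prop⟩

section

variable {X : Type*} [TopologicalSpace X] {a b c : X}

theorem trans_firstHalf (p : Path a b) (q : Path b c) (t : I) :
    p.trans q (firstHalf t) = p t := by
  have h : ((firstHalf t : I) : ℝ) ≤ 1 / 2 := by change (t : ℝ) / 2 ≤ 1 / 2; linarith [t.2.2]
  rw [Path.trans_apply, dif_pos h]
  congr 1
  ext1
  change 2 * ((t : ℝ) / 2) = t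
  ring

theorem trans_secondHalf (p : Path a b) (q : Path b c) (t : I) :
    p.trans q (secondHalf t) = q t := by
  rw [Path.trans_apply]
  split_ifs with h
  -- At the midpoint `Path.trans` uses its first branch.
  · have h' : (1 + (t : ℝ)) / 2 ≤ 1 / 2 := h
    have ht : t = 0 := Subtype.ext (by change (t : ℝ) = 0; linarith [t.2.1])
    subst ht
    rw [q.source]
    refine (congrArg p (Subtype.ext ?_)).trans p.target
    change 2 * ((1 + 0) / 2 : ℝ) = 1
    norm_num
  · congr 1
    ext1
    change 2 * ((1 + (t : ℝ)) / 2) - 1 = t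
    ring

end

/-! ### The flux of a curve -/

namespace Polyhedron

variable {M : Type u} [TopologicalSpace M] {n : ℕ} {P : Polyhedron M n}

section Flux

variable [T2Space M]

open Classical in
variable (P) in
/-- The flux of a curve: the increment of its potentials. -/
noncomputable def flux (c : I → M) : P.Flux :=
  -- The value `0` is only a convention: by `exists_isPotential_curve`, continuous curves have
  -- potentials when no face is its own neighbor.
  if h : ∃ y : I → P.Flux, IsPotential c y then h.choose 1 - h.choose 0 else 0

theorem IsPotential.flux_eq {c : I → M} {y : I → P.Flux} (h : IsPotential c y)
    (hc : Continuous c) : P.flux c = y 1 - y 0 := by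
  have he : ∃ y : I → P.Flux, IsPotential c y := ⟨y, h⟩
  rw [flux, dif_pos he]
  exact he.choose_spec.sub_eq_sub h hc 0 1

theorem exists_isPotential_curve (hself : P.NoSelfNeighbor) {c : I → M} (hc : Continuous c) :
    ∃ y : I → P.Flux, IsPotential c y := by
  have : ContractibleSpace I := (convex_Icc (0 : ℝ) 1).contractibleSpace ⟨0, by simp⟩
  have : LocallyPathConnectedSpace I := (convex_Icc (0 : ℝ) 1).locallyPathConnectedSpace
  exact exists_isPotential hself ⟨c, hc⟩

theorem flux_trans (hself : P.NoSelfNeighbor) {a b c : M} (p : Path a b) (q : Path b c) :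
    P.flux (p.trans q) = P.flux p + P.flux q := by
  obtain ⟨y, hy⟩ := exists_isPotential_curve hself (p.trans q).continuous
  have h1 : P.flux p = _ := IsPotential.flux_eq (c := p) (y := y ∘ firstHalf)
    ((funext (trans_firstHalf p q)) ▸ hy.comp firstHalf.continuous) p.continuous
  have h2 : P.flux q = _ := IsPotential.flux_eq (c := q) (y := y ∘ secondHalf)
    ((funext (trans_secondHalf p q)) ▸ hy.comp secondHalf.continuous) q.continuous
  rw [hy.flux_eq (p.trans q).continuous, h1, h2]
  have e1 : firstHalf 0 = 0 := Subtype.ext (by simp [firstHalf])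
  have e2 : firstHalf 1 = secondHalf 0 := Subtype.ext (by simp [firstHalf, secondHalf])
  have e3 : secondHalf 1 = 1 := Subtype.ext (by simp [secondHalf])
  simp only [Function.comp, e1, e2, e3]
  abel

theorem flux_symm (hself : P.NoSelfNeighbor) {a b : M} (p : Path a b) :
    P.flux p.symm = -P.flux p := by
  obtain ⟨y, hy⟩ := exists_isPotential_curve hself p.continuous
  have h1 : P.flux p.symm = _ := IsPotential.flux_eq (c := p.symm) (y := y ∘ σ)
    (hy.comp continuous_symm) p.symm.continuous
  rw [h1, hy.flux_eq p.continuous]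
  simp

/-- Inside a face `rep` has no choice, so there the local potential varies along the curve without
jumps. -/
theorem eventually_of_face {c : I → M} (hc : Continuous c) {t : I} {j : Fin n}
    (h : c t ∈ P.face j) {U : Set M} {D : Fin n × Disk → P.Flux} (hD : P.IsLocalPotential U D)
    (hU : c t ∈ U) : ∀ᶠ t' in 𝓝 t, D (P.rep (c t')) = D (P.rep (c t)) := by
  have hq : P.quot (P.rep (c t)) = c t := P.quot_rep _
  have h1 : ∀ᶠ x in 𝓝 (c t), ∀ p, P.quot p = x → D p = D (P.rep (c t)) := by
    refine P.eventually_quot fun p hp => ?_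
    obtain rfl : p = P.rep (c t) := P.eq_of_quot_eq (hq.trans hp.symm)
      (P.quot_mem_face.1 (hq.symm ▸ h)).2
    exact hD.eventually_eq _ (by rwa [hp])
  filter_upwards [hc.continuousAt.eventually h1] with t' ht'
  exact ht' _ (P.quot_rep _)

theorem flux_of_face {c : I → M} (hc : Continuous c) {j : Fin n} (h : ∀ t, c t ∈ P.face j) :
    P.flux c = 0 := by
  have hy : IsPotential c (0 : I → P.Flux) := by
    intro t
    refine ⟨_, _, h t, P.isLocalPotential_face j, ?_⟩
    filter_upwards [eventually_of_face hc (h t) (P.isLocalPotential_face j) (h t)] with t' ht'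
    rw [ht']; rfl
  rw [hy.flux_eq hc]
  simp

end Flux

section Edges

variable (P) in
theorem edge_opp (s : P.Side) : P.edge (P.opp s) = P.edge s := by
  have key : ∀ s : P.Side, P.edge s ⊆ P.edge (P.opp s) := by
    rintro s _ ⟨t, ht, rfl⟩
    exact ⟨1 - t, ⟨by linarith [ht.2], by linarith [ht.1]⟩,
      (P.quot_eq_of_glue (.side s t ht.1.le ht.2.le)).symm⟩
  refine Set.Subset.antisymm ?_ (key s)
  have := key (P.opp s)
  rwa [P.opp_opp] at this

/-- The points of the polygons over the point with parameter `t` of a side `s`. -/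
theorem eq_or_eq_of_quot_eq {s : P.Side} {t : ℝ} (h0 : 0 < t) (h1 : t < 1) {p : Fin n × Disk}
    (h : P.quot (s.1, P.sidePoint s t) = P.quot p) :
    p = (s.1, P.sidePoint s t) ∨ p = ((P.opp s).1, P.sidePoint (P.opp s) (1 - t)) := by
  have hr := (P.quot_eq_iff _ _).1 h
  set A : Set (Fin n × Disk) :=
    {p | p = (s.1, P.sidePoint s t) ∨ p = ((P.opp s).1, P.sidePoint (P.opp s) (1 - t))}
  have hg : ∀ p p', P.Glue p p' → p ∈ A → p' ∈ A := by
    rintro _ _ ⟨s', t', h0', h1'⟩ (hA | hA)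
    · obtain ⟨rfl, rfl⟩ := P.sidePoint_inj h0 h1 h0' h1' hA
      exact .inr rfl
    · obtain ⟨rfl, rfl⟩ := P.sidePoint_inj (by linarith) (by linarith) h0' h1' hA
      left
      rw [P.opp_opp, sub_sub_cancel]
  have hiff : ∀ p p', Relation.EqvGen P.Glue p p' → (p ∈ A ↔ p' ∈ A) := by
    intro p p' hr
    induction hr with
    | rel p p' h => exact ⟨hg _ _ h, hg _ _ (P.glue_symm h)⟩
    | refl => exact Iff.rfl
    | symm _ _ _ ih => exact ih.symm
    | trans _ _ _ _ _ ih1 ih2 => exact ih1.trans ih2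
  exact (hiff _ _ hr).1 (.inl rfl)

theorem eq_or_eq_of_mem_edge {s s' : P.Side} {x : M} (h : x ∈ P.edge s) (h' : x ∈ P.edge s') :
    s' = s ∨ s' = P.opp s := by
  obtain ⟨t, ht, rfl⟩ := h
  obtain ⟨t', ht', h'⟩ := h'
  rcases eq_or_eq_of_quot_eq ht.1 ht.2 (p := (s'.1, P.sidePoint s' t')) h'.symm with h | h
  · exact .inl (P.sidePoint_inj ht.1 ht.2 ht'.1.le ht'.2.le h).1
  · exact .inr (P.sidePoint_inj (by linarith [ht.2]) (by linarith [ht.1]) ht'.1.le ht'.2.le h).1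

theorem notMem_vertices_of_mem_edge {s : P.Side} {x : M} (h : x ∈ P.edge s) :
    x ∉ P.vertices := by
  obtain ⟨t, ht, rfl⟩ := h
  rintro ⟨s', h'⟩
  rcases eq_or_eq_of_quot_eq ht.1 ht.2 (p := (s'.1, P.sidePoint s' 0)) h'.symm with h | h
  · linarith [(P.sidePoint_inj ht.1 ht.2 le_rfl zero_le_one h).2, ht.1]
  · linarith [(P.sidePoint_inj (by linarith [ht.2]) (by linarith [ht.1]) le_rfl zero_le_one h).2,
      ht.2]

variable [T2Space M]

open Classical in
/-- The flux of a curve which crosses the side `s` once. -/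
theorem flux_of_cross (hself : P.NoSelfNeighbor) {c : I → M} (hc : Continuous c) {t₀ : I}
    {s : P.Side} (h0 : 0 < t₀) (h1 : t₀ < 1) (he : c t₀ ∈ P.edge s)
    (hl : ∀ t < t₀, c t ∈ P.face s.1) (hr : ∀ t > t₀, c t ∈ P.face (P.opp s).1) :
    P.flux c = P.cls s := by
  -- A step function with its step at `t₀`. Its value at `t₀` itself depends on which of the two
  -- points over `c t₀` is picked by `rep`.
  let y : I → P.Flux := fun t => if t < t₀ ∨ (t = t₀ ∧ (P.rep (c t₀)).1 = s.1) then 0 else P.cls s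
  have hyl : ∀ t < t₀, y t = 0 := fun t ht => if_pos (.inl ht)
  have hyr : ∀ t > t₀, y t = P.cls s := fun t ht => if_neg (by
    rintro (h | ⟨h, -⟩)
    · exact lt_asymm h ht
    · exact ht.ne' h)
  have hy : IsPotential c y := by
    intro t
    rcases lt_trichotomy t t₀ with ht | rfl | ht
    · refine ⟨_, _, hl t ht, P.isLocalPotential_face _, ?_⟩
      filter_upwards [eventually_of_face hc (hl t ht) (P.isLocalPotential_face _) (hl t ht),
        gt_mem_nhds ht] with t' h2 h3
      rw [h2, hyl t ht, hyl t' h3]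
    · obtain ⟨U, D, hx, hD⟩ := P.exists_isLocalPotential hself (c t)
      refine ⟨U, D, hx, hD, ?_⟩
      obtain ⟨r, hr0, hcr⟩ := he
      have hcr' : P.quot (s.1, P.sidePoint s r) = c t := hcr
      set pa : Fin n × Disk := (s.1, P.sidePoint s r) with hpa
      set pb : Fin n × Disk := ((P.opp s).1, P.sidePoint (P.opp s) (1 - r)) with hpb
      have hab : D pb = D pa + P.cls s := hD.side s r hr0.1.le hr0.2.le (by rwa [hcr'])
      have hq : ∀ p, P.quot p = c t → p = pa ∨ p = pb := fun p hp =>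
        eq_or_eq_of_quot_eq hr0.1 hr0.2 (hcr'.trans hp.symm)
      have hev : ∀ᶠ x in 𝓝 (c t), ∀ p, P.quot p = x →
          (p.1 = s.1 → D p = D pa) ∧ (p.1 = (P.opp s).1 → D p = D pb) := by
        refine P.eventually_quot fun p hp => ?_
        have hcont : ContinuousAt (fun q : Fin n × Disk => q.1) p := continuous_fst.continuousAt
        filter_upwards [hD.eventually_eq p (by rwa [hp]),
          hcont.eventually_mem ((isOpen_discrete {p.1}).mem_nhds rfl)] with q h2 h3
        obtain h3 : q.1 = p.1 := h3
        rcases hq p hp with rfl | rfl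
        · exact ⟨fun _ => h2, fun h => absurd (h.symm.trans h3) (hself s)⟩
        · exact ⟨fun h => absurd (h3.symm.trans h) (hself s), fun _ => h2⟩
      have hyt : D (P.rep (c t)) - y t = D pa := by
        rcases hq _ (P.quot_rep (c t)) with h | h
        · have : y t = 0 := if_pos (.inr ⟨rfl, by rw [h]⟩)
          rw [h, this, sub_zero]
        · have : y t = P.cls s := if_neg (by
            rintro (h' | ⟨-, h'⟩)
            · exact lt_irrefl _ h'
            · rw [h] at h'
              exact hself s h')
          rw [h, this, hab, add_sub_cancel_right]
      filter_upwards [hc.continuousAt.eventually hev] with t' ht'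
      obtain ⟨h2, h3⟩ := ht' _ (P.quot_rep _)
      rcases lt_trichotomy t' t with h4 | rfl | h4
      · have h5 := (P.quot_mem_face.1 ((P.quot_rep (c t')).symm ▸ hl t' h4)).1
        rw [hyl t' h4, h2 h5, hyt, sub_zero]
      · rfl
      · have h5 := (P.quot_mem_face.1 ((P.quot_rep (c t')).symm ▸ hr t' h4)).1
        rw [hyr t' h4, h3 h5, hyt, hab, add_sub_cancel_right]
    · refine ⟨_, _, hr t ht, P.isLocalPotential_face _, ?_⟩
      filter_upwards [eventually_of_face hc (hr t ht) (P.isLocalPotential_face _) (hr t ht),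
        lt_mem_nhds ht] with t' h2 h3
      rw [h2, hyr t ht, hyr t' h3]
  rw [hy.flux_eq hc, hyl 0 h0, hyr 1 h1, sub_zero]

end Edges

/-! ### The flux on singular chains -/

section Homology

/-- The curve underlying a singular `1`-simplex. -/
noncomputable def simplexCurve (τ : (TopCat.toSSet.obj (TopCat.of M)).obj (.op (.mk 1))) :
    C(I, M) :=
  ((TopCat.of M).toSSetObjEquiv _ τ).comp (stdSimplexHomeomorphUnitInterval.symm : C(_, _))

theorem simplexCurve_simplex (p : C(I, M)) : simplexCurve (simplex p) = p := by
  ext t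
  simp [simplexCurve, simplex]

theorem zz_hom_ext {N : ModuleCat.{u} ℤ} {f g : ZZ.{u} ⟶ N}
    (h : f.hom (ULift.up 1) = g.hom (ULift.up 1)) : f = g := by
  ext1
  refine LinearMap.ext fun m => ?_
  have : m = m.down • (ULift.up 1 : ULift.{u} ℤ) := by
    ext1; simp
  have hm : ∀ k : ZZ.{u} →ₗ[ℤ] N, k m = m.down • k (ULift.up 1) := fun k =>
    (congrArg k this).trans (map_zsmul k.toAddMonoidHom _ _)
  rw [hm, hm, h]

variable (P) in
/-- The homomorphism from the integers with a given value at `1`. -/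
noncomputable def fromZZ : P.Flux →+ (ZZ.{u} ⟶ ModuleCat.of ℤ (ULift.{u} P.Flux)) :=
  AddMonoidHom.mk'
    (fun g => ModuleCat.ofHom ((LinearMap.toSpanSingleton ℤ _ (ULift.up g)).comp
      (ULift.moduleEquiv : ULift.{u} ℤ ≃ₗ[ℤ] ℤ).toLinearMap))
    fun g h => by
      ext1
      refine LinearMap.ext fun m => ?_
      exact smul_add m.down (ULift.up g : ULift.{u} P.Flux) (ULift.up h)

theorem fromZZ_injective : Function.Injective (fromZZ P) := by
  intro g h hgh
  have h1 : (fromZZ P g).hom (ULift.up 1) = (fromZZ P h).hom (ULift.up 1) := by rw [hgh]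
  have h2 : ∀ g, (fromZZ P g).hom (ULift.up 1) = ULift.up g := fun g =>
    one_smul ℤ (ULift.up g : ULift.{u} P.Flux)
  rw [h2, h2] at h1
  exact ULift.up_injective h1

variable (P) in
/-- The flux as a homomorphism on singular `1`-chains. -/
noncomputable def chainFlux : (chains M).X 1 ⟶ ModuleCat.of ℤ (ULift.{u} P.Flux) :=
  Limits.Cofan.IsColimit.desc
    ((TopCat.toSSet.obj (TopCat.of M)).isColimitChainComplexXCofan ZZ 1)
    fun τ => fromZZ P (P.flux (simplexCurve τ))

theorem ι_chainFlux (τ : (TopCat.toSSet.obj (TopCat.of M)).obj (.op (.mk 1))) :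
    (TopCat.toSSet.obj (TopCat.of M)).ιChainComplex τ ≫ P.chainFlux =
      fromZZ P (P.flux (simplexCurve τ)) :=
  Limits.Cofan.IsColimit.fac
    ((TopCat.toSSet.obj (TopCat.of M)).isColimitChainComplexXCofan ZZ 1) _ τ

variable [T2Space M]

/-- The triangle is simply connected, so the whole simplex has one potential. The flux of each side
is the difference of its values at two vertices, and these differences telescope. -/
theorem flux_triangle (hself : P.NoSelfNeighbor)
    (τ : (TopCat.toSSet.obj (TopCat.of M)).obj (.op (.mk 2))) :
    P.flux (simplexCurve ((TopCat.toSSet.obj (TopCat.of M)).δ 1 τ)) =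
      P.flux (simplexCurve ((TopCat.toSSet.obj (TopCat.of M)).δ 0 τ)) +
      P.flux (simplexCurve ((TopCat.toSSet.obj (TopCat.of M)).δ 2 τ)) := by
  have : ContractibleSpace (stdSimplex ℝ (Fin 3)) := (convex_stdSimplex ℝ (Fin 3)).contractibleSpace
    ⟨_, (stdSimplex.vertex (S := ℝ) (0 : Fin 3)).2⟩
  have : LocallyPathConnectedSpace (stdSimplex ℝ (Fin 3)) :=
    (convex_stdSimplex ℝ (Fin 3)).locallyPathConnectedSpace
  let T : C(stdSimplex ℝ (Fin 3), M) := (TopCat.of M).toSSetObjEquiv _ τ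
  obtain ⟨y, hy⟩ := exists_isPotential hself T
  let e : Fin 3 → I → stdSimplex ℝ (Fin 3) := fun i t =>
    stdSimplex.map (Fin.succAbove i) (stdSimplexHomeomorphUnitInterval.symm t)
  have he : ∀ i, Continuous (e i) := fun i =>
    (stdSimplex.continuous_map _).comp stdSimplexHomeomorphUnitInterval.symm.continuous
  have hs : ∀ i : Fin 3, (simplexCurve ((TopCat.toSSet.obj (TopCat.of M)).δ i τ) : I → M) =
      T ∘ e i := fun i => rfl
  have hf : ∀ i, P.flux (T ∘ e i) = y (e i 1) - y (e i 0) := fun i =>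
    (hy.comp (he i)).flux_eq (T.continuous.comp (he i))
  have v0 : stdSimplexHomeomorphUnitInterval.symm 0 = stdSimplex.vertex (S := ℝ) (0 : Fin 2) := by
    rw [Homeomorph.symm_apply_eq]; rfl
  have v1 : stdSimplexHomeomorphUnitInterval.symm 1 = stdSimplex.vertex (S := ℝ) (1 : Fin 2) := by
    rw [Homeomorph.symm_apply_eq]; rfl
  rw [hs, hs, hs, hf, hf, hf]
  simp only [e, v0, v1, stdSimplex.map_vertex]
  have f1 : Fin.succAbove (0 : Fin 3) (0 : Fin 2) = 1 := rfl
  have f2 : Fin.succAbove (0 : Fin 3) (1 : Fin 2) = 2 := rfl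
  have f3 : Fin.succAbove (1 : Fin 3) (0 : Fin 2) = 0 := rfl
  have f4 : Fin.succAbove (1 : Fin 3) (1 : Fin 2) = 2 := rfl
  have f5 : Fin.succAbove (2 : Fin 3) (0 : Fin 2) = 0 := rfl
  have f6 : Fin.succAbove (2 : Fin 3) (1 : Fin 2) = 1 := rfl
  rw [f1, f2, f3, f4, f5, f6]
  abel

theorem d_chainFlux (hself : P.NoSelfNeighbor) : (chains M).d 2 1 ≫ P.chainFlux = 0 := by
  refine SSet.chainComplex_hom_ext fun τ => ?_
  rw [SSet.ιChainComplex_d_assoc, Limits.comp_zero]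
  simp only [Preadditive.sum_comp, Preadditive.zsmul_comp, ι_chainFlux]
  have := flux_triangle (P := P) hself τ
  simp [Fin.sum_univ_succ]
  rw [this, map_add]
  abel

/-- The flux as a homomorphism on singular `1`-chains modulo boundaries. -/
noncomputable def opcyclesFlux (hself : P.NoSelfNeighbor) :
    (chains M).opcycles 1 ⟶ ModuleCat.of ℤ (ULift.{u} P.Flux) :=
  (chains M).descOpcycles P.chainFlux 2 (by simp) (d_chainFlux hself)

theorem cl_opcyclesFlux (hself : P.NoSelfNeighbor) (p : C(I, M)) :
    cl p ≫ opcyclesFlux hself = fromZZ P (P.flux p) := by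
  rw [cl, Category.assoc, opcyclesFlux, HomologicalComplex.p_descOpcycles]
  refine (ι_chainFlux (simplex p)).trans ?_
  rw [simplexCurve_simplex]

/-- The total flux of a null-homologous cycle vanishes. -/
theorem sum_flux_eq_zero (hself : P.NoSelfNeighbor) {k : ℕ} (p : Fin k → C(I, M))
    (h : (∑ i, chain (p i)) ≫ (chains M).d 1 0 = 0)
    (h0 : (cycleClass p h).hom (ULift.up 1) = 0) : ∑ i, P.flux (p i) = 0 := by
  have h1 : cycleClass p h = 0 := zz_hom_ext (by rw [h0]; rfl)
  have h2 := cycleClass_ι p h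
  rw [h1, Limits.zero_comp] at h2
  have h3 := congrArg (· ≫ opcyclesFlux hself) h2
  simp only [Limits.zero_comp, Preadditive.sum_comp, cl_opcyclesFlux] at h3
  rw [← map_sum] at h3
  exact fromZZ_injective (h3.symm.trans (map_zero _).symm)

end Homology

end Polyhedron

/-! ### One-sided neighbourhoods under reparametrization -/

section Halves

theorem firstHalf_injective : Function.Injective firstHalf := fun a b h => by
  have h' : (a : ℝ) / 2 = b / 2 := congrArg Subtype.val h
  exact Subtype.ext (by linarith)

theorem secondHalf_injective : Function.Injective secondHalf := fun a b h => by
  have h' : (1 + (a : ℝ)) / 2 = (1 + b) / 2 := congrArg Subtype.val h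
  exact Subtype.ext (by linarith)

theorem exists_half (t : I) : (∃ u, firstHalf u = t) ∨ ∃ u, secondHalf u = t := by
  rcases le_total (t : ℝ) (1 / 2) with h | h
  · exact .inl ⟨⟨2 * t, by linarith [t.2.1], by linarith⟩, Subtype.ext (by
      change 2 * (t : ℝ) / 2 = t; ring)⟩
  · exact .inr ⟨⟨2 * t - 1, by linarith, by linarith [t.2.2]⟩, Subtype.ext (by
      change (1 + (2 * (t : ℝ) - 1)) / 2 = t; ring)⟩

theorem map_firstHalf_nhdsLT (t : I) : Filter.map firstHalf (𝓝[<] t) = 𝓝[<] (firstHalf t) := by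
  have he := (firstHalf.continuous.isClosedEmbedding firstHalf_injective).isEmbedding
  rw [he.map_nhdsWithin_eq]
  congr 1
  ext u
  constructor
  · rintro ⟨v, hv, rfl⟩
    have hv : (v : ℝ) < t := hv
    change (v : ℝ) / 2 < t / 2
    linarith
  · intro hu
    have hu : (u : ℝ) < t / 2 := hu
    refine ⟨⟨2 * u, by linarith [u.2.1], by linarith [t.2.2]⟩, ?_, Subtype.ext ?_⟩
    · change 2 * (u : ℝ) < t
      linarith
    · change 2 * (u : ℝ) / 2 = u
      ring

/-- The endpoint is excluded because nothing in `I` lies to the right of `1`, while `1 / 2` has a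
right neighbourhood. -/
theorem map_firstHalf_nhdsGT {t : I} (ht : t < 1) :
    Filter.map firstHalf (𝓝[>] t) = 𝓝[>] (firstHalf t) := by
  have he := (firstHalf.continuous.isClosedEmbedding firstHalf_injective).isEmbedding
  have ht' : (t : ℝ) < 1 := ht
  have hlt : firstHalf t < firstHalf 1 := by change (t : ℝ) / 2 < 1 / 2; linarith
  rw [he.map_nhdsWithin_eq, ← nhdsWithin_Ioc_eq_nhdsGT hlt]
  congr 1
  ext u
  constructor
  · rintro ⟨v, hv, rfl⟩
    have hv : (t : ℝ) < v := hv
    constructor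
    · change (t : ℝ) / 2 < v / 2; linarith
    · change (v : ℝ) / 2 ≤ 1 / 2; linarith [v.2.2]
  · rintro ⟨hu, hu'⟩
    have hu : (t : ℝ) / 2 < u := hu
    have hu' : (u : ℝ) ≤ 1 / 2 := hu'
    refine ⟨⟨2 * u, by linarith [u.2.1], by linarith⟩, ?_, Subtype.ext ?_⟩
    · change (t : ℝ) < 2 * u
      linarith
    · change 2 * (u : ℝ) / 2 = u
      ring

theorem map_secondHalf_nhdsGT (t : I) :
    Filter.map secondHalf (𝓝[>] t) = 𝓝[>] (secondHalf t) := by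
  have he := (secondHalf.continuous.isClosedEmbedding secondHalf_injective).isEmbedding
  rw [he.map_nhdsWithin_eq]
  congr 1
  ext u
  constructor
  · rintro ⟨v, hv, rfl⟩
    have hv : (t : ℝ) < v := hv
    change (1 + (t : ℝ)) / 2 < (1 + v) / 2
    linarith
  · intro hu
    have hu : (1 + (t : ℝ)) / 2 < u := hu
    refine ⟨⟨2 * u - 1, by linarith [t.2.1], by linarith [u.2.2]⟩, ?_, Subtype.ext ?_⟩
    · change (t : ℝ) < 2 * u - 1
      linarith
    · change (1 + (2 * (u : ℝ) - 1)) / 2 = u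
      ring

theorem map_secondHalf_nhdsLT {t : I} (ht : 0 < t) :
    Filter.map secondHalf (𝓝[<] t) = 𝓝[<] (secondHalf t) := by
  have he := (secondHalf.continuous.isClosedEmbedding secondHalf_injective).isEmbedding
  have ht' : (0 : ℝ) < t := ht
  have hlt : secondHalf 0 < secondHalf t := by
    change (1 + (0 : ℝ)) / 2 < (1 + t) / 2; linarith
  rw [he.map_nhdsWithin_eq, ← nhdsWithin_Ico_eq_nhdsLT hlt]
  congr 1
  ext u
  constructor
  · rintro ⟨v, hv, rfl⟩
    have hv : (v : ℝ) < t := hv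
    constructor
    · change (1 + (0 : ℝ)) / 2 ≤ (1 + v) / 2; linarith [v.2.1]
    · change (1 + (v : ℝ)) / 2 < (1 + t) / 2; linarith
  · rintro ⟨hu', hu⟩
    have hu : (u : ℝ) < (1 + t) / 2 := hu
    have hu' : (1 + (0 : ℝ)) / 2 ≤ u := hu'
    refine ⟨⟨2 * u - 1, by linarith, by linarith [u.2.2]⟩, ?_, Subtype.ext ?_⟩
    · change 2 * (u : ℝ) - 1 < t
      linarith
    · change (1 + (2 * (u : ℝ) - 1)) / 2 = u
      ring

theorem map_symm_nhdsLT (t : I) : Filter.map σ (𝓝[<] t) = 𝓝[>] (σ t) := by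
  have he := symmHomeomorph.isEmbedding
  have := he.map_nhdsWithin_eq (Set.Iio t) t
  refine this.trans ?_
  change 𝓝[σ '' Set.Iio t] (σ t) = _
  congr 1
  ext u
  constructor
  · rintro ⟨v, hv, rfl⟩
    exact symm_lt_symm.2 hv
  · intro hu
    exact ⟨σ u, by rw [Set.mem_Iio, ← symm_lt_symm, symm_symm]; exact hu, symm_symm u⟩

theorem map_symm_nhdsGT (t : I) : Filter.map σ (𝓝[>] t) = 𝓝[<] (σ t) := by
  have h := map_symm_nhdsLT (σ t)
  rw [symm_symm] at h
  rw [← h, Filter.map_map]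
  simp [Function.comp_def]

end Halves

/-! ### Tame curves and their crossing numbers -/

namespace Polyhedron

variable {M : Type u} [TopologicalSpace M] {n : ℕ} {P : Polyhedron M n}

theorem fluxMk_opp (μ : P.Side → ℤ) : P.fluxMk (fun s => μ (P.opp s)) = -P.fluxMk μ := by
  have h : ∀ μ : P.Side → ℤ, P.fluxMk μ = ∑ s, μ s • P.cls s := by
    intro μ
    have h1 : μ = ∑ s, μ s • Pi.single s (1 : ℤ) := by
      ext s
      simp [Finset.sum_apply, Pi.single_apply]
    conv_lhs => rw [h1]
    rw [map_sum]
    exact Finset.sum_congr rfl fun s _ => map_zsmul _ _ _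
  rw [h, h, ← Finset.sum_neg_distrib, ← Equiv.sum_comp P.oppPerm (fun s => -(μ s • P.cls s))]
  refine Finset.sum_congr rfl fun s _ => ?_
  change _ = -(μ (P.opp s) • P.cls (P.opp s))
  rw [GluingPattern.cls_opp, smul_neg, neg_neg]

variable (P) in
/-- Curves between points of the faces which meet the edges at finitely many times, crossing from
one face to another at these times, together with the numbers of crossings of all sides. -/
structure IsTame {a b : M} (c : Path a b) (N : P.Side → ℕ) : Prop where
  source : ∃ j, a ∈ P.face j
  target : ∃ j, b ∈ P.face j
  avoids_vertices : ∀ t, c t ∉ P.vertices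
  finite_times : {t | c t ∈ P.edges}.Finite
  changes_face : ∀ t, c t ∈ P.edges → ∃ j k, j ≠ k ∧
    (∀ᶠ u in 𝓝[<] t, c u ∈ P.face j) ∧ (∀ᶠ u in 𝓝[>] t, c u ∈ P.face k)
  ncard_crosses : ∀ s, {t | P.Crosses c.toContinuousMap t s}.ncard = N s
  -- As a field, this needs checking only for elementary pieces, concatenations and reversals; no
  -- general curve has to be cut at its crossings.
  flux_eq : P.flux c = P.fluxMk fun s => (N s : ℤ)

theorem edge_subset_edges (s : P.Side) : P.edge s ⊆ P.edges := Set.subset_iUnion P.edge s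

theorem Crosses.mem_edges {c : C(I, M)} {t : I} {s : P.Side} (h : P.Crosses c t s) :
    c t ∈ P.edges := edge_subset_edges s h.1

section Trans

variable {a b c : M} {p : Path a b} {q : Path b c}

theorem eventually_firstHalf_iff {A B : Set M} {t : I} (ht : t < 1) :
    ((∀ᶠ u in 𝓝[<] (firstHalf t), p.trans q u ∈ A) ∧
      (∀ᶠ u in 𝓝[>] (firstHalf t), p.trans q u ∈ B)) ↔
    ((∀ᶠ u in 𝓝[<] t, p u ∈ A) ∧ (∀ᶠ u in 𝓝[>] t, p u ∈ B)) := by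
  rw [← map_firstHalf_nhdsLT, ← map_firstHalf_nhdsGT ht, Filter.eventually_map,
    Filter.eventually_map]
  simp only [trans_firstHalf]

theorem eventually_secondHalf_iff {A B : Set M} {t : I} (ht : 0 < t) :
    ((∀ᶠ u in 𝓝[<] (secondHalf t), p.trans q u ∈ A) ∧
      (∀ᶠ u in 𝓝[>] (secondHalf t), p.trans q u ∈ B)) ↔
    ((∀ᶠ u in 𝓝[<] t, q u ∈ A) ∧ (∀ᶠ u in 𝓝[>] t, q u ∈ B)) := by
  rw [← map_secondHalf_nhdsLT ht, ← map_secondHalf_nhdsGT, Filter.eventually_map,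
    Filter.eventually_map]
  simp only [trans_secondHalf]

/-- Endpoints lie in faces, so nothing is crossed at a junction of two tame curves, and one-sided
neighbourhoods can be compared at all crossing times. -/
theorem lt_one_of_mem_edges (hb : ∃ j, b ∈ P.face j) {t : I} (h : p t ∈ P.edges) : t < 1 := by
  refine lt_of_le_of_ne le_one' fun ht => ?_
  rw [ht, p.target] at h
  exact P.notMem_edges_of_mem_face hb.choose_spec h

theorem pos_of_mem_edges (ha : ∃ j, a ∈ P.face j) {t : I} (h : p t ∈ P.edges) : 0 < t := by
  refine lt_of_le_of_ne nonneg' fun ht => ?_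
  rw [← ht, p.source] at h
  exact P.notMem_edges_of_mem_face ha.choose_spec h

theorem IsTame.trans [T2Space M] (hself : P.NoSelfNeighbor) {N N' : P.Side → ℕ}
    (hp : P.IsTame p N) (hq : P.IsTame q N') : P.IsTame (p.trans q) (N + N') where
  source := hp.source
  target := hq.target
  avoids_vertices t := by
    rcases exists_half t with ⟨u, rfl⟩ | ⟨u, rfl⟩
    · rw [trans_firstHalf]; exact hp.avoids_vertices u
    · rw [trans_secondHalf]; exact hq.avoids_vertices u
  finite_times := by
    refine ((hp.finite_times.image firstHalf).union (hq.finite_times.image secondHalf)).subset ?_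
    intro t ht
    rcases exists_half t with ⟨u, rfl⟩ | ⟨u, rfl⟩
    · rw [Set.mem_ofPred_eq, trans_firstHalf] at ht
      exact .inl ⟨u, ht, rfl⟩
    · rw [Set.mem_ofPred_eq, trans_secondHalf] at ht
      exact .inr ⟨u, ht, rfl⟩
  changes_face t ht := by
    rcases exists_half t with ⟨u, rfl⟩ | ⟨u, rfl⟩
    · rw [trans_firstHalf] at ht
      obtain ⟨j, k, hjk, h⟩ := hp.changes_face u ht
      exact ⟨j, k, hjk, (eventually_firstHalf_iff (lt_one_of_mem_edges hp.target ht)).2 h⟩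
    · rw [trans_secondHalf] at ht
      obtain ⟨j, k, hjk, h⟩ := hq.changes_face u ht
      exact ⟨j, k, hjk, (eventually_secondHalf_iff (pos_of_mem_edges hq.source ht)).2 h⟩
  ncard_crosses s := by
    have h1 : ∀ u, P.Crosses (p.trans q).toContinuousMap (firstHalf u) s ↔
        P.Crosses p.toContinuousMap u s := by
      intro u
      have e : (p.trans q).toContinuousMap (firstHalf u) = p.toContinuousMap u :=
        trans_firstHalf p q u
      constructor
      · rintro ⟨h1, h2⟩
        rw [e] at h1
        exact ⟨h1, (eventually_firstHalf_iff
          (lt_one_of_mem_edges hp.target (edge_subset_edges s h1))).1 h2⟩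
      · rintro ⟨h1, h2⟩
        exact ⟨e ▸ h1, (eventually_firstHalf_iff
          (lt_one_of_mem_edges hp.target (edge_subset_edges s h1))).2 h2⟩
    have h2 : ∀ u, P.Crosses (p.trans q).toContinuousMap (secondHalf u) s ↔
        P.Crosses q.toContinuousMap u s := by
      intro u
      have e : (p.trans q).toContinuousMap (secondHalf u) = q.toContinuousMap u :=
        trans_secondHalf p q u
      constructor
      · rintro ⟨h1, h2⟩
        rw [e] at h1
        exact ⟨h1, (eventually_secondHalf_iff
          (pos_of_mem_edges hq.source (edge_subset_edges s h1))).1 h2⟩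
      · rintro ⟨h1, h2⟩
        exact ⟨e ▸ h1, (eventually_secondHalf_iff
          (pos_of_mem_edges hq.source (edge_subset_edges s h1))).2 h2⟩
    have hset : {t | P.Crosses (p.trans q).toContinuousMap t s} =
        firstHalf '' {t | P.Crosses p.toContinuousMap t s} ∪
          secondHalf '' {t | P.Crosses q.toContinuousMap t s} := by
      ext t
      constructor
      · intro ht
        rcases exists_half t with ⟨u, rfl⟩ | ⟨u, rfl⟩
        · exact .inl ⟨u, (h1 u).1 ht, rfl⟩
        · exact .inr ⟨u, (h2 u).1 ht, rfl⟩
      · rintro (⟨u, hu, rfl⟩ | ⟨u, hu, rfl⟩)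
        · exact (h1 u).2 hu
        · exact (h2 u).2 hu
    -- The only common time of the two halves is the junction, where the curve is in a face.
    have hdis : Disjoint (firstHalf '' {t | P.Crosses p.toContinuousMap t s})
        (secondHalf '' {t | P.Crosses q.toContinuousMap t s}) := by
      rw [Set.disjoint_left]
      rintro _ ⟨u, hu, rfl⟩ ⟨v, hv, huv⟩
      have h3 : (u : ℝ) < 1 := lt_one_of_mem_edges hp.target (Crosses.mem_edges hu)
      have h4 : (1 + (v : ℝ)) / 2 = u / 2 := congrArg Subtype.val huv
      linarith [v.2.1]
    have f1 : {t | P.Crosses p.toContinuousMap t s}.Finite :=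
      hp.finite_times.subset fun t ht => Crosses.mem_edges ht
    have f2 : {t | P.Crosses q.toContinuousMap t s}.Finite :=
      hq.finite_times.subset fun t ht => Crosses.mem_edges ht
    rw [hset, Set.ncard_union_eq hdis (f1.image _) (f2.image _),
      Set.ncard_image_of_injective _ firstHalf_injective,
      Set.ncard_image_of_injective _ secondHalf_injective, hp.ncard_crosses, hq.ncard_crosses,
      Pi.add_apply]
  flux_eq := by
    rw [flux_trans hself, hp.flux_eq, hq.flux_eq, ← map_add]
    congr 1

end Trans

theorem crosses_symm {a b : M} (p : Path a b) (t : I) (s : P.Side) :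
    P.Crosses p.symm.toContinuousMap t s ↔ P.Crosses p.toContinuousMap (σ t) (P.opp s) := by
  rw [Crosses, Crosses, P.edge_opp, P.opp_opp, ← map_symm_nhdsLT, ← map_symm_nhdsGT,
    Filter.eventually_map, Filter.eventually_map]
  exact and_congr Iff.rfl and_comm

theorem IsTame.symm [T2Space M] (hself : P.NoSelfNeighbor) {a b : M} {p : Path a b}
    {N : P.Side → ℕ} (hp : P.IsTame p N) : P.IsTame p.symm (fun s => N (P.opp s)) where
  source := hp.target
  target := hp.source
  avoids_vertices t := hp.avoids_vertices (σ t)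
  finite_times := (hp.finite_times.image σ).subset fun t ht => ⟨σ t, ht, symm_symm t⟩
  changes_face t ht := by
    obtain ⟨j, k, hjk, h1, h2⟩ := hp.changes_face (σ t) ht
    rw [← map_symm_nhdsGT, Filter.eventually_map] at h1
    rw [← map_symm_nhdsLT, Filter.eventually_map] at h2
    exact ⟨k, j, hjk.symm, h2, h1⟩
  ncard_crosses s := by
    simp_rw [crosses_symm]
    rw [← hp.ncard_crosses, ← Set.ncard_image_of_injective _ symmHomeomorph.injective]
    congr 1
    ext t
    constructor
    · rintro ⟨u, hu, rfl⟩
      exact hu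
    · intro ht
      exact ⟨σ t, by rw [Set.mem_ofPred_eq, symm_symm]; exact ht, symm_symm t⟩
  flux_eq := by
    rw [flux_symm hself, hp.flux_eq]
    exact (fluxMk_opp fun s => (N s : ℤ)).symm

theorem isTame_of_face [T2Space M] {a b : M} {p : Path a b} {j : Fin n}
    (h : ∀ t, p t ∈ P.face j) : P.IsTame p 0 where
  source := ⟨j, by simpa using h 0⟩
  target := ⟨j, by simpa using h 1⟩
  avoids_vertices t := P.notMem_vertices_of_mem_face (h t)
  finite_times := by
    convert Set.finite_empty
    ext t
    exact iff_of_false (P.notMem_edges_of_mem_face (h t)) (Set.notMem_empty t)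
  changes_face t ht := absurd ht (P.notMem_edges_of_mem_face (h t))
  ncard_crosses s := by
    refine (congrArg Set.ncard (Set.eq_empty_iff_forall_notMem.2 fun t h' => ?_)).trans
      (Set.ncard_empty I)
    exact P.notMem_edges_of_mem_face (h t) (Crosses.mem_edges h')
  flux_eq := by
    rw [flux_of_face p.continuous h]
    exact (map_zero P.fluxMk).symm

theorem isTame_of_cross [T2Space M] (hself : P.NoSelfNeighbor) {a b : M} {p : Path a b} {t₀ : I}
    {s : P.Side} (h0 : 0 < t₀) (h1 : t₀ < 1) (he : p t₀ ∈ P.edge s)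
    (hl : ∀ t < t₀, p t ∈ P.face s.1) (hr : ∀ t > t₀, p t ∈ P.face (P.opp s).1) :
    P.IsTame p (Pi.single s 1) := by
  have hedge : ∀ t, p t ∈ P.edges → t = t₀ := by
    intro t ht
    rcases lt_trichotomy t t₀ with h | h | h
    · exact absurd ht (P.notMem_edges_of_mem_face (hl t h))
    · exact h
    · exact absurd ht (P.notMem_edges_of_mem_face (hr t h))
  have hl' : ∀ᶠ u in 𝓝[<] t₀, p u ∈ P.face s.1 :=
    Filter.eventually_of_mem self_mem_nhdsWithin hl
  have hr' : ∀ᶠ u in 𝓝[>] t₀, p u ∈ P.face (P.opp s).1 :=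
    Filter.eventually_of_mem self_mem_nhdsWithin hr
  have hne : (𝓝[<] t₀).NeBot := nhdsLT_neBot_of_exists_lt ⟨0, h0⟩
  refine ⟨⟨s.1, by simpa using hl 0 h0⟩, ⟨(P.opp s).1, by simpa using hr 1 h1⟩, fun t => ?_,
    (Set.finite_singleton t₀).subset hedge, fun t ht => ?_, fun s' => ?_, ?_⟩
  · rcases lt_trichotomy t t₀ with h | rfl | h
    · exact P.notMem_vertices_of_mem_face (hl t h)
    · exact notMem_vertices_of_mem_edge he
    · exact P.notMem_vertices_of_mem_face (hr t h)
  · obtain rfl := hedge t ht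
    exact ⟨_, _, (hself s).symm, hl', hr'⟩
  · by_cases hs : s' = s
    · subst hs
      rw [Pi.single_eq_same, Set.ncard_eq_one]
      refine ⟨t₀, Set.ext fun t => ⟨fun h => hedge t (Crosses.mem_edges h), ?_⟩⟩
      rintro rfl
      exact ⟨he, hl', hr'⟩
    · rw [Pi.single_eq_of_ne hs]
      convert Set.ncard_empty I
      refine Set.eq_empty_iff_forall_notMem.2 fun t h => ?_
      obtain rfl := hedge t (Crosses.mem_edges h)
      rcases eq_or_eq_of_mem_edge he h.1 with h2 | rfl
      · exact hs h2
      -- A crossing of `P.opp s` would come from the face `(P.opp s).1`, but just before `t₀` the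
      -- curve is in `s.1`.
      · obtain ⟨u, hu1, hu2⟩ := (hl'.and h.2.1).exists
        exact hself s (P.face_unique hu2 hu1)
  · rw [flux_of_cross hself p.continuous h0 h1 he hl hr]
    refine congrArg P.fluxMk (funext fun s' => ?_)
    by_cases hs : s' = s
    · subst hs; simp
    · simp [hs]

end Polyhedron

/-! ### Nice neighbourhoods of points in faces -/

namespace Polyhedron

variable {M : Type u} [TopologicalSpace M] {n : ℕ} {P : Polyhedron M n} [T2Space M]

variable (P) in
/-- There is a tame curve from `a` to `b` inside `W` with given numbers of crossings. -/
def TameIn (W : Set M) (a b : M) (N : P.Side → ℕ) : Prop :=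
  ∃ p : Path a b, (∀ t, p t ∈ W) ∧ P.IsTame p N

theorem TameIn.trans (hself : P.NoSelfNeighbor) {W : Set M} {a b c : M} {N N' : P.Side → ℕ}
    (h : P.TameIn W a b N) (h' : P.TameIn W b c N') : P.TameIn W a c (N + N') := by
  obtain ⟨p, hp, hN⟩ := h
  obtain ⟨q, hq, hN'⟩ := h'
  refine ⟨p.trans q, fun t => ?_, hN.trans hself hN'⟩
  rcases exists_half t with ⟨u, rfl⟩ | ⟨u, rfl⟩
  · rw [trans_firstHalf]; exact hp u
  · rw [trans_secondHalf]; exact hq u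

theorem TameIn.symm (hself : P.NoSelfNeighbor) {W : Set M} {a b : M} {N : P.Side → ℕ}
    (h : P.TameIn W a b N) : P.TameIn W b a (fun s => N (P.opp s)) := by
  obtain ⟨p, hp, hN⟩ := h
  exact ⟨p.symm, fun t => hp _, hN.symm hself⟩

variable (P) in
/-- Simply connected sets whose points in the faces are joined by tame curves. -/
structure IsNice (W : Set M) : Prop where
  simplyConnected : SimplyConnectedSpace W
  exists_face : ∃ a ∈ W, ∃ j, a ∈ P.face j
  tame : ∀ a ∈ W, ∀ b ∈ W, (∃ j, a ∈ P.face j) → (∃ j, b ∈ P.face j) → ∃ N, P.TameIn W a b N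

/-- The characteristic map is injective on the open disk, hence embeds a small closed Euclidean disk
around the point; curves in it cross nothing. -/
theorem exists_isNice_of_mem_face {x : M} {j : Fin n} (hx : x ∈ P.face j) {O : Set M}
    (hO : O ∈ 𝓝 x) : ∃ W, P.IsNice W ∧ W ∈ 𝓝 x ∧ W ⊆ O := by
  obtain ⟨z, hz, rfl⟩ := hx
  have hz : ‖(z : ℂ)‖ < 1 := hz
  obtain ⟨ε, hε, hball⟩ := Metric.mem_nhds_iff.1
    ((P.char j).continuous.continuousAt.preimage_mem_nhds hO)
  obtain ⟨δ, hδ0, hδ⟩ := exists_between (lt_min hε (sub_pos.2 hz))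
  set B : Set ℂ := Metric.closedBall (z : ℂ) δ
  have hB : ∀ w ∈ B, ‖w‖ < 1 := by
    intro w hw
    have h1 : ‖w - z‖ ≤ δ := by rw [← dist_eq_norm]; exact hw
    have h2 := norm_le_norm_add_norm_sub' w z
    linarith [hδ.trans_le (min_le_right _ _)]
  let i : B → Disk := fun w => ⟨w, mem_closedBall_zero_iff.2 (hB w w.2).le⟩
  let e : B → M := fun w => P.char j (i w)
  have he : Continuous e := (P.char j).continuous.comp (continuous_subtype_val.subtype_mk _)
  have hf : ∀ w, e w ∈ P.face j := fun w => ⟨i w, hB w w.2, rfl⟩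
  have hinj : Function.Injective e := by
    intro w w' h
    have := P.eq_of_quot_eq (p := (j, i w)) (p' := (j, i w')) h (hB w w.2)
    exact Subtype.ext (congrArg (fun p : Fin n × Disk => (p.2 : ℂ)) this).symm
  have hcomp : CompactSpace B := isCompact_iff_compactSpace.1 (isCompact_closedBall _ _)
  have hcontr : ContractibleSpace B :=
    (convex_closedBall (z : ℂ) δ).contractibleSpace ⟨z, Metric.mem_closedBall_self hδ0.le⟩
  have hemb := he.isClosedEmbedding hinj
  have hcontr' : ContractibleSpace (Set.range e) :=
    hemb.isEmbedding.toHomeomorph.symm.contractibleSpace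
  refine ⟨Set.range e, ⟨inferInstance, ⟨_, ⟨⟨z, Metric.mem_closedBall_self hδ0.le⟩, rfl⟩, j, hf _⟩,
    ?_⟩, ?_, ?_⟩
  · rintro _ ⟨a, rfl⟩ _ ⟨b, rfl⟩ - -
    exact ⟨0, (PathConnectedSpace.somePath a b).map he, fun t => ⟨_, rfl⟩,
      isTame_of_face fun t => hf _⟩
  · have h : ∀ᶠ x in 𝓝 (P.char j z), ∀ p, P.quot p = x → p.1 = j ∧ (p.2 : ℂ) ∈ B := by
      refine P.eventually_quot fun p hp => ?_
      obtain rfl := P.eq_of_quot_eq (p := (j, z)) (p' := p) hp.symm hz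
      have c1 : Continuous fun q : Fin n × Disk => q.1 := continuous_fst
      have c2 : Continuous fun q : Fin n × Disk => (q.2 : ℂ) :=
        continuous_subtype_val.comp continuous_snd
      exact (c1.continuousAt.eventually_mem ((isOpen_discrete {j}).mem_nhds (Set.mem_singleton j))).and
        (c2.continuousAt.eventually_mem (Metric.closedBall_mem_nhds _ hδ0))
    filter_upwards [h] with x hx
    obtain ⟨⟨k, w⟩, rfl⟩ := P.quot_surjective x
    obtain ⟨rfl, h2⟩ := hx (k, w) rfl
    exact ⟨⟨w, h2⟩, rfl⟩
  · rintro _ ⟨w, rfl⟩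
    refine hball (?_ : i w ∈ Metric.ball z ε)
    have : dist (w : ℂ) z ≤ δ := w.2
    exact this.trans_lt (hδ.trans_le (min_le_left _ _))

end Polyhedron

/-! ### Tame curves in star neighbourhoods -/

namespace GluingPattern.Star

variable {n : ℕ} {P₀ : GluingPattern n} (T : P₀.Star)

/-- The inner radius of the corners. -/
def inner : Set.Icc (1 - T.rad) 1 :=
  ⟨1 - T.rad, by have := T.rad_pos; constructor <;> linarith⟩

theorem inner_lt : (T.inner : ℝ) < 1 := by
  have := T.rad_pos
  change 1 - T.rad < 1
  linarith

theorem iterate_mem (k : ℕ) : T.rot.SameCycle T.base (T.rot^[k] T.base) :=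
  ⟨k, by rw [Equiv.Perm.iterate_eq_pow]; simp⟩

theorem convexComb_lt_one {r r' : Set.Icc (1 - T.rad) 1} {t : I} (hr : (r : ℝ) < 1) (ht : t < 1) :
    (Set.Icc.convexComb r r' t : ℝ) < 1 := by
  have ht : (t : ℝ) < 1 := ht
  rw [Set.Icc.coe_convexComb]
  nlinarith [mul_pos (sub_pos.2 ht) (sub_pos.2 hr), mul_nonneg t.2.1 (sub_nonneg.2 r'.2.2)]

theorem convexComb_lt_one' {r r' : Set.Icc (1 - T.rad) 1} {t : I} (hr : (r' : ℝ) < 1)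
    (ht : 0 < t) : (Set.Icc.convexComb r r' t : ℝ) < 1 := by
  have ht : 0 < (t : ℝ) := ht
  rw [Set.Icc.coe_convexComb]
  nlinarith [mul_pos ht (sub_pos.2 hr), mul_nonneg (sub_nonneg.2 t.2.2) (sub_nonneg.2 r.2.2)]

variable {M : Type u} [TopologicalSpace M] (P : Polyhedron M n) (T : P.Star)

/-- A point of the surface inside a corner. -/
noncomputable def innerPoint (c : T.Corner) : M := P.quot (T.pt (c, T.zero, T.inner))

theorem quot_pt_mem_face (a : T.Box) : P.quot (T.pt a) ∈ P.face a.1.1.1 ↔ (a.2.2 : ℝ) < 1 := by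
  rw [P.quot_mem_face, T.norm_pt]
  exact and_iff_right rfl

theorem quot_pt_mem_face' {a : T.Box} {j : Fin n} (h : P.quot (T.pt a) ∈ P.face j) :
    (a.2.2 : ℝ) < 1 := by
  rw [P.quot_mem_face, T.norm_pt] at h
  exact h.2

/-- The image of a straight path in a corner. -/
noncomputable def cornerPath (c : T.Corner) (v v' : Set.Icc (-T.rad) T.rad)
    (r r' : Set.Icc (1 - T.rad) 1) :
    Path (P.quot (T.pt (c, v, r))) (P.quot (T.pt (c, v', r'))) where
  toFun t := P.quot (T.pt (c, Set.Icc.convexComb v v' t, Set.Icc.convexComb r r' t))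
  continuous_toFun := P.continuous_quot.comp (T.continuous_pt.comp (continuous_const.prodMk
    ((Set.Icc.continuous_convexComb v v').prodMk (Set.Icc.continuous_convexComb r r'))))
  source' := by simp
  target' := by simp

theorem cornerPath_mem_nbhd (c : T.Corner) (v v' : Set.Icc (-T.rad) T.rad)
    (r r' : Set.Icc (1 - T.rad) 1) (t : I) : T.cornerPath P c v v' r r' t ∈ T.nbhd P :=
  ⟨_, rfl⟩

variable [T2Space M]

theorem tameIn_corner (c : T.Corner) (v v' : Set.Icc (-T.rad) T.rad)
    (r r' : Set.Icc (1 - T.rad) 1) (hr : (r : ℝ) < 1) (hr' : (r' : ℝ) < 1) :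
    P.TameIn (T.nbhd P) (P.quot (T.pt (c, v, r))) (P.quot (T.pt (c, v', r'))) 0 := by
  refine ⟨T.cornerPath P c v v' r r', T.cornerPath_mem_nbhd P c v v' r r',
    Polyhedron.isTame_of_face (j := c.1.1) fun t => (T.quot_pt_mem_face P (c, _, _)).2 ?_⟩
  rcases (le_one' : t ≤ 1).lt_or_eq with ht | rfl
  · exact T.convexComb_lt_one hr ht
  · change (Set.Icc.convexComb r r' 1 : ℝ) < 1
    rwa [Set.Icc.convexComb_one]

/-- The curve runs straight to the boundary of the corner at `v = rad`, which is glued to `v = -rad`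
in the next corner, and from there straight to the inner point. -/
theorem tameIn_rotCorner (hself : P.NoSelfNeighbor) (hT : ∀ c, (T.rot c).1 = (P.opp c).1)
    (c : T.Corner) :
    P.TameIn (T.nbhd P) (T.innerPoint P c) (T.innerPoint P (T.rotCorner c)) (Pi.single c.1 1) := by
  change P.TameIn (T.nbhd P) (P.quot (T.pt (c, T.zero, T.inner)))
    (P.quot (T.pt (T.rotCorner c, T.zero, T.inner))) _
  -- Positivity of `v` places the crossing in the open edge, away from the centre, which may be a
  -- vertex.
  let v : Set.Icc (-T.rad) T.rad := ⟨T.rad, by have := T.rad_pos; constructor <;> linarith⟩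
  have hv : (0 : ℝ) < v := T.rad_pos
  have hglue := T.quot_rotCorner P c v hv.le
  let p := T.cornerPath P c T.zero v T.inner T.one
  let q := (T.cornerPath P (T.rotCorner c) (T.neg v) T.zero T.one T.inner).cast hglue rfl
  have hp : ∀ t < 1, p t ∈ P.face c.1.1 := fun t ht =>
    (T.quot_pt_mem_face P (c, _, _)).2 (T.convexComb_lt_one T.inner_lt ht)
  have hq : ∀ t > 0, q t ∈ P.face (P.opp c.1).1 := fun t ht => by
    rw [← hT]
    exact (T.quot_pt_mem_face P (T.rotCorner c, _, _)).2 (T.convexComb_lt_one' T.inner_lt ht)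
  refine ⟨p.trans q, fun t => ?_, Polyhedron.isTame_of_cross hself
    (t₀ := firstHalf 1) ?_ ?_ ?_ ?_ ?_⟩
  · rcases exists_half t with ⟨u, rfl⟩ | ⟨u, rfl⟩
    · rw [trans_firstHalf]; exact T.cornerPath_mem_nbhd P _ _ _ _ _ u
    · rw [trans_secondHalf]; exact T.cornerPath_mem_nbhd P _ _ _ _ _ u
  · change (0 : ℝ) < 1 / 2; norm_num
  · change (1 : ℝ) / 2 < 1; norm_num
  · rw [trans_firstHalf, p.target]
    obtain ⟨t, -, -, ht, h, -⟩ := T.side c.1 c.2 v hv.le v.2.2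
    refine ⟨t, ht hv, ?_⟩
    exact congrArg P.quot h
  · intro t ht
    rcases exists_half t with ⟨u, rfl⟩ | ⟨u, rfl⟩
    · rw [trans_firstHalf]
      refine hp u ?_
      have ht : (u : ℝ) / 2 < 1 / 2 := ht
      change (u : ℝ) < 1
      linarith
    · have ht : (1 + (u : ℝ)) / 2 < 1 / 2 := ht
      linarith [u.2.1]
  · intro t ht
    rcases exists_half t with ⟨u, rfl⟩ | ⟨u, rfl⟩
    · have ht : (1 : ℝ) / 2 < u / 2 := ht
      linarith [u.2.2]
    · rw [trans_secondHalf]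
      refine hq u ?_
      have ht : (1 : ℝ) / 2 < (1 + u) / 2 := ht
      change (0 : ℝ) < u
      linarith

/-- After a full period of `rot` this curve closes up to a loop around the centre, whose crossing
vector at a vertex is the vertex relation. -/
theorem tameIn_iterate (hself : P.NoSelfNeighbor) (hT : ∀ c, (T.rot c).1 = (P.opp c).1) (k : ℕ) :
    P.TameIn (T.nbhd P) (T.innerPoint P T.baseCorner)
      (T.innerPoint P ⟨_, T.iterate_mem k⟩)
      (∑ i ∈ Finset.range k, Pi.single (T.rot^[i] T.base) 1) := by
  induction k with
  | zero =>
    rw [Finset.sum_range_zero]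
    exact T.tameIn_corner P T.baseCorner _ _ _ _ T.inner_lt T.inner_lt
  | succ k ih =>
    rw [Finset.sum_range_succ]
    have h := T.tameIn_rotCorner P hself hT ⟨_, T.iterate_mem k⟩
    have e : T.rotCorner ⟨_, T.iterate_mem k⟩ = ⟨_, T.iterate_mem (k + 1)⟩ :=
      Subtype.ext (Function.iterate_succ_apply' _ _ _).symm
    rw [e] at h
    exact ih.trans hself h

theorem tameIn_innerPoint (hself : P.NoSelfNeighbor) (hT : ∀ c, (T.rot c).1 = (P.opp c).1)
    (c : T.Corner) :
    ∃ N, P.TameIn (T.nbhd P) (T.innerPoint P T.baseCorner) (T.innerPoint P c) N := by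
  induction c using T.corner_induction with
  | h0 => exact ⟨0, T.tameIn_corner P T.baseCorner _ _ _ _ T.inner_lt T.inner_lt⟩
  | h1 c ih =>
    obtain ⟨N, hN⟩ := ih
    exact ⟨_, hN.trans hself (T.tameIn_rotCorner P hself hT c)⟩

/-- A point with `r < 1` is joined to the inner point of its corner without crossings, and all inner
points are joined by turning around the centre. -/
theorem isNice_nbhd (hself : P.NoSelfNeighbor) (hT : ∀ c, (T.rot c).1 = (P.opp c).1) :
    P.IsNice (T.nbhd P) where
  simplyConnected := by
    have := T.contractibleSpace_nbhd P
    infer_instance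
  exists_face := ⟨T.innerPoint P T.baseCorner, ⟨_, rfl⟩, _,
    (T.quot_pt_mem_face P (T.baseCorner, _, _)).2 T.inner_lt⟩
  tame := by
    rintro _ ⟨⟨c, v, r⟩, rfl⟩ _ ⟨⟨c', v', r'⟩, rfl⟩ ⟨j, hj⟩ ⟨j', hj'⟩
    have hr := T.quot_pt_mem_face' P hj
    have hr' := T.quot_pt_mem_face' P hj'
    obtain ⟨N, hN⟩ := T.tameIn_innerPoint P hself hT c
    obtain ⟨N', hN'⟩ := T.tameIn_innerPoint P hself hT c'
    exact ⟨_, (((T.tameIn_corner P c v T.zero r T.inner hr T.inner_lt).trans hself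
      (hN.symm hself)).trans hself hN').trans hself
      (T.tameIn_corner P c' T.zero v' T.inner r' T.inner_lt hr')⟩

end GluingPattern.Star

namespace Polyhedron

variable {M : Type u} [TopologicalSpace M] [T2Space M] {n : ℕ} {P : Polyhedron M n}

/-- Every point of the surface has arbitrarily small nice neighbourhoods. -/
theorem exists_isNice (hself : P.NoSelfNeighbor) (x : M) {O : Set M} (hO : O ∈ 𝓝 x) :
    ∃ W, P.IsNice W ∧ W ∈ 𝓝 x ∧ W ⊆ O := by
  rcases P.exists_face_or x with ⟨j, hj⟩ | ⟨j, z, hz, rfl⟩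
  · exact exists_isNice_of_mem_face hj hO
  · obtain ⟨T, hT, h⟩ := P.exists_star hself j z hz
    have hc : T.center P = P.quot (j, z) := by rw [← hT]; rfl
    have hrot : ∀ c, (T.rot c).1 = (P.opp c).1 := by
      rcases h with ⟨h, -⟩ | h <;> rw [h] <;> exact fun c => rfl
    obtain ⟨δ, h0, h1, h2⟩ := T.exists_shrink P (O := O) (by rwa [hc])
    refine ⟨_, (T.shrink δ h0 h1).isNice_nbhd P hself hrot, ?_, h2⟩
    have := (T.shrink δ h0 h1).nbhd_mem_nhds P
    rwa [show (T.shrink δ h0 h1).center P = P.quot (j, z) from hc] at this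

/-- Small tame loops around a vertex. -/
theorem exists_vertex_loop (hself : P.NoSelfNeighbor) (s : P.Side) {O : Set M}
    (hO : O ∈ 𝓝 (P.char s.1 (P.sidePoint s 0))) : ∃ W a, W ⊆ O ∧ SimplyConnectedSpace W ∧
      a ∈ P.face s.1 ∧ P.TameIn W a a
        (∑ i ∈ Finset.range (Function.minimalPeriod P.rot s), Pi.single (P.rot^[i] s) 1) := by
  let T : P.Star := P.vertexStar s
  have hc : T.center P = P.char s.1 (P.sidePoint s 0) := by
    rw [GluingPattern.sidePoint_eq_polar]
    change P.quot _ = P.quot (s.1, P.polar s.1 ((s.2 : ℕ) + 0) 1)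
    simp [T, GluingPattern.Star.pt, GluingPattern.Star.baseCorner, GluingPattern.Star.zero,
      GluingPattern.Star.one, GluingPattern.cornerPoint, GluingPattern.vertexStar]
  obtain ⟨δ, h0, h1, h2⟩ := T.exists_shrink P (O := O) (by rwa [hc])
  set T' := T.shrink δ h0 h1
  have hrot : ∀ c, (T'.rot c).1 = (P.opp c).1 := fun c => rfl
  refine ⟨_, T'.innerPoint P T'.baseCorner, h2, (T'.isNice_nbhd P hself hrot).simplyConnected,
    (T'.quot_pt_mem_face P (T'.baseCorner, _, _)).2 T'.inner_lt, ?_⟩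
  have := T'.tameIn_iterate P hself hrot (Function.minimalPeriod P.rot s)
  have e : (⟨_, T'.iterate_mem (Function.minimalPeriod P.rot s)⟩ : T'.Corner) = T'.baseCorner :=
    Subtype.ext (Function.iterate_minimalPeriod (f := P.rot) (x := s))
  rwa [e] at this

end Polyhedron

/-! ### Tame paths of configurations -/

section Product

variable {n : ℕ} {M : Type u} [TopologicalSpace M]

/-- Curves in disjoint sets form a path of configurations. -/
theorem exists_path_confBox {N : Fin n → Set M} (hN : Pairwise (Function.onFun Disjoint N))
    {a b : Conf n M} (q : ∀ i, Path (a.1 i) (b.1 i)) (hq : ∀ i t, q i t ∈ N i) :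
    ∃ p : Path a b, (∀ t, p t ∈ confBox N) ∧ ∀ i t, (p t).1 i = q i t := by
  refine ⟨⟨⟨fun t => ⟨fun i => q i t, fun i j hij => ?_⟩, ?_⟩, ?_, ?_⟩,
    fun t i => hq i t, fun i t => rfl⟩
  · by_contra hne
    have hij : q i t = q j t := hij
    exact Set.disjoint_left.1 (hN hne) (hq i t) (hij ▸ hq j t)
  · exact Continuous.subtype_mk (continuous_pi fun i => (q i).continuous) _
  · exact Subtype.ext (funext fun i => (q i).source)
  · exact Subtype.ext (funext fun i => (q i).target)

theorem confBox_mem_nhds {N : Fin n → Set M} {z : Conf n M} (h : ∀ i, N i ∈ 𝓝 (z.1 i)) :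
    confBox N ∈ 𝓝 z :=
  Filter.eventually_all.2 fun i => (coord i).continuous.continuousAt.eventually_mem (h i)

theorem exists_confBox_subset {z : Conf n M} {O : Set (Conf n M)} (hO : O ∈ 𝓝 z) :
    ∃ V : Fin n → Set M, (∀ i, V i ∈ 𝓝 (z.1 i)) ∧ confBox V ⊆ O := by
  rw [show 𝓝 z = Filter.comap Subtype.val (𝓝 z.1) from nhds_induced _ _, nhds_pi] at hO
  obtain ⟨S, hS, hSO⟩ := hO
  obtain ⟨F, hF, V, hV, hVS⟩ := Filter.mem_pi.1 hS
  exact ⟨V, hV, fun y hy => hSO (hVS fun i _ => hy i)⟩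

end Product

namespace Polyhedron

variable {M : Type u} [TopologicalSpace M] [T2Space M] {n : ℕ} (P : Polyhedron M n)

/-- Paths of configurations all of whose constituents are tame, with the total numbers of
crossings. -/
def ConfTame {x y : Conf n M} (p : Path x y) (N : P.Side → ℕ) : Prop :=
  ∃ μ : Fin n → P.Side → ℕ,
    (∀ i, P.IsTame (p.map (coord i).continuous) (μ i)) ∧ N = ∑ i, μ i

variable {P}

theorem ConfTame.refl {x : Conf n M} (hx : ∀ i, ∃ j, x.1 i ∈ P.face j) :
    P.ConfTame (Path.refl x) 0 := by
  refine ⟨0, fun i => ?_, by simp⟩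
  obtain ⟨j, hj⟩ := hx i
  exact isTame_of_face fun t => hj

theorem ConfTame.trans (hself : P.NoSelfNeighbor) {x y z : Conf n M} {p : Path x y} {q : Path y z}
    {N N' : P.Side → ℕ} (hp : P.ConfTame p N) (hq : P.ConfTame q N') :
    P.ConfTame (p.trans q) (N + N') := by
  obtain ⟨μ, hμ, rfl⟩ := hp
  obtain ⟨ν, hν, rfl⟩ := hq
  refine ⟨μ + ν, fun i => ?_, by simp [Finset.sum_add_distrib]⟩
  rw [Path.map_trans]
  exact (hμ i).trans hself (hν i)

theorem ConfTame.symm (hself : P.NoSelfNeighbor) {x y : Conf n M} {p : Path x y}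
    {N : P.Side → ℕ} (hp : P.ConfTame p N) : P.ConfTame p.symm fun s => N (P.opp s) := by
  obtain ⟨μ, hμ, rfl⟩ := hp
  refine ⟨fun i s => μ i (P.opp s), fun i => ?_, ?_⟩
  · rw [← Path.map_symm]
    exact (hμ i).symm hself
  · ext s
    simp [Finset.sum_apply]

/-- Paths of configurations can be made tame by a homotopy. -/
theorem exists_confTame_homotopic (hself : P.NoSelfNeighbor) {x y : Conf n M}
    (hx : ∀ i, ∃ j, x.1 i ∈ P.face j) (hy : ∀ i, ∃ j, y.1 i ∈ P.face j) (p : Path x y) :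
    ∃ (p' : Path x y) (N : P.Side → ℕ), P.ConfTame p' N ∧ p'.Homotopic p := by
  suffices h : ∃ p' : Path x y, (∃ N, P.ConfTame p' N) ∧ p'.Homotopic p by
    obtain ⟨p', ⟨N, hN⟩, h⟩ := h
    exact ⟨p', N, hN, h⟩
  -- The neighbourhoods are boxes of pairwise disjoint nice sets, so connecting paths and homotopies
  -- are found one coordinate at a time.
  refine exists_homotopic_of_nhds_basis
    {x : Conf n M | ∀ i, ∃ j, x.1 i ∈ P.face j}
    (fun x y (p : Path x y) => ∃ N, P.ConfTame p N)
    (fun x hx => ⟨0, .refl hx⟩)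
    (fun x y z p q ⟨N, hN⟩ ⟨N', hN'⟩ => ⟨N + N', hN.trans hself hN'⟩)
    {B | ∃ N : Fin n → Set M, B = confBox N ∧ Pairwise (Function.onFun Disjoint N) ∧
      ∀ i, P.IsNice (N i)}
    ?_ ?_ ?_ ?_ hx hy p
  · intro z O hO
    obtain ⟨V, hV, hVO⟩ := exists_confBox_subset hO
    obtain ⟨U, hU, hdis⟩ := (Set.finite_range z.1).t2_separation
    choose N hN hNz hNV using fun i => P.exists_isNice hself (z.1 i)
      (Filter.inter_mem (hV i) ((hU (z.1 i)).2.mem_nhds (hU _).1))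
    refine ⟨confBox N, ⟨N, rfl, fun i j hij => ?_, hN⟩, confBox_mem_nhds hNz,
      fun y hy => hVO fun i => (hNV i (hy i)).1⟩
    exact (hdis ⟨i, rfl⟩ ⟨j, rfl⟩ (z.2.ne hij)).mono (fun w hw => (hNV i hw).2)
      fun w hw => (hNV j hw).2
  · rintro _ ⟨N, rfl, hdis, hN⟩ a ha
    choose y hy hf using fun i => (hN i).exists_face
    let b : Conf n M := ⟨y, fun i j hij => by
      by_contra hne
      exact Set.disjoint_left.1 (hdis hne) (hy i) (hij ▸ hy j)⟩
    have hq : ∀ i, ∃ q : Path (a.1 i) (b.1 i), ∀ t, q t ∈ N i := fun i => by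
      have := (hN i).simplyConnected
      have hc : IsPathConnected (N i) := isPathConnected_iff_pathConnectedSpace.2 inferInstance
      obtain ⟨q, hq⟩ := hc.joinedIn _ (ha i) _ (hy i)
      exact ⟨q, hq⟩
    choose q hq using hq
    obtain ⟨p, hp, -⟩ := exists_path_confBox hdis q hq
    exact ⟨b, ⟨hf, hy⟩, p, hp⟩
  · rintro _ ⟨N, rfl, hdis, hN⟩ a b p q hp hq
    exact confBox_homotopic hdis (fun i => (hN i).simplyConnected) p q hp hq
  · rintro _ ⟨N, rfl, hdis, hN⟩ a ⟨ha, ha'⟩ b ⟨hb, hb'⟩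
    choose μ q hq hμ using fun i => (hN i).tame _ (ha' i) _ (hb' i) (ha i) (hb i)
    obtain ⟨p, hp, hpq⟩ := exists_path_confBox hdis q hq
    refine ⟨p, ⟨_, μ, fun i => ?_, rfl⟩, hp⟩
    have e : p.map (coord i).continuous = q i := Path.ext (funext (hpq i))
    exact e ▸ hμ i

end Polyhedron

/-! ### Null-homotopic loops that realize the relations -/

namespace Polyhedron

variable {M : Type u} [TopologicalSpace M] {n : ℕ} {P : Polyhedron M n}

theorem isPathConnected_face (j : Fin n) : IsPathConnected (P.face j) := by
  have hb : IsPathConnected (Metric.ball (0 : ℂ) 1) :=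
    (convex_ball 0 1).isPathConnected ⟨0, Metric.mem_ball_self one_pos⟩
  have := isPathConnected_iff_pathConnectedSpace.1 hb
  let f : Metric.ball (0 : ℂ) 1 → M := fun w => P.char j ⟨w, Metric.ball_subset_closedBall w.2⟩
  have hf : Continuous f := (P.char j).continuous.comp (continuous_subtype_val.subtype_mk _)
  have h : P.face j = Set.range f := by
    ext m
    constructor
    · rintro ⟨z, hz, rfl⟩
      exact ⟨⟨z, mem_ball_zero_iff.2 hz⟩, rfl⟩
    · rintro ⟨w, rfl⟩
      exact ⟨_, mem_ball_zero_iff.1 w.2, rfl⟩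
  rw [h]
  exact isPathConnected_range hf

theorem IsTame.congr {a b a' b' : M} {p : Path a b} {p' : Path a' b'} {N : P.Side → ℕ}
    (hp : P.IsTame p N) (h : ⇑p' = ⇑p) : P.IsTame p' N := by
  obtain rfl : a' = a := by rw [← p.source, ← h, p'.source]
  obtain rfl : b' = b := by rw [← p.target, ← h, p'.target]
  rwa [Path.ext h]

variable [T2Space M]

/-- Moving one point of a configuration once around a vertex gives a null-homotopic loop. -/
theorem exists_vertex_confTame (hself : P.NoSelfNeighbor) (x : Conf n M)
    (hx : ∀ j, x.1 j ∈ P.face j) (s : P.Side) :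
    ∃ ℓ : Path x x, ℓ.Homotopic (Path.refl x) ∧ P.ConfTame ℓ
      (∑ i ∈ Finset.range (Function.minimalPeriod P.rot s), Pi.single (P.rot^[i] s) 1) := by
  set N := ∑ i ∈ Finset.range (Function.minimalPeriod P.rot s),
    (Pi.single (P.rot^[i] s) 1 : P.Side → ℕ)
  set j := s.1
  -- The points of `x` lie in faces, so a small neighbourhood of the vertex contains none of them.
  have hO : (Set.range x.1)ᶜ ∈ 𝓝 (P.char s.1 (P.sidePoint s 0)) := by
    refine (Set.finite_range x.1).isClosed.isOpen_compl.mem_nhds ?_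
    rintro ⟨k, hk⟩
    exact P.notMem_vertices_of_mem_face (hx k) ⟨s, hk.symm⟩
  obtain ⟨W, a, hWO, hW, ha, ℓ, hℓW, hℓ⟩ := exists_vertex_loop hself s hO
  -- The positions available to the point `j` while the others stay fixed; `A` contains the face `j`
  -- and the neighbourhood `W` of the vertex.
  let A : Set M := {m | ∀ k, k ≠ j → m ≠ x.1 k}
  have hWA : W ⊆ A := fun w hw k _ h => hWO hw ⟨k, h.symm⟩
  have hfA : P.face j ⊆ A := fun m hm k hk h => hk (P.face_unique (h ▸ hx k) hm)
  let ins : A → Conf n M := fun m => ⟨Function.update x.1 j m, by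
    intro k l h
    by_cases hk : k = j <;> by_cases hl : l = j
    · rw [hk, hl]
    · subst hk
      rw [Function.update_self, Function.update_of_ne hl] at h
      exact absurd h (m.2 l hl)
    · subst hl
      rw [Function.update_self, Function.update_of_ne hk] at h
      exact absurd h.symm (m.2 k hk)
    · rw [Function.update_of_ne hk, Function.update_of_ne hl] at h
      exact x.2 h⟩
  have hins : Continuous ins :=
    Continuous.subtype_mk
    ((continuous_const (y := x.1)).update j (continuous_subtype_val (p := (· ∈ A)))) _
  obtain ⟨α, hα⟩ := (isPathConnected_face (P := P) j).joinedIn _ (hx j) _ ha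
  let x₀ : A := ⟨x.1 j, hfA (hx j)⟩
  let a₀ : A := ⟨a, hfA ha⟩
  let α' : Path x₀ a₀ := ⟨⟨fun t => ⟨α t, hfA (hα t)⟩, α.continuous.subtype_mk _⟩,
    Subtype.ext α.source, Subtype.ext α.target⟩
  let aW : W := ⟨a, by simpa using hℓW 0⟩
  let ℓW : Path aW aW := ⟨⟨fun t => ⟨ℓ t, hℓW t⟩, ℓ.continuous.subtype_mk _⟩,
    Subtype.ext ℓ.source, Subtype.ext ℓ.target⟩
  let ℓ' : Path a₀ a₀ := ℓW.map (continuous_inclusion hWA)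
  have hℓ' : ℓ'.Homotopic (Path.refl a₀) :=
    (SimplyConnectedSpace.paths_homotopic ℓW (Path.refl aW)).map ⟨_, continuous_inclusion hWA⟩
  -- The loop in `W` is contractible there; conjugation by a path in the face `j`, which crosses
  -- nothing, moves its base point to `x_j`.
  let q : Path x₀ x₀ := α'.trans (ℓ'.trans α'.symm)
  have hq : q.Homotopic (Path.refl x₀) := by
    rw [← Path.Homotopic.Quotient.eq] at hℓ' ⊢
    simp only [q, Path.Homotopic.Quotient.mk_trans, Path.Homotopic.Quotient.mk_symm] at *
    rw [hℓ']
    simp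
  have hins0 : ins x₀ = x := Subtype.ext (Function.update_eq_self j x.1)
  suffices h : ∃ ℓ : Path (ins x₀) (ins x₀), ℓ.Homotopic (Path.refl _) ∧ P.ConfTame ℓ N by
    rwa [hins0] at h
  -- Only the strand `j` moves, so it has all the crossings.
  refine ⟨q.map hins, hq.map ⟨ins, hins⟩, Pi.single j N, fun i => ?_, by simp⟩
  by_cases hi : i = j
  · subst hi
    have htα : P.IsTame α 0 := isTame_of_face hα
    have ht := htα.trans hself (hℓ.trans hself (htα.symm hself))
    have e : q.map continuous_subtype_val = α.trans (ℓ.trans α.symm) := by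
      rw [Path.map_trans, Path.map_trans]
      rfl
    have e1 : (0 + (N + fun s => (0 : P.Side → ℕ) (P.opp s)) : P.Side → ℕ) = N := by
      ext s
      simp
    rw [e1, ← e] at ht
    rw [Pi.single_eq_same]
    exact ht.congr (funext fun t => Function.update_self ..)
  · rw [Pi.single_eq_of_ne hi]
    refine isTame_of_face (j := i) fun t => ?_
    have : (((q.map hins).map (coord i).continuous) t) = x.1 i := Function.update_of_ne hi _ _
    rw [this]
    exact hx i

/-- Relations between signed edges are realized by null-homotopic loops of configurations, up to
chains in which both signs of every edge have the same multiplicity. -/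
theorem exists_nullhomotopic_confTame (hself : P.NoSelfNeighbor) (x : Conf n M)
    (hx : ∀ j, x.1 j ∈ P.face j) {μ : P.Side → ℤ} (hμ : μ ∈ P.relations) :
    ∃ (ℓ : Path x x) (N : P.Side → ℕ), ℓ.Homotopic (Path.refl x) ∧ P.ConfTame ℓ N ∧
      ∀ s, (N s : ℤ) - μ s = N (P.opp s) - μ (P.opp s) := by
  have hrefl : P.ConfTame (Path.refl x) 0 := .refl fun i => ⟨i, hx i⟩
  induction hμ using AddSubgroup.closure_induction with
  | mem μ h =>
    rcases h with ⟨s, rfl⟩ | ⟨s, rfl⟩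
    -- The relation `s + opp s` is itself invariant under `opp`, so the constant loop suffices.
    · refine ⟨_, 0, .refl _, hrefl, fun s' => ?_⟩
      have h1 : P.opp s' = s ↔ s' = P.opp s :=
        ⟨fun h => by rw [← h, P.opp_opp], fun h => by rw [h, P.opp_opp]⟩
      have h2 : P.opp s' = P.opp s ↔ s' = s :=
        ⟨fun h => by rw [← P.opp_opp s', h, P.opp_opp], fun h => by rw [h]⟩
      simp only [Pi.add_apply, Pi.single_apply, h1, h2, Pi.zero_apply]
      ring
    · obtain ⟨ℓ, h, hN⟩ := exists_vertex_confTame hself x hx s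
      refine ⟨ℓ, _, h, hN, fun s' => ?_⟩
      have e : ∀ t, ((∑ i ∈ Finset.range (Function.minimalPeriod P.rot s),
          (Pi.single (P.rot^[i] s) 1 : P.Side → ℕ)) t : ℤ) =
          (∑ i ∈ Finset.range (Function.minimalPeriod P.rot s),
            (Pi.single (P.rot^[i] s) 1 : P.Side → ℤ)) t := fun t => by
        simp [Finset.sum_apply, Pi.single_apply]
      rw [e, e, sub_self, sub_self]
  | zero => exact ⟨_, 0, .refl _, hrefl, fun s => rfl⟩
  | add μ ν _ _ ih ih' =>
    obtain ⟨ℓ, N, h, hN, hs⟩ := ih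
    obtain ⟨ℓ', N', h', hN', hs'⟩ := ih'
    refine ⟨ℓ.trans ℓ', N + N', ?_, hN.trans hself hN', fun s => ?_⟩
    · rw [← Path.Homotopic.Quotient.eq] at h h' ⊢
      rw [Path.Homotopic.Quotient.mk_trans, h, h']
      simp
    · have := hs s
      have := hs' s
      simp only [Pi.add_apply, Nat.cast_add]
      linarith
  | neg μ _ ih =>
    obtain ⟨ℓ, N, h, hN, hs⟩ := ih
    refine ⟨ℓ.symm, _, ?_, hN.symm hself, fun s => ?_⟩
    · simpa using h.symm₂
    · have := hs s
      simp only [Pi.neg_apply, P.opp_opp]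
      linarith

end Polyhedron

/-! ### Passage between ordered and unordered configurations -/

section Forget

variable {n : ℕ} {M : Type u} [TopologicalSpace M] [T2Space M]

/-- The loop of unordered configurations given by a path of ordered configurations. -/
def unordered {x y : Conf n M} (p : Path x y) (h : forget x = forget y) :
    Path (forget x) (forget x) :=
  (p.map isCoveringMap_forget.continuous).cast rfl h

theorem unordered_homotopic {x y : Conf n M} {p q : Path x y} (hpq : p.Homotopic q)
    (h : forget x = forget y) : (unordered p h).Homotopic (unordered q h) := by
  obtain ⟨F⟩ := hpq.map ⟨_, isCoveringMap_forget.continuous⟩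
  exact ⟨F.cast rfl rfl⟩

/-- By uniqueness of lifts to the covering by ordered configurations, the lift defining `strand` is
`p` itself. -/
theorem strand_unordered {x y : Conf n M} (p : Path x y) (h : forget x = forget y) (i : Fin n) :
    strand x (unordered p h) i = (p.map (coord i).continuous).toContinuousMap := by
  have : p.toContinuousMap = lift x (unordered p h) :=
    ((isCoveringMap_forget (n := n) (M := M)).eq_liftPath_iff' _).2 ⟨rfl, p.source⟩
  rw [strand, ← this]
  rfl

theorem exists_unordered_eq (x : Conf n M) (γ : Path (forget x) (forget x)) :
    ∃ (y : Conf n M) (p : Path x y) (h : forget x = forget y),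
      (∃ g : Equiv.Perm (Fin n), y = g • x) ∧ unordered p h = γ := by
  have hl := (isCoveringMap_forget (n := n) (M := M)).liftPath_lifts γ x γ.source
  have h0 := (isCoveringMap_forget (n := n) (M := M)).liftPath_zero γ x γ.source
  refine ⟨lift x γ 1, ⟨lift x γ, h0, rfl⟩, ?_, exists_perm x γ, ?_⟩
  · exact ((congrFun hl 1).trans γ.target).symm
  · exact Path.ext hl

end Forget

namespace Polyhedron

variable {M : Type u} [TopologicalSpace M] [T2Space M] {n : ℕ} {P : Polyhedron M n}

theorem ConfTame.multiplicity_unordered {x y : Conf n M} {p : Path x y} {N : P.Side → ℕ}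
    (hp : P.ConfTame p N) (h : forget x = forget y) (s : P.Side) :
    P.multiplicity x (unordered p h) s = N s := by
  obtain ⟨μ, hμ, rfl⟩ := hp
  rw [multiplicity, Finset.sum_apply]
  refine Finset.sum_congr rfl fun i _ => ?_
  rw [strand_unordered]
  exact (hμ i).ncard_crosses s

theorem ConfTame.isEnumerable_unordered {x y : Conf n M} {p : Path x y} {N : P.Side → ℕ}
    (hp : P.ConfTame p N) (h : forget x = forget y) : P.IsEnumerable x (unordered p h) := by
  obtain ⟨μ, hμ, -⟩ := hp
  refine ⟨fun i => ?_, ?_, fun i => ?_⟩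
  · rw [strand_unordered]
    exact (hμ i).avoids_vertices
  · simp_rw [strand_unordered, Set.ofPred_exists]
    exact Set.finite_iUnion fun i => (hμ i).finite_times
  · rw [strand_unordered]
    exact (hμ i).changes_face

theorem ConfTame.sum_flux_unordered {x y : Conf n M} {p : Path x y} {N : P.Side → ℕ}
    (hp : P.ConfTame p N) (h : forget x = forget y) :
    ∑ i, P.flux (strand x (unordered p h) i) = P.fluxMk fun s => (N s : ℤ) := by
  obtain ⟨μ, hμ, rfl⟩ := hp
  have e : (fun s => ((∑ i, μ i) s : ℤ)) = ∑ i, fun s => (μ i s : ℤ) := by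
    ext s
    simp [Finset.sum_apply]
  rw [e, map_sum]
  refine Finset.sum_congr rfl fun i _ => ?_
  rw [strand_unordered]
  exact (hμ i).flux_eq

end Polyhedron

end SurfaceBraid

/-! ### The balanced representative -/

theorem mainTheorem2 {M : Type*} [TopologicalSpace M] [T2Space M] [ConnectedSpace M] {n : ℕ}
    (P : SurfaceBraid.Polyhedron M n) (hself : P.NoSelfNeighbor) (hshare : P.AtMostOneSharedEdge)
    (x : SurfaceBraid.Conf n M) (hx : ∀ j, x.1 j ∈ P.face j)
    (b : FundamentalGroup (SurfaceBraid.UConf n M) (SurfaceBraid.forget x))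
    (hb : b ∈ SurfaceBraid.B0 x) :
    ∃ γ : Path (SurfaceBraid.forget x) (SurfaceBraid.forget x),
      P.IsBalanced x γ ∧ FundamentalGroup.fromPath (Path.Homotopic.Quotient.mk γ) = b := by
  induction b using Path.Homotopic.Quotient.ind with | mk γ => ?_
  have hγ : SurfaceBraid.loopClass x γ = 0 :=
    Multiplicative.ofAdd.injective (MonoidHom.mem_ker.1 hb)
  obtain ⟨_, p, h, ⟨g, rfl⟩, rfl⟩ := SurfaceBraid.exists_unordered_eq x γ
  obtain ⟨p', N, hp', hpp⟩ := SurfaceBraid.Polyhedron.exists_confTame_homotopic hself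
    (fun i => ⟨i, hx i⟩) (fun i => ⟨g⁻¹ i, hx _⟩) p
  have hpp' := SurfaceBraid.unordered_homotopic hpp h
  have hflux := SurfaceBraid.Polyhedron.sum_flux_eq_zero hself _
    (SurfaceBraid.isCycle_strand x (SurfaceBraid.unordered p' h))
    ((SurfaceBraid.loopClass_eq x hpp').trans hγ)
  -- The total flux of the tame representative is the class of `N`; its vanishing puts `N` into
  -- `relations`.
  rw [hp'.sum_flux_unordered h, SurfaceBraid.GluingPattern.fluxMk_eq_zero] at hflux
  obtain ⟨ℓ, N', hℓ, hN', hs⟩ :=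
    SurfaceBraid.Polyhedron.exists_nullhomotopic_confTame hself x hx (neg_mem hflux)
  -- The correcting loop is based at `x` and therefore goes first: `p'` ends at `g • x`, possibly a
  -- different ordering.
  have hq := hN'.trans hself hp'
  refine ⟨SurfaceBraid.unordered (ℓ.trans p') h, ⟨hq.isEnumerable_unordered h, fun s => ?_⟩, ?_⟩
  · rw [hq.multiplicity_unordered, hq.multiplicity_unordered]
    have := hs s
    simp only [Pi.neg_apply, Pi.add_apply] at this ⊢
    -- For the relation `-N`, `hs` says exactly that `N' + N` is invariant under `opp`.
    omega
  · refine congrArg FundamentalGroup.fromPath (Path.Homotopic.Quotient.eq.2 ?_)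
    refine SurfaceBraid.unordered_homotopic ?_ h
    rw [← Path.Homotopic.Quotient.eq] at hℓ hpp ⊢
    rw [Path.Homotopic.Quotient.mk_trans, hℓ, hpp]
    simp
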